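/- **PushASEP.** Let $\mathcal W=\{X\in\mathbb Z^{\mathbb N}: X(1)>X(2)>\cdots\}$ and $r,\ell\ge 0$. PushASEP is the Markov process on $\mathcal W$ with generator, on bounded cylinder functions $f$ (functions of finitely many particles), $$\mathcal L_{r,\ell}f(X)=r\sum_{k\ge1}\mathbf 1_{X(k-1)-X(k)>1}\,[f(X^{k,+})-f(X)]+\ell\sum_{k\ge1}[f(X^{k,-})-f(X)],\qquad X(0)=\infty ,$$ where $X^{k,+}$ is $X$ with particle $k$ moved one step to the right, and $X^{k,-}$ is $X$ with particle $k$ and the whole block of adjacent particles to its left (the particles $j\ge k$ with $X(j)=X(k)-(j-k)$) moved one step to the left. Here a PushASEP process means a càdlàg solution of the martingale problem for $\mathcal L_{r,\ell}$ on bounded cylinder functions. Fix labels $1\le n_1<\dots<n_m$ and $a\in\mathbb Z^m$. *Kernels on $\mathbb Z$.* Let $Q(x,y)=2^{-(x-y)}\mathbf 1_{x>y}$, with inverse $Q^{-1}(x,y)=2\cdot\mathbf 1_{x=y-1}-\mathbf 1_{x=y}$; for $n\ge1$ let $\bar Q^{(n)}(x,y)=2^{y-x}\frac1{(n-1)!}\prod_{j=1}^{n-1}(x-y-j)$;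 let $\nabla^-f(x)=f(x)-f(x-1)$, $\nabla^+f(x)=f(x+1)-f(x)$. For $s\in\mathbb R$, $e^{-s\nabla^-}(x,y)=e^{-s}\frac{s^{x-y}}{(x-y)!}\mathbf 1_{x\ge y}$ and $e^{s\nabla^+}(x,y)=e^{-s}\frac{s^{y-x}}{(y-x)!}\mathbf 1_{y\ge x}$; the exponential of the sum of these commuting operators is the product. Define $$\mathcal S_{-t,-n}=(e^{-\frac12rt\nabla^-+2\ell t\nabla^+}Q^{-n})^*\ (n\ge0),\qquad \bar{\mathcal S}_{-t,n}=\bar Q^{(n)}e^{\frac12rt\nabla^--2\ell t\nabla^+}\ (n\ge1),$$ $$\bar{\mathcal S}^{\mathrm{epi}(X)}_{-t,n}(z_1,z_2)=\mathbb E_{B_0=z_1}\big[\bar{\mathcal S}_{-t,n-\tau}(B_\tau,z_2)\mathbf 1_{\tau<n}\big],$$ where $B$ is the random walk with transition probabilities $Q$ and $\tau=\min\{k\in\{0,\dots,n-1\}:B_k>X(k+1)\}$ (with $\tau=\infty$ if there is no such $k$). Let $$K_t(n_i,\cdot;n_j,\cdot)=-Q^{n_j-n_i}\mathbf 1_{n_i<n_j}+(\mathcal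 S_{-t,-n_i})^*\,\bar{\mathcal S}^{\mathrm{epi}(X)}_{-t,n_j},\qquad \bar\chi_af(n_j,x)=f(n_j,x)\mathbf 1_{x\le a_j}.$$ The Fredholm determinant of a kernel on a countable set is given by its Fredholm series: $\det(I-K)=\sum_A(-1)^{|A|}\det(K(x,y))_{x,y\in A}$, the sum running over all finite subsets $A$. **Theorem.** Let $t\ge0$ and $X\in\mathcal W$. 1. For every positively oriented circle $\Gamma_0$ around $0$ of radius in $(0,1)$, $$\mathcal S_{-t,-n}(z_1,z_2)=\frac1{2\pi i}\oint_{\Gamma_0}dw\,\frac{(1-w)^n}{2^{z_2-z_1}w^{n+1+z_2-z_1}}e^{t[r(w-1/2)+\ell(1/w-2)]}\quad(n\ge0),$$ $$\bar{\mathcal S}_{-t,n}(z_1,z_2)=\frac1{2\pi i}\oint_{\Gamma_0}dw\,\frac{(1-w)^{z_2-z_1+n-1}}{2^{z_1-z_2}w^n}e^{t[r(w-1/2)+\ell(2-1/(1-w))]}\quad(n\ge1).$$ 2. The sums over $\mathbb Z$ that define the products $(\mathcal S_{-t,-n_i})^*\bar{\mathcal S}^{\mathrm{epi}(X)}_{-t,n_j}$,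 and the Fredholm series of $\bar\chi_aK_t\bar\chi_a$ on $\{n_1,\dots,n_m\}\times\mathbb Z$, converge absolutely. 3. The function $F_t(X;a,n)=\det(I-\bar\chi_aK_t\bar\chi_a)$ solves, for $t\ge0$ (with the one-sided derivative at $t=0$), the Kolmogorov backward equation $$\tfrac{d}{dt}F_t=\mathcal L_{r,\ell}F_t,\qquad F_0(X;a,n)=\mathbf 1_{X(n_1)>a_1,\dots,X(n_m)>a_m},$$ and it is the unique solution among functions of $(t,X)$ that, for $t$ in each bounded interval $[0,T]$, are uniformly bounded and depend only on the first $N$ particles for some $N=N(T)$. 4. For every PushASEP process $X_t$ started at $X_0\in\mathcal W$ and every $t\ge 0$, $$\mathbb P_{X_0}\big(X_t(n_j)>a_j,\ j=1,\dots,m\big)=F_t(X_0;a,n).$$ -/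

import Mathlib

open MeasureTheory ProbabilityTheory Filter Topology Set
open scoped NNReal

namespace PushASEP

noncomputable section

/-! ## Configurations and the generator -/

/-- One-sided particle configurations `X(1) > X(2) > ⋯`. Particle labels start at `1` on paper and
at `0` here: `X.1 k` is the position of the particle with label `k + 1`. -/
abbrev Config : Type := {X : ℕ → ℤ // StrictAnti X}

/-- The particle of index `k` may jump to the right: the site to its right is empty (this always
holds for the rightmost particle). -/
def CanJump (X : Config) (k : ℕ) : Prop := k = 0 ∨ 1 < X.1 (k - 1) - X.1 k

/-- The configuration after the particle of index `k` has jumped one step to the right. -/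
def jumpRight (X : Config) (k : ℕ) (h : CanJump X k) : Config :=
  ⟨Function.update X.1 k (X.1 k + 1), by
    refine strictAnti_nat_of_succ_lt fun j => ?_
    have hj : X.1 (j + 1) < X.1 j := X.2 (Nat.lt_succ_self j)
    rcases eq_or_ne (j + 1) k with h1 | h1
    · subst h1
      have h2 : j ≠ j + 1 := by omega
      rw [Function.update_self, Function.update_of_ne h2]
      rcases h with h | h
      · omega
      · have h3 : j + 1 - 1 = j := by omega
        rw [h3] at h
        omega
    · rcases eq_or_ne j k with h2 | h2
      · subst h2
        rw [Function.update_self, Function.update_of_ne h1]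
        omega
      · rw [Function.update_of_ne h1, Function.update_of_ne h2]
        exact hj⟩

/-- The particle of index `j` lies in the block of adjacent particles that starts at the particle
of index `k` and extends to its left (the block may be infinite). -/
def InBlock (X : Config) (k j : ℕ) : Prop := k ≤ j ∧ X.1 j = X.1 k - ((j : ℤ) - k)

open Classical in
/-- The configuration after the particle of index `k`, together with the block of adjacent
particles to its left, has been moved one step to the left. -/
def pushLeft (X : Config) (k : ℕ) : Config :=
  ⟨fun j => if InBlock X k j then X.1 j - 1 else X.1 j, by
    refine strictAnti_nat_of_succ_lt fun j => ?_
    have hj : X.1 (j + 1) < X.1 j := X.2 (Nat.lt_succ_self j)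
    by_cases h1 : InBlock X k j <;> by_cases h2 : InBlock X k (j + 1)
    · simp only [h1, h2, if_true]; omega
    · simp only [h1, h2, if_true, if_false]
      by_contra h3
      refine h2 ⟨by have := h1.1; omega, ?_⟩
      have h4 := h1.2
      push_cast
      omega
    · simp only [h1, h2, if_true, if_false]; omega
    · simp only [h1, h2, if_false]; exact hj⟩

/-- `f` depends only on the first `N` particles. -/
def DependsOnFirst (N : ℕ) (f : Config → ℝ) : Prop :=
  ∀ X Y : Config, (∀ k < N, X.1 k = Y.1 k) → f X = f Y

/-- Bounded cylinder functions. -/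
def IsBoundedCylinder (f : Config → ℝ) : Prop :=
  (∃ N, DependsOnFirst N f) ∧ ∃ C : ℝ, ∀ X, |f X| ≤ C

open Classical in
/-- The generator of PushASEP. On cylinder functions both sums have only finitely many non-zero
terms. -/
def generator (r ℓ : ℝ) (f : Config → ℝ) (X : Config) : ℝ :=
  r * ∑ᶠ k : ℕ, (if h : CanJump X k then f (jumpRight X k h) - f X else 0)
    + ℓ * ∑ᶠ k : ℕ, (f (pushLeft X k) - f X)

/-- A PushASEP process with right jump rate `r` and left push rate `ℓ`, started from `X₀`: a càdlàg
process whose law solves the martingale problem for the generator on bounded cylinder functions. -/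
structure IsPushASEP (r ℓ : ℝ) (X₀ : Config) {Ω : Type*} [mΩ : MeasurableSpace Ω] (P : Measure Ω)
    (𝓕 : Filtration ℝ≥0 mΩ) (X : ℝ≥0 → Ω → Config) : Prop where
  initial : ∀ᵐ ω ∂P, X 0 ω = X₀
  adapted : ∀ t k, Measurable[𝓕 t] fun ω => (X t ω).1 k
  right_continuous : ∀ ω t k, ∀ᶠ s in 𝓝[>] t, (X s ω).1 k = (X t ω).1 k
  left_limits : ∀ ω t k, ∃ c : ℤ, ∀ᶠ s in 𝓝[<] t, (X s ω).1 k = c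
  martingale : ∀ f : Config → ℝ, IsBoundedCylinder f →
    Martingale
      (fun (t : ℝ≥0) ω => f (X t ω) - ∫ s in (0 : ℝ)..t, generator r ℓ f (X s.toNNReal ω)) 𝓕 P

/-! ## The Kolmogorov backward equation -/

/-- `u` solves, for `t ≥ 0`, the backward equation `∂ₜ u = 𝓛 u` with initial condition
`u₀(X) = 1{X(n_j) > a_j for all j}`, among functions that, locally uniformly in time, are
bounded and depend on finitely many particles. (At `t = 0` the derivative is one-sided.) -/
structure IsBackwardSolution (r ℓ : ℝ) {m : ℕ} (n : Fin m → ℕ) (a : Fin m → ℤ)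
    (u : ℝ → Config → ℝ) : Prop where
  cylinder : ∀ T : ℝ, ∃ N, ∀ t ∈ Icc 0 T, DependsOnFirst N (u t)
  bounded : ∀ T : ℝ, ∃ C : ℝ, ∀ t ∈ Icc 0 T, ∀ X, |u t X| ≤ C
  equation : ∀ t : ℝ, 0 ≤ t → ∀ X,
    HasDerivWithinAt (fun s => u s X) (generator r ℓ (u t) X) (Ici 0) t
  initial_true : ∀ X : Config, (∀ j, a j < X.1 (n j - 1)) → u 0 X = 1
  initial_false : ∀ X : Config, (¬ ∀ j, a j < X.1 (n j - 1)) → u 0 X = 0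

/-! ## Kernels on `ℤ` -/

/-- Composition of kernels on `ℤ`. -/
def comp (A B : ℤ → ℤ → ℝ) (x y : ℤ) : ℝ := ∑' z, A x z * B z y

/-- Powers of a kernel on `ℤ`. -/
def kpow (A : ℤ → ℤ → ℝ) : ℕ → ℤ → ℤ → ℝ
  | 0 => fun x y => if x = y then 1 else 0
  | n + 1 => comp (kpow A n) A

/-- `Q(x,y) = 2^{-(x-y)} 1{x > y}`. -/
def Q (x y : ℤ) : ℝ := if y < x then (2 : ℝ) ^ (y - x) else 0

/-- The inverse `Q⁻¹(x,y) = 2·1{x = y - 1} - 1{x = y}` of `Q`. -/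
def Qinv (x y : ℤ) : ℝ := 2 * (if x = y - 1 then 1 else 0) - (if x = y then 1 else 0)

/-- The extension `2^{-(x-y)} ∏_{j=1}^{n-1} (x-y-j) / (n-1)!` of `Qⁿ(x,y)` from `x - y ≥ 1` to all
`x, y` (for `n ≥ 1`). -/
def Qbar (n : ℕ) (x y : ℤ) : ℝ :=
  (2 : ℝ) ^ (y - x) * (∏ j ∈ Finset.range (n - 1), ((x : ℝ) - y - (j + 1))) / (n - 1).factorial

/-- The kernel of `e^{-s∇⁻}`, `∇⁻f(x) = f(x) - f(x-1)`, for any real `s`. -/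
def expNablaMinus (s : ℝ) (x y : ℤ) : ℝ :=
  if y ≤ x then Real.exp (-s) * s ^ (x - y).toNat / (x - y).toNat.factorial else 0

/-- The kernel of `e^{s∇⁺}`, `∇⁺f(x) = f(x+1) - f(x)`, for any real `s`. -/
def expNablaPlus (s : ℝ) (x y : ℤ) : ℝ :=
  if x ≤ y then Real.exp (-s) * s ^ (y - x).toNat / (y - x).toNat.factorial else 0

/-- The kernel of `e^{-½rt∇⁻ + 2ℓt∇⁺}` (the operators `∇⁻` and `∇⁺` commute). -/
def expKernel (r ℓ t : ℝ) : ℤ → ℤ → ℝ :=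
  comp (expNablaMinus (r * t / 2)) (expNablaPlus (2 * ℓ * t))

/-- `𝓢_{-t,-n} = (e^{-½rt∇⁻ + 2ℓt∇⁺} Q^{-n})^*`. -/
def S (r ℓ t : ℝ) (n : ℕ) (z₁ z₂ : ℤ) : ℝ := comp (expKernel r ℓ t) (kpow Qinv n) z₂ z₁

/-- `𝓢̄_{-t,n} = Q̄^{(n)} e^{½rt∇⁻ - 2ℓt∇⁺}`. -/
def Sbar (r ℓ t : ℝ) (n : ℕ) : ℤ → ℤ → ℝ := comp (Qbar n) (expKernel r ℓ (-t))

/-- The contour integral for `𝓢_{-t,-n}`, over the circle of radius `ρ` around `0`. -/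
def SContour (r ℓ t : ℝ) (n : ℕ) (z₁ z₂ : ℤ) (ρ : ℝ) : ℂ :=
  (2 * Real.pi * Complex.I)⁻¹ * ∮ w in C(0, ρ),
    (1 - w) ^ n / ((2 : ℂ) ^ (z₂ - z₁) * w ^ ((n : ℤ) + 1 + z₂ - z₁)) *
      Complex.exp (t * (r * (w - 1 / 2) + ℓ * (1 / w - 2)))

/-- The contour integral for `𝓢̄_{-t,n}`, over the circle of radius `ρ` around `0`. -/
def SbarContour (r ℓ t : ℝ) (n : ℕ) (z₁ z₂ : ℤ) (ρ : ℝ) : ℂ :=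
  (2 * Real.pi * Complex.I)⁻¹ * ∮ w in C(0, ρ),
    (1 - w) ^ (z₂ - z₁ + n - 1) / ((2 : ℂ) ^ (z₁ - z₂) * w ^ n) *
      Complex.exp (t * (r * (w - 1 / 2) + ℓ * (2 - 1 / (1 - w))))

/-! ## The random walk and its hitting time -/

/-- The law of `n` independent variables with `P(ξ = i) = 2^{-(i+1)}`, `i ≥ 0`. -/
def stepLaw (n : ℕ) : Measure (Fin n → ℕ) :=
  Measure.pi fun _ => geometricMeasure ⟨1 / 2, by norm_num, by norm_num⟩

/-- The walk with transition probabilities `Q`, started from `z`: its `i`-th step is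
`-(ξ i + 1)`. -/
def walk {n : ℕ} (z : ℤ) (ξ : Fin n → ℕ) (k : ℕ) : ℤ :=
  z - ∑ i : Fin n, if (i : ℕ) < k then (ξ i : ℤ) + 1 else 0

/-- At time `k < n` the walk is in the strict epigraph of the curve `(X(k+1))_{k = 0, …, n-1}`. -/
def InEpi (X : Config) {n : ℕ} (z : ℤ) (ξ : Fin n → ℕ) (k : ℕ) : Prop :=
  k < n ∧ X.1 k < walk z ξ k

open Classical in
/-- `𝓢̄_{-t,n}^{epi(X)}(z₁,z₂) = E_{B₀ = z₁}[𝓢̄_{-t,n-τ}(B_τ, z₂) 1{τ < n}]`, where `τ` is the hitting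
time of the strict epigraph. -/
def SbarEpi (r ℓ t : ℝ) (X : Config) (n : ℕ) (z₁ z₂ : ℤ) : ℝ :=
  ∫ ξ, (if h : ∃ k, InEpi X z₁ ξ k then
      Sbar r ℓ t (n - Nat.find h) (walk z₁ ξ (Nat.find h)) z₂ else 0) ∂(stepLaw n)

/-! ## The extended kernel and its Fredholm determinant -/

/-- The kernel
`K_t(n_i,·;n_j,·) = -Q^{n_j-n_i} 1{n_i < n_j} + (𝓢_{-t,-n_i})^* 𝓢̄_{-t,n_j}^{epi(X)}`
on `{n_1, …, n_m} × ℤ`, with `n_i` represented by the index `i`. -/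
def kernel (r ℓ t : ℝ) (X : Config) {m : ℕ} (n : Fin m → ℕ) (p q : Fin m × ℤ) : ℝ :=
  -(if n p.1 < n q.1 then kpow Q (n q.1 - n p.1) p.2 q.2 else 0)
    + ∑' y : ℤ, S r ℓ t (n p.1) y p.2 * SbarEpi r ℓ t X (n q.1) y q.2

/-- The kernel `χ̄_a K_t χ̄_a`, where `χ̄_a f(n_j,x) = f(n_j,x) 1{x ≤ a_j}`. -/
def cutKernel (r ℓ t : ℝ) (X : Config) {m : ℕ} (n : Fin m → ℕ) (a : Fin m → ℤ)
    (p q : Fin m × ℤ) : ℝ :=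
  (if p.2 ≤ a p.1 then 1 else 0) * kernel r ℓ t X n p q * (if q.2 ≤ a q.1 then 1 else 0)

/-- The term of the Fredholm series of `det(I - K)` that belongs to a finite set of points:
`(-1)^{|A|} det (K(x,y))_{x,y ∈ A}`. -/
def fredholmTerm {ι : Type*} [DecidableEq ι] (K : ι → ι → ℝ) (A : Finset ι) : ℝ :=
  (-1) ^ A.card * (Matrix.of fun x y : A => K x y).det

/-- The Fredholm determinant `det(I - K)` of a kernel on a discrete space, by its Fredholm series
`∑ₖ ((-1)ᵏ / k!) ∑_{x₁, …, x_k} det(K(x_i,x_j))`, written as a sum over finite sets of points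
(the terms with two equal points vanish, and each set of `k` points has `k!` orderings). -/
def fredholmDet {ι : Type*} [DecidableEq ι] (K : ι → ι → ℝ) : ℝ :=
  ∑' A : Finset ι, fredholmTerm K A

end

end PushASEP

/-!
For a finite set `A` of points `(n_j, x)` let `D_A(t, X)` be the corresponding term of the Fredholm
series of `χ̄_a K_t χ̄_a`. The theorem rests on the fact that every single `D_A`, and not only their
sum, solves the backward equation.

The contour formulas give the time derivatives of `𝓢` and `𝓢̄`, and geometric bounds for them. The
expectation over the walk is `hit s n X y`, defined by conditioning on the first step; this makes
sense for every `X : ℕ → ℤ`, decreasing or not. In this extended sense three things hold. First,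
the time derivative of the kernel equals
`∑_k [r (K^{X + e_k} - K^X) + ℓ (K^{X - e_k} - K^X)]` for decreasing `X` (`sum_hit_move_right`,
`sum_hit_move_left`, `prodKernel_hasDerivAt`), with no exclusion or pushing. Secondly, replacing `X`
by the largest strictly decreasing configuration below it with the same first position changes
nothing (`hit_capped_self`), and applied to `X ± e_k` this operation produces exclusion and pushing
(`jump_eq_capped`, `pushLeft_eq_capped`). Thirdly, `K^{X ± e_k} - K^X` has rank one
(`hit_move_sub`), and along a rank one perturbation the determinant is affine
(`detRows_add_rankOne`). Hence `∂_t D_A = 𝓛 D_A` (`fredholmTerm_hasDerivAt`).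

On functions of the first `N` particles the generator is a bounded operator, also with respect to
weights that grow exponentially in the positions. A solution of exponential growth is therefore
`∑_k t^k / k! 𝓛^k u_0` (`hasSum_genIter`, a Taylor expansion), and absolutely convergent sums may be
exchanged with this series (`tsum_eq_semigroup`). So everything reduces to time zero, where the
kernel is explicit: a nonvanishing `D_A(0, X)` has boundedly many points in a window around the
configuration (`exists_sum_abs_fredholmTerm_le`), and the Fredholm determinant is `1` because the
kernel raises levels, or `0` because a column of it is a unit vector
(`fredholmDet_time_zero_of_forall`, `fredholmDet_time_zero_of_exists`).

Uniqueness is the same Taylor expansion, and so is the formula for the process: by Dynkin's formula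
the functions `t ↦ E[𝓛^k F_0(X_t)]` are successive derivatives of each other
(`IsPushASEP.integral_eq_semigroup`).
-/


namespace PushASEP

noncomputable section

/-! ### Contour integrals around the origin -/

/-- The normalized contour integral `(2πi)⁻¹ ∮ g(w) dw` over the circle of radius `ρ` around `0`. -/
def cint (ρ : ℝ) (g : ℂ → ℂ) : ℂ := (2 * Real.pi * Complex.I)⁻¹ * ∮ w in C(0, ρ), g w

variable {ρ : ℝ}

lemma ne_zero_of_mem_sphere (hρ : 0 < ρ) {w : ℂ} (hw : w ∈ Metric.sphere (0 : ℂ) ρ) : w ≠ 0 := by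
  rintro rfl
  simp at hw
  exact hρ.ne hw

lemma cint_congr (hρ : 0 < ρ) {f g : ℂ → ℂ} (h : ∀ w ∈ Metric.sphere (0 : ℂ) ρ, f w = g w) :
    cint ρ f = cint ρ g := by
  rw [cint, cint, circleIntegral.integral_congr hρ.le h]

lemma cint_sub (hρ : 0 < ρ) {f g : ℂ → ℂ} (hf : ContinuousOn f (Metric.sphere 0 ρ))
    (hg : ContinuousOn g (Metric.sphere 0 ρ)) :
    cint ρ (fun w => f w - g w) = cint ρ f - cint ρ g := by
  rw [cint, cint, cint, circleIntegral.integral_sub (hf.circleIntegrable hρ.le)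
    (hg.circleIntegrable hρ.le), mul_sub]

lemma cint_add (hρ : 0 < ρ) {f g : ℂ → ℂ} (hf : ContinuousOn f (Metric.sphere 0 ρ))
    (hg : ContinuousOn g (Metric.sphere 0 ρ)) :
    cint ρ (fun w => f w + g w) = cint ρ f + cint ρ g := by
  rw [cint, cint, cint, circleIntegral.integral_add (hf.circleIntegrable hρ.le)
    (hg.circleIntegrable hρ.le), mul_add]

lemma cint_const_mul (c : ℂ) (f : ℂ → ℂ) :
    cint ρ (fun w => c * f w) = c * cint ρ f := by
  rw [cint, cint, circleIntegral.integral_const_mul]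
  ring

lemma norm_cint_le (hρ : 0 < ρ) {f : ℂ → ℂ} {C : ℝ}
    (h : ∀ w ∈ Metric.sphere (0 : ℂ) ρ, ‖f w‖ ≤ C) : ‖cint ρ f‖ ≤ ρ * C := by
  have := circleIntegral.norm_two_pi_i_inv_smul_integral_le_of_norm_le_const hρ.le h
  simpa [cint, smul_eq_mul] using this

lemma cint_zpow (hρ : 0 < ρ) (k : ℤ) :
    cint ρ (fun w => w ^ k) = if k = -1 then 1 else 0 := by
  rw [cint]
  split_ifs with h
  · subst h
    have := circleIntegral.integral_sub_center_inv (0 : ℂ) hρ.ne'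
    simp only [sub_zero] at this
    simp only [zpow_neg_one, this]
    exact inv_mul_cancel₀ Complex.two_pi_I_ne_zero
  · have := circleIntegral.integral_sub_zpow_of_ne h 0 0 ρ
    simp only [sub_zero] at this
    rw [this, mul_zero]

lemma cint_eq_zero (hρ : 0 < ρ) {f : ℂ → ℂ} (hf : DifferentiableOn ℂ f (Metric.closedBall 0 ρ)) :
    cint ρ f = 0 := by
  rw [cint, Complex.circleIntegral_eq_zero_of_differentiable_on_off_countable hρ.le
    countable_empty hf.continuousOn, mul_zero]
  intro z hz
  exact (hf z (Metric.ball_subset_closedBall hz.1)).differentiableAt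
    (Metric.closedBall_mem_nhds_of_mem hz.1)

lemma cint_hasSum (hρ : 0 < ρ) {ι : Type*} [Countable ι] {f : ι → ℂ → ℂ} {g : ℂ → ℂ}
    {u : ι → ℝ} (hf : ∀ i, ContinuousOn (f i) (Metric.sphere 0 ρ)) (hu : Summable u)
    (hb : ∀ i, ∀ w ∈ Metric.sphere (0 : ℂ) ρ, ‖f i w‖ ≤ u i)
    (hg : ∀ w ∈ Metric.sphere (0 : ℂ) ρ, HasSum (fun i => f i w) (g w)) :
    HasSum (fun i => cint ρ (f i)) (cint ρ g) := by
  have hm : ∀ θ, circleMap 0 ρ θ ∈ Metric.sphere (0 : ℂ) ρ := circleMap_mem_sphere 0 hρ.le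
  refine HasSum.mul_left _ ?_
  simp only [circleIntegral]
  refine intervalIntegral.hasSum_integral_of_dominated_convergence (fun i _ => ρ * u i)
    (fun i => ?_) (fun i => ?_) ?_ ?_ ?_
  · refine Continuous.aestronglyMeasurable ?_
    have h1 : Continuous fun θ => f i (circleMap 0 ρ θ) :=
      (hf i).comp_continuous (continuous_circleMap 0 ρ) hm
    have h2 : Continuous (deriv (circleMap 0 ρ)) := by
      simp only [funext (deriv_circleMap 0 ρ)]
      exact (continuous_circleMap 0 ρ).mul continuous_const
    exact h2.smul h1
  · refine ae_of_all _ fun θ _ => ?_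
    rw [norm_smul, deriv_circleMap]
    simp only [norm_mul, norm_circleMap_zero, Complex.norm_I, mul_one, abs_of_pos hρ]
    exact mul_le_mul_of_nonneg_left (hb i _ (hm θ)) hρ.le
  · exact ae_of_all _ fun θ _ => hu.mul_left _
  · exact intervalIntegrable_const
  · exact ae_of_all _ fun θ _ => (hg _ (hm θ)).const_smul _

lemma cint_hasDerivAt (hρ : 0 < ρ) {g φ : ℂ → ℂ} (hg : ContinuousOn g (Metric.sphere 0 ρ))
    (hφ : ContinuousOn φ (Metric.sphere 0 ρ)) (t : ℝ) :
    HasDerivAt (fun s : ℝ => cint ρ fun w => g w * Complex.exp (s * φ w))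
      (cint ρ fun w => φ w * (g w * Complex.exp (t * φ w))) t := by
  have hm : ∀ θ, circleMap 0 ρ θ ∈ Metric.sphere (0 : ℂ) ρ := circleMap_mem_sphere 0 hρ.le
  have hcg : Continuous fun θ => g (circleMap 0 ρ θ) :=
    hg.comp_continuous (continuous_circleMap 0 ρ) hm
  have hcφ : Continuous fun θ => φ (circleMap 0 ρ θ) :=
    hφ.comp_continuous (continuous_circleMap 0 ρ) hm
  have hcd : Continuous (deriv (circleMap 0 ρ)) := by
    simp only [funext (deriv_circleMap 0 ρ)]
    exact (continuous_circleMap 0 ρ).mul continuous_const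
  obtain ⟨A, hA⟩ := (isCompact_sphere (0 : ℂ) ρ).exists_bound_of_continuousOn hg
  obtain ⟨B, hB⟩ := (isCompact_sphere (0 : ℂ) ρ).exists_bound_of_continuousOn hφ
  have hA0 : 0 ≤ A := (norm_nonneg _).trans (hA _ (hm 0))
  have hB0 : 0 ≤ B := (norm_nonneg _).trans (hB _ (hm 0))
  refine HasDerivAt.const_mul _ ?_
  simp only [circleIntegral]
  refine (intervalIntegral.hasDerivAt_integral_of_dominated_loc_of_deriv_le (𝕜 := ℝ) (E := ℂ)
    (F := fun s θ => deriv (circleMap 0 ρ) θ • (g (circleMap 0 ρ θ) *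
      Complex.exp ((s : ℝ) * φ (circleMap 0 ρ θ))))
    (F' := fun s θ => deriv (circleMap 0 ρ) θ • (φ (circleMap 0 ρ θ) * (g (circleMap 0 ρ θ) *
      Complex.exp ((s : ℝ) * φ (circleMap 0 ρ θ)))))
    (μ := volume) (a := 0) (b := 2 * Real.pi)
    (bound := fun _ => ρ * (B * (A * Real.exp ((|t| + 1) * B))))
    (s := Metric.ball t 1) (Metric.ball_mem_nhds t one_pos) ?_ ?_ ?_ ?_ ?_ ?_).2
  · refine Eventually.of_forall fun s => Continuous.aestronglyMeasurable ?_
    exact hcd.smul (hcg.mul (Complex.continuous_exp.comp (continuous_const.mul hcφ)))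
  · refine Continuous.intervalIntegrable ?_ _ _
    exact hcd.smul (hcg.mul (Complex.continuous_exp.comp (continuous_const.mul hcφ)))
  · refine Continuous.aestronglyMeasurable ?_
    exact hcd.smul (hcφ.mul (hcg.mul (Complex.continuous_exp.comp (continuous_const.mul hcφ))))
  · refine ae_of_all _ fun θ _ s hs => ?_
    rw [norm_smul, deriv_circleMap]
    simp only [norm_mul, norm_circleMap_zero, Complex.norm_I, mul_one, abs_of_pos hρ]
    have hs' : |s| ≤ |t| + 1 := by
      have h1 : |s - t| < 1 := by simpa [Real.dist_eq] using hs
      have h2 : |s| ≤ |s - t| + |t| := by simpa using abs_add_le (s - t) t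
      linarith
    have h3 : ‖Complex.exp (s * φ (circleMap 0 ρ θ))‖ ≤ Real.exp ((|t| + 1) * B) := by
      refine (Complex.norm_exp_le_exp_norm _).trans (Real.exp_le_exp.2 ?_)
      rw [norm_mul, Complex.norm_real, Real.norm_eq_abs]
      exact mul_le_mul hs' (hB _ (hm θ)) (norm_nonneg _) (by positivity)
    gcongr
    · exact hB _ (hm θ)
    · exact hA _ (hm θ)
  · exact intervalIntegrable_const
  · refine ae_of_all _ fun θ _ s _ => ?_
    have h1 : HasDerivAt (fun s : ℝ => (s : ℂ) * φ (circleMap 0 ρ θ)) (φ (circleMap 0 ρ θ)) s := by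
      simpa using (Complex.ofRealCLM.hasDerivAt (x := s)).mul_const (φ (circleMap 0 ρ θ))
    have h2 := ((h1.cexp).const_mul (g (circleMap 0 ρ θ))).const_smul (deriv (circleMap 0 ρ) θ)
    convert! h2 using 1
    simp only [smul_eq_mul]
    ring

/-! ### Laurent series of the exponential kernel -/

lemma comp_Qinv_right (A : ℤ → ℤ → ℝ) (x y : ℤ) : comp A Qinv x y = 2 * A x (y - 1) - A x y := by
  rw [comp, tsum_eq_sum (s := {y - 1, y})]
  · have h1 : y ≠ y - 1 := by omega
    rw [Finset.sum_pair h1.symm]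
    simp only [Qinv, h1, h1.symm, if_true, if_false]
    ring
  · intro z hz
    simp only [Finset.mem_insert, Finset.mem_singleton, not_or] at hz
    simp [Qinv, hz.1, hz.2]

lemma comp_id_right (A : ℤ → ℤ → ℝ) (x y : ℤ) :
    comp A (fun x y => if x = y then 1 else 0) x y = A x y := by
  rw [comp, tsum_eq_single y]
  · simp
  · intro z hz
    simp [hz]

lemma kpow_Qinv_eq_zero (n : ℕ) : ∀ x y : ℤ, x ∉ Finset.Icc (y - n) y → kpow Qinv n x y = 0 := by
  induction n with
  | zero =>
    intro x y h
    have : x ≠ y := by rintro rfl; simp at h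
    simp [kpow, this]
  | succ n ih =>
    intro x y h
    rw [Finset.mem_Icc] at h
    push_cast at h
    rw [kpow, comp_Qinv_right, ih x (y - 1), ih x y]
    · simp
    · rw [Finset.mem_Icc]; omega
    · rw [Finset.mem_Icc]; omega

lemma expKernel_add (r ℓ t : ℝ) (x y c : ℤ) :
    expKernel r ℓ t (x + c) (y + c) = expKernel r ℓ t x y := by
  rw [expKernel, comp, comp, ← (Equiv.addRight c).tsum_eq]
  refine tsum_congr fun z => ?_
  simp [expNablaMinus, expNablaPlus]

/-- The Laurent series of `e^{s(u-1)}`. -/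
lemma hasSum_expNablaMinus (s : ℝ) (u : ℂ) :
    HasSum (fun j : ℤ => (expNablaMinus s j 0 : ℂ) * u ^ j) (Complex.exp (s * (u - 1))) := by
  rw [← Function.Injective.hasSum_iff (Nat.cast_injective (R := ℤ))]
  · have h := (NormedSpace.expSeries_div_hasSum_exp ((s : ℂ) * u)).mul_left (Complex.exp (-s))
    rw [← Complex.exp_eq_exp_ℂ, ← Complex.exp_add] at h
    convert! h using 1
    · funext j
      simp [expNablaMinus, mul_pow]
      ring
    · congr 1
      ring
  · intro j hj
    have : ¬ 0 ≤ j := fun h => hj ⟨j.toNat, by simp [h]⟩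
    simp [expNablaMinus, this]

lemma hasSum_expNablaPlus (s : ℝ) (u : ℂ) :
    HasSum (fun j : ℤ => (expNablaPlus s j 0 : ℂ) * u ^ j) (Complex.exp (s * (1 / u - 1))) := by
  have h := hasSum_expNablaMinus s (1 / u)
  rw [← (Equiv.neg ℤ).hasSum_iff] at h
  convert! h using 1
  funext j
  simp [expNablaMinus, expNablaPlus]

/-- The symbol of a convolution is the product of the symbols. -/
lemma hasSum_convolution {α β : ℤ → ℝ} {u a b : ℂ} (hu : u ≠ 0)
    (h1 : HasSum (fun j : ℤ => (α j : ℂ) * u ^ j) a)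
    (h2 : HasSum (fun j : ℤ => (β j : ℂ) * u ^ j) b) :
    HasSum (fun j : ℤ => ((∑' v, α (j - v) * β v : ℝ) : ℂ) * u ^ j) (a * b) := by
  have hs := summable_mul_of_summable_norm (f := fun j : ℤ => (α j : ℂ) * u ^ j)
    (g := fun j : ℤ => (β j : ℂ) * u ^ j) h1.summable.norm h2.summable.norm
  have h3 := h1.mul h2 hs
  let e : ℤ × ℤ ≃ ℤ × ℤ := ⟨fun p => (p.1 - p.2, p.2), fun p => (p.1 + p.2, p.2),
    fun p => Prod.ext (sub_add_cancel _ _) rfl, fun p => Prod.ext (add_sub_cancel_right _ _) rfl⟩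
  have h4 : HasSum (fun p : ℤ × ℤ => ((α (p.1 - p.2) : ℂ) * u ^ (p.1 - p.2)) *
      ((β p.2 : ℂ) * u ^ p.2)) (a * b) := e.hasSum_iff.2 h3
  have h5 := h4.prod_fiberwise (fun j => (h4.summable.prod_factor j).hasSum)
  convert! h5 using 1
  funext j
  rw [Complex.ofReal_tsum, ← tsum_mul_right]
  refine tsum_congr fun v => ?_
  have h6 : u ^ j = u ^ (j - v) * u ^ v := by rw [← zpow_add₀ hu, sub_add_cancel]
  rw [h6]
  push_cast
  ring

/-- The symbol of the exponential kernel: `∑_j e^{-½rt∇⁻+2ℓt∇⁺}(j,0) u^j`. -/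
lemma hasSum_expKernel (r ℓ t : ℝ) {u : ℂ} (hu : u ≠ 0) :
    HasSum (fun j : ℤ => (expKernel r ℓ t j 0 : ℂ) * u ^ j)
      (Complex.exp (r * t / 2 * (u - 1) + 2 * ℓ * t * (1 / u - 1))) := by
  have h := hasSum_convolution hu (hasSum_expNablaMinus (r * t / 2) u)
    (hasSum_expNablaPlus (2 * ℓ * t) u)
  rw [← Complex.exp_add] at h
  have e : ∀ j, expKernel r ℓ t j 0 = ∑' v, expNablaMinus (r * t / 2) (j - v) 0 *
      expNablaPlus (2 * ℓ * t) v 0 := fun j => by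
    simp only [expKernel, comp, expNablaMinus, sub_zero, sub_nonneg]
  simp only [e]
  convert! h using 3 <;> push_cast <;> rfl

lemma summable_abs_expKernel (r ℓ t : ℝ) {a : ℝ} (ha : 0 < a) :
    Summable fun j : ℤ => |expKernel r ℓ t j 0| * a ^ j := by
  have h := (hasSum_expKernel r ℓ t (u := a) (by exact_mod_cast ha.ne')).summable.norm
  refine h.congr fun j => ?_
  rw [norm_mul, Complex.norm_real, norm_zpow, Complex.norm_real, Real.norm_eq_abs, Real.norm_eq_abs,
    abs_of_pos ha]

lemma S_zero_index (r ℓ t : ℝ) (z₁ z₂ : ℤ) : S r ℓ t 0 z₁ z₂ = expKernel r ℓ t (z₂ - z₁) 0 := by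
  have h := expKernel_add r ℓ t (z₂ - z₁) 0 z₁
  simp only [sub_add_cancel, zero_add] at h
  rw [S, ← h]
  exact comp_id_right _ _ _

lemma S_succ_index (r ℓ t : ℝ) (n : ℕ) (z₁ z₂ : ℤ) :
    S r ℓ t (n + 1) z₁ z₂ = 2 * S r ℓ t n (z₁ - 1) z₂ - S r ℓ t n z₁ z₂ := by
  have hs : ∀ z : ℤ, Summable fun v => expKernel r ℓ t z₂ v * kpow Qinv n v z := fun z =>
    summable_of_ne_finset_zero (s := Finset.Icc (z - n) z) fun v hv => by
      rw [kpow_Qinv_eq_zero n v z hv, mul_zero]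
  rw [S, S, S, comp, comp, comp, ← tsum_mul_left, ← ((hs _).mul_left 2).tsum_sub (hs z₁)]
  refine tsum_congr fun v => ?_
  rw [kpow, comp_Qinv_right]
  ring

/-- The integrand of the contour formula for `𝓢`. -/
def SIntegrand (r ℓ t : ℝ) (n : ℕ) (z₁ z₂ : ℤ) (w : ℂ) : ℂ :=
  (1 - w) ^ n / ((2 : ℂ) ^ (z₂ - z₁) * w ^ ((n : ℤ) + 1 + z₂ - z₁)) *
      Complex.exp (t * (r * (w - 1 / 2) + ℓ * (1 / w - 2)))

lemma continuousOn_zpow_sphere (hρ : 0 < ρ) (k : ℤ) :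
    ContinuousOn (fun w : ℂ => w ^ k) (Metric.sphere 0 ρ) :=
  fun _ hw => (continuousAt_zpow₀ _ k (Or.inl (ne_zero_of_mem_sphere hρ hw))).continuousWithinAt

lemma continuousOn_SIntegrand (hρ : 0 < ρ) (r ℓ t : ℝ) (n : ℕ) (z₁ z₂ : ℤ) :
    ContinuousOn (SIntegrand r ℓ t n z₁ z₂) (Metric.sphere 0 ρ) := by
  have h0 : ∀ w ∈ Metric.sphere (0 : ℂ) ρ, w ≠ 0 := fun w => ne_zero_of_mem_sphere hρ
  have h1 := continuousOn_zpow_sphere hρ ((n : ℤ) + 1 + z₂ - z₁)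
  unfold SIntegrand
  refine ContinuousOn.mul (ContinuousOn.div (by fun_prop) (by fun_prop) fun w hw => ?_)
    (by fun_prop (disch := assumption))
  exact mul_ne_zero (zpow_ne_zero _ two_ne_zero) (zpow_ne_zero _ (h0 w hw))

/-- The contour formula for `𝓢_{-t,-n}`; the circle may have any radius. -/
lemma S_eq_cint (hρ : 0 < ρ) (r ℓ t : ℝ) (n : ℕ) :
    ∀ z₁ z₂ : ℤ, (S r ℓ t n z₁ z₂ : ℂ) = cint ρ (SIntegrand r ℓ t n z₁ z₂) := by
  have h2 : (2 : ℂ) ≠ 0 := two_ne_zero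
  induction n with
  | zero =>
    intro z₁ z₂
    rw [S_zero_index]
    set j := z₂ - z₁ with hj
    have key := cint_hasSum hρ (f := fun (i : ℤ) w => (expKernel r ℓ t i 0 : ℂ) * 2 ^ (i - j) *
      w ^ (i - j - 1)) (g := SIntegrand r ℓ t 0 z₁ z₂)
      (u := fun i => |expKernel r ℓ t i 0| * (2 * ρ) ^ i * (2 ^ (-j) * ρ ^ (-j - 1)))
      (fun i => continuousOn_const.mul (continuousOn_zpow_sphere hρ _))
      ((summable_abs_expKernel r ℓ t (by positivity)).mul_right _) (fun i w hw => ?_)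
      fun w hw => ?_
    · refine HasSum.unique ?_ key
      convert! hasSum_ite_eq j (expKernel r ℓ t j 0 : ℂ) using 1
      funext i
      rw [cint_const_mul, cint_zpow hρ]
      by_cases h : i = j
      · subst h; simp
      · have : i - j - 1 ≠ -1 := by omega
        simp [h, this]
    · have hw' : ‖w‖ = ρ := by simpa using hw
      have e1 : (2 : ℝ) ^ (i - j) = 2 ^ i * 2 ^ (-j) := by
        rw [← zpow_add₀ two_ne_zero, sub_eq_add_neg]
      have e2 : ρ ^ (i - j - 1) = ρ ^ i * ρ ^ (-j - 1) := by
        rw [← zpow_add₀ hρ.ne']; congr 1; ring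
      rw [norm_mul, norm_mul, norm_zpow, norm_zpow, hw', Complex.norm_real, Complex.norm_ofNat,
        e1, e2, mul_zpow, Real.norm_eq_abs]
      apply le_of_eq
      ring
    · have hw0 := ne_zero_of_mem_sphere hρ hw
      have h := (hasSum_expKernel r ℓ t (mul_ne_zero h2 hw0)).mul_right
        ((2 : ℂ) ^ (-j) * w ^ (-j - 1))
      convert! h using 1
      · funext i
        have e1 : (2 : ℂ) ^ (i - j) = 2 ^ i * 2 ^ (-j) := by
          rw [← zpow_add₀ h2, sub_eq_add_neg]
        have e2 : w ^ (i - j - 1) = w ^ i * w ^ (-j - 1) := by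
          rw [← zpow_add₀ hw0]; congr 1; ring
        rw [e1, e2, mul_zpow]
        ring
      · rw [SIntegrand, mul_comm]
        congr 1
        · congr 1
          field_simp
        · have e3 : ((0 : ℕ) : ℤ) + 1 + z₂ - z₁ = -(-j - 1) := by rw [hj]; push_cast; ring
          rw [e3, ← hj, zpow_neg w, zpow_neg (2 : ℂ)]
          simp [mul_comm]
  | succ n ih =>
    intro z₁ z₂
    rw [S_succ_index]
    push_cast
    have hc := cint_sub hρ (f := fun w => 2 * SIntegrand r ℓ t n (z₁ - 1) z₂ w)
      (continuousOn_const.mul (continuousOn_SIntegrand hρ r ℓ t n _ _))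
      (continuousOn_SIntegrand hρ r ℓ t n z₁ z₂)
    rw [ih, ih, ← cint_const_mul, ← hc]
    refine cint_congr hρ fun w hw => ?_
    have hw0 := ne_zero_of_mem_sphere hρ hw
    have e1 : (2 : ℂ) ^ (z₂ - (z₁ - 1)) = 2 ^ (z₂ - z₁) * 2 := by
      rw [← zpow_add_one₀ h2]; congr 1; ring
    have e2 : w ^ ((n : ℤ) + 1 + z₂ - (z₁ - 1)) = w ^ ((n : ℤ) + 1 + z₂ - z₁) * w := by
      rw [← zpow_add_one₀ hw0]; congr 1; ring
    have e3 : w ^ (((n + 1 : ℕ) : ℤ) + 1 + z₂ - z₁) = w ^ ((n : ℤ) + 1 + z₂ - z₁) * w := by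
      rw [← zpow_add_one₀ hw0]; congr 1; push_cast; ring
    simp only [SIntegrand, e1, e2, e3]
    have h3 : (2 : ℂ) ^ (z₂ - z₁) ≠ 0 := zpow_ne_zero _ h2
    have h4 : w ^ ((n : ℤ) + 1 + z₂ - z₁) ≠ 0 := zpow_ne_zero _ hw0
    generalize (2 : ℂ) ^ (z₂ - z₁) = A at *
    generalize w ^ ((n : ℤ) + 1 + z₂ - z₁) = B at *
    generalize Complex.exp _ = E
    field_simp
    ring

lemma S_eq_SContour (hρ : 0 < ρ) (r ℓ t : ℝ) (n : ℕ) (z₁ z₂ : ℤ) :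
    (S r ℓ t n z₁ z₂ : ℂ) = SContour r ℓ t n z₁ z₂ ρ :=
  S_eq_cint hρ r ℓ t n z₁ z₂

/-! ### The contour formula for `𝓢̄` -/

lemma one_sub_ne_zero_of_mem (hρ1 : ρ < 1) {w : ℂ} (hw : w ∈ Metric.closedBall (0 : ℂ) ρ) :
    1 - w ≠ 0 := by
  intro h
  have h1 : w = 1 := (sub_eq_zero.1 h).symm
  simp [h1] at hw
  linarith

lemma norm_one_sub_mem {w : ℂ} (hw : w ∈ Metric.sphere (0 : ℂ) ρ) :
    ‖1 - w‖ ∈ Icc (1 - ρ) (1 + ρ) := by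
  have hw' : ‖w‖ = ρ := by simpa using hw
  have h1 := norm_sub_norm_le (1 : ℂ) w
  have h2 := norm_sub_le (1 : ℂ) w
  rw [norm_one, hw'] at h1 h2
  exact ⟨h1, h2⟩

/-- An integer power of a number in `[a, b]` is at most the sum of the powers of the end points. -/
lemma zpow_le_zpow_add_zpow {a b v : ℝ} (ha : 0 < a) (hv : v ∈ Icc a b) (k : ℤ) :
    v ^ k ≤ a ^ k + b ^ k := by
  have hv0 : 0 < v := ha.trans_le hv.1
  have hb : 0 < b := hv0.trans_le hv.2
  rcases le_total 0 k with h | h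
  · have h1 : v ^ k ≤ b ^ k := zpow_le_zpow_left₀ h hv0.le hv.2
    have h2 : 0 ≤ a ^ k := (zpow_pos ha k).le
    linarith
  · have h1 : v ^ k ≤ a ^ k := by
      have h3 : a ^ (-k) ≤ v ^ (-k) := zpow_le_zpow_left₀ (by omega) ha.le hv.1
      rw [zpow_neg, zpow_neg] at h3
      exact (inv_le_inv₀ (zpow_pos ha k) (zpow_pos hv0 k)).1 h3
    have h2 : 0 ≤ b ^ k := (zpow_pos hb k).le
    linarith

lemma continuousOn_one_sub_zpow (hρ1 : ρ < 1) (k : ℤ) :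
    ContinuousOn (fun w : ℂ => (1 - w) ^ k) (Metric.sphere 0 ρ) := by
  refine ContinuousOn.zpow₀ (by fun_prop) k fun w hw => Or.inl ?_
  exact one_sub_ne_zero_of_mem hρ1 (Metric.sphere_subset_closedBall hw)

lemma differentiableOn_one_sub_zpow (hρ1 : ρ < 1) (k : ℤ) :
    DifferentiableOn ℂ (fun w : ℂ => (1 - w) ^ k) (Metric.closedBall 0 ρ) := by
  refine DifferentiableOn.zpow (by fun_prop) (Or.inl fun w hw => ?_)
  exact one_sub_ne_zero_of_mem hρ1 hw

/-- The Taylor coefficients at `0` of `(1 - w)^k`, for any integer `k`. -/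
lemma cint_one_sub_zpow (hρ : 0 < ρ) (hρ1 : ρ < 1) (m : ℕ) : ∀ k : ℤ,
    cint ρ (fun w => (1 - w) ^ k * w ^ (-(m + 1) : ℤ)) =
      (∏ j ∈ Finset.range m, ((j : ℂ) - k)) / m.factorial := by
  have hc : ∀ (k i : ℤ), ContinuousOn (fun w : ℂ => (1 - w) ^ k * w ^ i) (Metric.sphere 0 ρ) :=
    fun k i => (continuousOn_one_sub_zpow hρ1 k).mul (continuousOn_zpow_sphere hρ i)
  have hstep : ∀ (k i : ℤ), cint ρ (fun w => (1 - w) ^ (k + 1) * w ^ i) =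
      cint ρ (fun w => (1 - w) ^ k * w ^ i) - cint ρ (fun w => (1 - w) ^ k * w ^ (i + 1)) := by
    intro k i
    rw [← cint_sub hρ (hc _ _) (hc _ _)]
    refine cint_congr hρ fun w hw => ?_
    rw [zpow_add_one₀ (one_sub_ne_zero_of_mem hρ1 (Metric.sphere_subset_closedBall hw)),
      zpow_add_one₀ (ne_zero_of_mem_sphere hρ hw)]
    ring
  induction m with
  | zero =>
    have h0 : cint ρ (fun w => (1 - w) ^ (0 : ℤ) * w ^ (-((0 : ℕ) + 1) : ℤ)) = 1 := by
      have := cint_zpow hρ (-1)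
      simpa using this
    have hs : ∀ k : ℤ, cint ρ (fun w => (1 - w) ^ (k + 1) * w ^ (-((0 : ℕ) + 1) : ℤ)) =
        cint ρ (fun w => (1 - w) ^ k * w ^ (-((0 : ℕ) + 1) : ℤ)) := by
      intro k
      have h1 : cint ρ (fun w => (1 - w) ^ k * w ^ (-((0 : ℕ) + 1) + 1 : ℤ)) = 0 := by
        refine cint_eq_zero hρ ?_
        simpa using differentiableOn_one_sub_zpow hρ1 k
      rw [hstep, h1, sub_zero]
    intro k
    simp only [Finset.range_zero, Finset.prod_empty, Nat.factorial_zero, Nat.cast_one, div_one]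
    induction k using Int.induction_on with
    | zero => exact h0
    | succ i hi => rw [hs, hi]
    | pred i hi =>
      have h1 := hs (-(i : ℤ) - 1)
      rw [sub_add_cancel] at h1
      rw [← h1, hi]
  | succ m ih =>
    have hs : ∀ k : ℤ, cint ρ (fun w => (1 - w) ^ (k + 1) * w ^ (-((m + 1 : ℕ) + 1) : ℤ)) =
        cint ρ (fun w => (1 - w) ^ k * w ^ (-((m + 1 : ℕ) + 1) : ℤ)) -
        (∏ j ∈ Finset.range m, ((j : ℂ) - k)) / m.factorial := by
      intro k
      have e : (-((m + 1 : ℕ) + 1) + 1 : ℤ) = -(m + 1) := by push_cast; ring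
      rw [hstep, ← ih k, e]
    have hp : ∀ k : ℤ, (∏ j ∈ Finset.range (m + 1), ((j : ℂ) - (k + 1 : ℤ))) / (m + 1).factorial =
        (∏ j ∈ Finset.range (m + 1), ((j : ℂ) - k)) / (m + 1).factorial -
        (∏ j ∈ Finset.range m, ((j : ℂ) - k)) / m.factorial := by
      intro k
      rw [Finset.prod_range_succ', Finset.prod_range_succ _ m, Nat.factorial_succ]
      have e : ∀ j : ℕ, ((j + 1 : ℕ) : ℂ) - (k + 1 : ℤ) = j - k := fun j => by push_cast; ring
      simp only [e]
      have h1 : ((m : ℂ) + 1) ≠ 0 := by exact_mod_cast Nat.succ_ne_zero m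
      have h2 : (m.factorial : ℂ) ≠ 0 := by exact_mod_cast m.factorial_ne_zero
      push_cast
      field_simp
      ring
    intro k
    induction k using Int.induction_on with
    | zero =>
      have h1 := cint_zpow hρ (-((m + 1 : ℕ) + 1) : ℤ)
      rw [if_neg (by omega)] at h1
      rw [Finset.prod_eq_zero (Finset.mem_range.2 (Nat.succ_pos m)) (by simp), zero_div, ← h1]
      simp
    | succ i hi => rw [hs, hi, hp]
    | pred i hi =>
      have h1 := hs (-(i : ℤ) - 1)
      have h2 := hp (-(i : ℤ) - 1)
      rw [sub_add_cancel] at h1 h2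
      rw [hi, h2] at h1
      exact (sub_left_injective h1).symm

lemma Qbar_eq_cint (hρ : 0 < ρ) (hρ1 : ρ < 1) (n : ℕ) (x y : ℤ) :
    (Qbar (n + 1) x y : ℂ) =
      cint ρ (fun w => 2 ^ (y - x) * ((1 - w) ^ (y - x + n) * w ^ (-(n + 1) : ℤ))) := by
  rw [cint_const_mul, cint_one_sub_zpow hρ hρ1, Qbar, Nat.add_sub_cancel]
  push_cast
  rw [mul_div_assoc]
  congr 2
  rw [← Finset.prod_range_reflect]
  refine Finset.prod_congr rfl fun j hj => ?_
  have hj' : j < n := Finset.mem_range.1 hj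
  have e : ((n - 1 - j : ℕ) : ℂ) = n - 1 - j := by
    rw [Nat.cast_sub (by omega), Nat.cast_sub (by omega)]
    simp
  rw [e]
  ring

/-- The integrand of the contour formula for `𝓢̄`. -/
def SbarIntegrand (r ℓ t : ℝ) (n : ℕ) (z₁ z₂ : ℤ) (w : ℂ) : ℂ :=
    (1 - w) ^ (z₂ - z₁ + n - 1) / ((2 : ℂ) ^ (z₁ - z₂) * w ^ n) *
      Complex.exp (t * (r * (w - 1 / 2) + ℓ * (2 - 1 / (1 - w))))

lemma summable_abs_expKernel_sub (r ℓ t : ℝ) (z : ℤ) {a : ℝ} (ha : 0 < a) :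
    Summable fun v : ℤ => |expKernel r ℓ t (v - z) 0| * a ^ (v - z) :=
  (summable_abs_expKernel r ℓ t ha).comp_injective (sub_left_injective (b := z))

lemma Sbar_eq_cint (hρ : 0 < ρ) (hρ1 : ρ < 1) (r ℓ t : ℝ) (n : ℕ) (z₁ z₂ : ℤ) :
    (Sbar r ℓ t (n + 1) z₁ z₂ : ℂ) = cint ρ (SbarIntegrand r ℓ t (n + 1) z₁ z₂) := by
  have h2 : (2 : ℂ) ≠ 0 := two_ne_zero
  have hE : ∀ v, expKernel r ℓ (-t) v z₂ = expKernel r ℓ (-t) (v - z₂) 0 := fun v => by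
    have h := expKernel_add r ℓ (-t) (v - z₂) 0 z₂
    rw [← h]
    simp
  set a : ℝ := 1 - ρ with ha
  set b : ℝ := 1 + ρ with hb
  have ha0 : 0 < a := by linarith
  have hb0 : 0 < b := by linarith
  have key := cint_hasSum hρ (f := fun (v : ℤ) w => (2 ^ (v - z₁) * ((1 - w) ^ (v - z₁ + n) *
      w ^ (-(n + 1) : ℤ))) * (expKernel r ℓ (-t) v z₂ : ℂ)) (g := SbarIntegrand r ℓ t (n + 1) z₁ z₂)
      (u := fun v => |expKernel r ℓ (-t) (v - z₂) 0| * (2 * a) ^ (v - z₂) *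
          (2 ^ (z₂ - z₁) * a ^ (z₂ - z₁ + n) * ρ ^ (-(n + 1) : ℤ)) +
        |expKernel r ℓ (-t) (v - z₂) 0| * (2 * b) ^ (v - z₂) *
          (2 ^ (z₂ - z₁) * b ^ (z₂ - z₁ + n) * ρ ^ (-(n + 1) : ℤ)))
      (fun v => (continuousOn_const.mul ((continuousOn_one_sub_zpow hρ1 _).mul
        (continuousOn_zpow_sphere hρ _))).mul continuousOn_const) ?_ (fun v w hw => ?_)
      fun w hw => ?_
  · refine HasSum.unique ?_ key
    have h1 : ∀ v, cint ρ (fun w => (2 ^ (v - z₁) * ((1 - w) ^ (v - z₁ + n) *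
        w ^ (-(n + 1) : ℤ))) * (expKernel r ℓ (-t) v z₂ : ℂ)) =
        ((Qbar (n + 1) z₁ v * expKernel r ℓ (-t) v z₂ : ℝ) : ℂ) := fun v => by
      push_cast
      rw [Qbar_eq_cint hρ hρ1, mul_comm _ (expKernel r ℓ (-t) v z₂ : ℂ), ← cint_const_mul]
      congr 1
      funext w
      ring
    have hsum := key.summable
    simp only [h1] at hsum ⊢
    rw [Sbar, comp, Complex.ofReal_tsum]
    exact hsum.hasSum
  · exact ((summable_abs_expKernel_sub r ℓ (-t) z₂ (by positivity)).mul_right _).add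
      ((summable_abs_expKernel_sub r ℓ (-t) z₂ (by positivity)).mul_right _)
  · have hw' : ‖w‖ = ρ := by simpa using hw
    have h3 := zpow_le_zpow_add_zpow ha0 (norm_one_sub_mem hw) (v - z₁ + n)
    have e : ∀ c : ℝ, 0 < c → (2 * c) ^ (v - z₂) * (2 ^ (z₂ - z₁) * c ^ (z₂ - z₁ + n)) =
        2 ^ (v - z₁) * c ^ (v - z₁ + n) := fun c hc => by
      have e1 : (2 : ℝ) ^ (v - z₁) = 2 ^ (v - z₂) * 2 ^ (z₂ - z₁) := by
        rw [← zpow_add₀ two_ne_zero]; congr 1; ring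
      have e2 : c ^ (v - z₁ + n) = c ^ (v - z₂) * c ^ (z₂ - z₁ + n) := by
        rw [← zpow_add₀ hc.ne']; congr 1; ring
      rw [e1, e2, mul_zpow]
      ring
    rw [norm_mul, norm_mul, norm_mul, norm_zpow, norm_zpow, norm_zpow, hw', Complex.norm_real,
      Complex.norm_ofNat, hE v, Real.norm_eq_abs]
    set K := |expKernel r ℓ (-t) (v - z₂) 0|
    calc (2 : ℝ) ^ (v - z₁) * (‖1 - w‖ ^ (v - z₁ + n) * ρ ^ (-(n + 1) : ℤ)) * K
        ≤ 2 ^ (v - z₁) * ((a ^ (v - z₁ + n) + b ^ (v - z₁ + n)) * ρ ^ (-(n + 1) : ℤ)) * K := by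
          gcongr
      _ = K * ρ ^ (-(n + 1) : ℤ) * ((2 ^ (v - z₁) * a ^ (v - z₁ + n)) +
            (2 ^ (v - z₁) * b ^ (v - z₁ + n))) := by ring
      _ = _ := by rw [← e a ha0, ← e b hb0]; ring
  · have hw0 := ne_zero_of_mem_sphere hρ hw
    have hw1 := one_sub_ne_zero_of_mem hρ1 (Metric.sphere_subset_closedBall hw)
    have h := (hasSum_expKernel r ℓ (-t) (mul_ne_zero h2 hw1)).mul_right
      ((2 : ℂ) ^ (z₂ - z₁) * (1 - w) ^ (z₂ - z₁ + n) * w ^ (-(n + 1) : ℤ))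
    rw [← (Equiv.subRight z₂).hasSum_iff] at h
    convert! h using 1
    · funext v
      have e1 : (2 : ℂ) ^ (v - z₁) = 2 ^ (v - z₂) * 2 ^ (z₂ - z₁) := by
        rw [← zpow_add₀ h2]; congr 1; ring
      have e2 : (1 - w) ^ (v - z₁ + n) = (1 - w) ^ (v - z₂) * (1 - w) ^ (z₂ - z₁ + n) := by
        rw [← zpow_add₀ hw1]; congr 1; ring
      simp only [Function.comp_apply, Equiv.subRight_apply]
      rw [e1, e2, mul_zpow, hE v]
      ring
    · rw [SbarIntegrand, mul_comm]
      congr 1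
      · congr 1
        push_cast
        field_simp
        ring
      · have e3 : z₂ - z₁ + (n + 1 : ℕ) - 1 = z₂ - z₁ + n := by push_cast; ring
        have e4 : z₁ - z₂ = -(z₂ - z₁) := by ring
        have e5 : w ^ (-(n + 1) : ℤ) = (w ^ (n + 1))⁻¹ := by
          rw [zpow_neg]; norm_cast
        rw [e3, e4, e5, zpow_neg (2 : ℂ)]
        field_simp

lemma Sbar_eq_SbarContour (hρ : 0 < ρ) (hρ1 : ρ < 1) (r ℓ t : ℝ) {n : ℕ} (hn : 1 ≤ n)
    (z₁ z₂ : ℤ) : (Sbar r ℓ t n z₁ z₂ : ℂ) = SbarContour r ℓ t n z₁ z₂ ρ := by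
  obtain ⟨n, rfl⟩ := Nat.exists_eq_add_of_le' hn
  exact Sbar_eq_cint hρ hρ1 r ℓ t n z₁ z₂

/-! ### Translation invariance, recursion, time derivative and decay of `𝓢` and `𝓢̄` -/

lemma S_add (r ℓ t : ℝ) (n : ℕ) (y x c : ℤ) : S r ℓ t n (y + c) (x + c) = S r ℓ t n y x := by
  have h : SIntegrand r ℓ t n (y + c) (x + c) = SIntegrand r ℓ t n y x := by
    have e1 : x + c - (y + c) = x - y := by ring
    have e2 : (n : ℤ) + 1 + (x + c) - (y + c) = n + 1 + x - y := by ring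
    funext w
    simp only [SIntegrand, e1, e2]
  have := S_eq_cint one_pos r ℓ t n (y + c) (x + c)
  rw [h, ← S_eq_cint one_pos r ℓ t n y x] at this
  exact_mod_cast this

lemma Sbar_add (r ℓ t : ℝ) (n : ℕ) (b z c : ℤ) :
    Sbar r ℓ t (n + 1) (b + c) (z + c) = Sbar r ℓ t (n + 1) b z := by
  have h : SbarIntegrand r ℓ t (n + 1) (b + c) (z + c) = SbarIntegrand r ℓ t (n + 1) b z := by
    have e1 : b + c - (z + c) = b - z := by ring
    have e2 : z + c - (b + c) = z - b := by ring
    funext w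
    simp only [SbarIntegrand, e1, e2]
  have h0 : (0 : ℝ) < 1 / 3 := by norm_num
  have h1 : (1 / 3 : ℝ) < 1 := by norm_num
  have := Sbar_eq_cint h0 h1 r ℓ t n (b + c) (z + c)
  rw [h, ← Sbar_eq_cint h0 h1 r ℓ t n b z] at this
  exact_mod_cast this

lemma continuousOn_SbarIntegrand (hρ : 0 < ρ) (hρ1 : ρ < 1) (r ℓ t : ℝ) (n : ℕ) (z₁ z₂ : ℤ) :
    ContinuousOn (SbarIntegrand r ℓ t n z₁ z₂) (Metric.sphere 0 ρ) := by
  have h0 : ∀ w ∈ Metric.sphere (0 : ℂ) ρ, w ≠ 0 := fun w => ne_zero_of_mem_sphere hρ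
  have h1 : ∀ w ∈ Metric.sphere (0 : ℂ) ρ, 1 - w ≠ 0 := fun w hw =>
    one_sub_ne_zero_of_mem hρ1 (Metric.sphere_subset_closedBall hw)
  have h2 := continuousOn_one_sub_zpow hρ1 (z₂ - z₁ + n - 1)
  unfold SbarIntegrand
  refine ContinuousOn.mul (ContinuousOn.div h2 (by fun_prop) fun w hw => ?_)
    (by fun_prop (disch := assumption))
  exact mul_ne_zero (zpow_ne_zero _ two_ne_zero) (pow_ne_zero _ (h0 w hw))

/-- `Q⁻¹ 𝓢̄_{-t,n+1} = 𝓢̄_{-t,n}` for `n ≥ 1`. -/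
lemma Sbar_rec (r ℓ t : ℝ) (n : ℕ) (b z : ℤ) :
    2 * Sbar r ℓ t (n + 2) (b + 1) z - Sbar r ℓ t (n + 2) b z = Sbar r ℓ t (n + 1) b z := by
  have h0 : (0 : ℝ) < 1 / 3 := by norm_num
  have h1 : (1 / 3 : ℝ) < 1 := by norm_num
  have hc := cint_sub h0 (f := fun w => 2 * SbarIntegrand r ℓ t (n + 2) (b + 1) z w)
      (continuousOn_const.mul (continuousOn_SbarIntegrand h0 h1 r ℓ t (n + 2) _ _))
      (continuousOn_SbarIntegrand h0 h1 r ℓ t (n + 2) b z)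
  suffices h : ((2 * Sbar r ℓ t (n + 2) (b + 1) z - Sbar r ℓ t (n + 2) b z : ℝ) : ℂ) =
    Sbar r ℓ t (n + 1) b z by exact_mod_cast h
  push_cast
  rw [Sbar_eq_cint h0 h1, Sbar_eq_cint h0 h1, Sbar_eq_cint h0 h1, ← cint_const_mul, ← hc]
  refine cint_congr h0 fun w hw => ?_
  have hw0 := ne_zero_of_mem_sphere h0 hw
  have hw1 := one_sub_ne_zero_of_mem h1 (Metric.sphere_subset_closedBall hw)
  have e1 : (2 : ℂ) ^ (b + 1 - z) = 2 ^ (b - z) * 2 := by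
    rw [← zpow_add_one₀ two_ne_zero]; congr 1; ring
  have e2 : (1 - w) ^ (z - b + (n + 2 : ℕ) - 1) =
      (1 - w) ^ (z - (b + 1) + (n + 2 : ℕ) - 1) * (1 - w) := by
    rw [← zpow_add_one₀ hw1]; congr 1; ring
  have e3 : z - b + (n + 1 : ℕ) - 1 = z - (b + 1) + (n + 2 : ℕ) - 1 := by push_cast; ring
  have h3 : (2 : ℂ) ^ (b - z) ≠ 0 := zpow_ne_zero _ two_ne_zero
  simp only [SbarIntegrand, e1, e2, e3]
  generalize (2 : ℂ) ^ (b - z) = A at *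
  generalize (1 - w) ^ (z - (b + 1) + (n + 2 : ℕ) - 1) = B at *
  generalize Complex.exp _ = E
  field_simp
  ring

/-- `Q⁻¹ 𝓢̄_{-t,1} = 0`, because the factor `w` cancels the pole of the integrand. -/
lemma Sbar_one_rec (r ℓ t : ℝ) (b z : ℤ) :
    2 * Sbar r ℓ t 1 (b + 1) z - Sbar r ℓ t 1 b z = 0 := by
  have h0 : (0 : ℝ) < 1 / 3 := by norm_num
  have h1 : (1 / 3 : ℝ) < 1 := by norm_num
  have hc := cint_sub h0 (f := fun w => 2 * SbarIntegrand r ℓ t 1 (b + 1) z w)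
      (continuousOn_const.mul (continuousOn_SbarIntegrand h0 h1 r ℓ t 1 _ _))
      (continuousOn_SbarIntegrand h0 h1 r ℓ t 1 b z)
  suffices h : ((2 * Sbar r ℓ t 1 (b + 1) z - Sbar r ℓ t 1 b z : ℝ) : ℂ) = 0 by exact_mod_cast h
  push_cast
  have hs := Sbar_eq_cint h0 h1 r ℓ t 0
  rw [zero_add] at hs
  rw [hs, hs, ← cint_const_mul, ← hc]
  have hd : DifferentiableOn ℂ (fun w : ℂ => (1 - w) ^ (z - (b + 1)) / (2 : ℂ) ^ (b - z) *
      Complex.exp (t * (r * (w - 1 / 2) + ℓ * (2 - 1 / (1 - w))))) (Metric.closedBall 0 (1 / 3)) := by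
    have h2 := differentiableOn_one_sub_zpow h1 (z - (b + 1))
    have h3 : ∀ w ∈ Metric.closedBall (0 : ℂ) (1 / 3), 1 - w ≠ 0 := fun w hw =>
      one_sub_ne_zero_of_mem h1 hw
    refine DifferentiableOn.mul (h2.div_const _) ?_
    fun_prop (disch := assumption)
  rw [← cint_eq_zero h0 hd]
  refine cint_congr h0 fun w hw => ?_
  have hw0 := ne_zero_of_mem_sphere h0 hw
  have hw1 := one_sub_ne_zero_of_mem h1 (Metric.sphere_subset_closedBall hw)
  have e1 : (2 : ℂ) ^ (b + 1 - z) = 2 ^ (b - z) * 2 := by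
    rw [← zpow_add_one₀ two_ne_zero]; congr 1; ring
  have e2 : (1 - w) ^ (z - b + (1 : ℕ) - 1) = (1 - w) ^ (z - (b + 1)) * (1 - w) := by
    rw [← zpow_add_one₀ hw1]; congr 1; push_cast; ring
  have e3 : z - (b + 1) + (1 : ℕ) - 1 = z - (b + 1) := by push_cast; ring
  have h3 : (2 : ℂ) ^ (b - z) ≠ 0 := zpow_ne_zero _ two_ne_zero
  simp only [SbarIntegrand, e1, e2, e3]
  generalize (2 : ℂ) ^ (b - z) = A at *
  generalize (1 - w) ^ (z - (b + 1)) = B at *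
  generalize Complex.exp _ = E
  field_simp
  ring

lemma cint_comb (hρ : 0 < ρ) (a b : ℂ) {f₁ f₂ f₃ f₄ : ℂ → ℂ}
    (h₁ : ContinuousOn f₁ (Metric.sphere 0 ρ)) (h₂ : ContinuousOn f₂ (Metric.sphere 0 ρ))
    (h₃ : ContinuousOn f₃ (Metric.sphere 0 ρ)) (h₄ : ContinuousOn f₄ (Metric.sphere 0 ρ)) :
    cint ρ (fun w => a * (f₁ w - f₂ w) + b * (f₃ w - f₄ w)) =
      a * (cint ρ f₁ - cint ρ f₂) + b * (cint ρ f₃ - cint ρ f₄) := by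
  have h := cint_add hρ (f := fun w => a * (f₁ w - f₂ w)) (g := fun w => b * (f₃ w - f₄ w))
    (continuousOn_const.mul (h₁.sub h₂)) (continuousOn_const.mul (h₃.sub h₄))
  rw [h, cint_const_mul, cint_const_mul, cint_sub hρ h₁ h₂, cint_sub hρ h₃ h₄]

lemma hasDerivAt_of_ofReal {f : ℝ → ℝ} {f' t : ℝ}
    (h : HasDerivAt (fun s => (f s : ℂ)) (f' : ℂ) t) : HasDerivAt f f' t := by
  simpa [Function.comp_def] using Complex.reCLM.hasFDerivAt.comp_hasDerivAt t h

lemma S_hasDerivAt (r ℓ t : ℝ) (n : ℕ) (y x : ℤ) :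
    HasDerivAt (fun s => S r ℓ s n y x)
      (r / 2 * (S r ℓ t n y (x - 1) - S r ℓ t n y x) +
        2 * ℓ * (S r ℓ t n y (x + 1) - S r ℓ t n y x)) t := by
  refine hasDerivAt_of_ofReal ?_
  have h0 : (0 : ℝ) < 1 := one_pos
  have hn0 : ∀ w ∈ Metric.sphere (0 : ℂ) 1, w ≠ 0 := fun w => ne_zero_of_mem_sphere h0
  have hg : ContinuousOn (fun w : ℂ => (1 - w) ^ n / ((2 : ℂ) ^ (x - y) *
      w ^ ((n : ℤ) + 1 + x - y))) (Metric.sphere 0 1) := by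
    have h1 := continuousOn_zpow_sphere h0 ((n : ℤ) + 1 + x - y)
    refine ContinuousOn.div (by fun_prop) (by fun_prop) fun w hw => ?_
    exact mul_ne_zero (zpow_ne_zero _ two_ne_zero) (zpow_ne_zero _ (hn0 w hw))
  have hφ : ContinuousOn (fun w : ℂ => (r * (w - 1 / 2) + ℓ * (1 / w - 2) : ℂ))
      (Metric.sphere 0 1) := by fun_prop (disch := assumption)
  have h := cint_hasDerivAt h0 hg hφ t
  have hc : ∀ x', ContinuousOn (SIntegrand r ℓ t n y x') (Metric.sphere 0 1) :=
    continuousOn_SIntegrand h0 r ℓ t n y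
  have e : ((r / 2 * (S r ℓ t n y (x - 1) - S r ℓ t n y x) +
        2 * ℓ * (S r ℓ t n y (x + 1) - S r ℓ t n y x) : ℝ) : ℂ) = cint 1 fun w =>
      r / 2 * (SIntegrand r ℓ t n y (x - 1) w - SIntegrand r ℓ t n y x w) +
        2 * ℓ * (SIntegrand r ℓ t n y (x + 1) w - SIntegrand r ℓ t n y x w) := by
    rw [cint_comb h0 _ _ (hc _) (hc _) (hc _) (hc _)]
    simp only [← S_eq_cint h0]
    push_cast
    ring
  rw [e]
  convert! h using 1
  · funext s
    exact S_eq_cint h0 r ℓ s n y x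
  · refine cint_congr h0 fun w hw => ?_
    have hw0 := hn0 w hw
    have e1 : (2 : ℂ) ^ (x - 1 - y) = 2 ^ (x - y) / 2 := by
      rw [div_eq_mul_inv, ← zpow_sub_one₀ two_ne_zero]; congr 1; ring
    have e2 : (2 : ℂ) ^ (x + 1 - y) = 2 ^ (x - y) * 2 := by
      rw [← zpow_add_one₀ two_ne_zero]; congr 1; ring
    have e3 : w ^ ((n : ℤ) + 1 + (x - 1) - y) = w ^ ((n : ℤ) + 1 + x - y) / w := by
      rw [div_eq_mul_inv, ← zpow_sub_one₀ hw0]; congr 1; ring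
    have e4 : w ^ ((n : ℤ) + 1 + (x + 1) - y) = w ^ ((n : ℤ) + 1 + x - y) * w := by
      rw [← zpow_add_one₀ hw0]; congr 1; ring
    simp only [SIntegrand, e1, e2, e3, e4]
    have h3 : (2 : ℂ) ^ (x - y) ≠ 0 := zpow_ne_zero _ two_ne_zero
    have h4 : w ^ ((n : ℤ) + 1 + x - y) ≠ 0 := zpow_ne_zero _ hw0
    generalize (2 : ℂ) ^ (x - y) = A at *
    generalize w ^ ((n : ℤ) + 1 + x - y) = B at *
    generalize Complex.exp _ = E
    field_simp

lemma Sbar_hasDerivAt (r ℓ t : ℝ) (n : ℕ) (b z : ℤ) :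
    HasDerivAt (fun s => Sbar r ℓ s (n + 1) b z)
      (r / 2 * (Sbar r ℓ t (n + 1) b z - Sbar r ℓ t (n + 1) b (z + 1)) -
        2 * ℓ * (Sbar r ℓ t (n + 1) b (z - 1) - Sbar r ℓ t (n + 1) b z)) t := by
  refine hasDerivAt_of_ofReal ?_
  have h0 : (0 : ℝ) < 1 / 3 := by norm_num
  have h1 : (1 / 3 : ℝ) < 1 := by norm_num
  have hn0 : ∀ w ∈ Metric.sphere (0 : ℂ) (1 / 3), w ≠ 0 := fun w => ne_zero_of_mem_sphere h0
  have hn1 : ∀ w ∈ Metric.sphere (0 : ℂ) (1 / 3), 1 - w ≠ 0 := fun w hw =>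
    one_sub_ne_zero_of_mem h1 (Metric.sphere_subset_closedBall hw)
  have hg : ContinuousOn (fun w : ℂ => (1 - w) ^ (z - b + (n + 1 : ℕ) - 1) /
      ((2 : ℂ) ^ (b - z) * w ^ (n + 1))) (Metric.sphere 0 (1 / 3)) := by
    have h1 := continuousOn_one_sub_zpow h1 (z - b + (n + 1 : ℕ) - 1)
    refine ContinuousOn.div h1 (by fun_prop) fun w hw => ?_
    exact mul_ne_zero (zpow_ne_zero _ two_ne_zero) (pow_ne_zero _ (hn0 w hw))
  have hφ : ContinuousOn (fun w : ℂ => (r * (w - 1 / 2) + ℓ * (2 - 1 / (1 - w)) : ℂ))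
      (Metric.sphere 0 (1 / 3)) := by fun_prop (disch := assumption)
  have h := cint_hasDerivAt h0 hg hφ t
  have hc : ∀ z', ContinuousOn (SbarIntegrand r ℓ t (n + 1) b z') (Metric.sphere 0 (1 / 3)) :=
    continuousOn_SbarIntegrand h0 h1 r ℓ t (n + 1) b
  have e : ((r / 2 * (Sbar r ℓ t (n + 1) b z - Sbar r ℓ t (n + 1) b (z + 1)) -
        2 * ℓ * (Sbar r ℓ t (n + 1) b (z - 1) - Sbar r ℓ t (n + 1) b z) : ℝ) : ℂ) =
      cint (1 / 3) fun w =>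
      r / 2 * (SbarIntegrand r ℓ t (n + 1) b z w - SbarIntegrand r ℓ t (n + 1) b (z + 1) w) +
        -(2 * ℓ) * (SbarIntegrand r ℓ t (n + 1) b (z - 1) w - SbarIntegrand r ℓ t (n + 1) b z w) := by
    rw [cint_comb h0 _ _ (hc _) (hc _) (hc _) (hc _)]
    simp only [← Sbar_eq_cint h0 h1]
    push_cast
    ring
  rw [e]
  convert! h using 1
  · funext s
    exact Sbar_eq_cint h0 h1 r ℓ s n b z
  · refine cint_congr h0 fun w hw => ?_
    have hw0 := hn0 w hw
    have hw1 := hn1 w hw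
    have e1 : (2 : ℂ) ^ (b - (z + 1)) = 2 ^ (b - z) / 2 := by
      rw [div_eq_mul_inv, ← zpow_sub_one₀ two_ne_zero]; congr 1; ring
    have e2 : (2 : ℂ) ^ (b - (z - 1)) = 2 ^ (b - z) * 2 := by
      rw [← zpow_add_one₀ two_ne_zero]; congr 1; ring
    have e3 : (1 - w) ^ (z - 1 - b + (n + 1 : ℕ) - 1) =
        (1 - w) ^ (z - b + (n + 1 : ℕ) - 1) / (1 - w) := by
      rw [div_eq_mul_inv, ← zpow_sub_one₀ hw1]; congr 1; ring
    have e4 : (1 - w) ^ (z + 1 - b + (n + 1 : ℕ) - 1) =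
        (1 - w) ^ (z - b + (n + 1 : ℕ) - 1) * (1 - w) := by
      rw [← zpow_add_one₀ hw1]; congr 1; ring
    simp only [SbarIntegrand, e1, e2, e3, e4]
    have h3 : (2 : ℂ) ^ (b - z) ≠ 0 := zpow_ne_zero _ two_ne_zero
    generalize (2 : ℂ) ^ (b - z) = A at *
    generalize (1 - w) ^ (z - b + (n + 1 : ℕ) - 1) = B at *
    generalize Complex.exp _ = E
    field_simp
    ring

lemma norm_exp_mul_le {t T B : ℝ} (ht : |t| ≤ T) {φ : ℂ} (hφ : ‖φ‖ ≤ B) :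
    ‖Complex.exp (t * φ)‖ ≤ Real.exp (T * B) := by
  refine (Complex.norm_exp_le_exp_norm _).trans (Real.exp_le_exp.2 ?_)
  rw [norm_mul, Complex.norm_real, Real.norm_eq_abs]
  exact mul_le_mul ht hφ (norm_nonneg _) ((abs_nonneg t).trans ht)

lemma S_le_zpow (hρ : 0 < ρ) (r ℓ T : ℝ) (n : ℕ) : ∃ C, ∀ t, |t| ≤ T → ∀ y x : ℤ,
    |S r ℓ t n y x| ≤ C * (2 * ρ) ^ (y - x) := by
  refine ⟨ρ * ((1 + ρ) ^ n * ρ ^ (-(n + 1) : ℤ) *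
    Real.exp (T * (|r| * (ρ + 1 / 2) + |ℓ| * (1 / ρ + 2)))), fun t ht y x => ?_⟩
  rw [← Real.norm_eq_abs, ← Complex.norm_real, S_eq_cint hρ, mul_assoc]
  refine norm_cint_le hρ fun w hw => ?_
  have hw' : ‖w‖ = ρ := by simpa using hw
  have h1 : ‖(r * (w - 1 / 2) + ℓ * (1 / w - 2) : ℂ)‖ ≤ |r| * (ρ + 1 / 2) + |ℓ| * (1 / ρ + 2) := by
    refine (norm_add_le _ _).trans ?_
    rw [norm_mul, norm_mul, Complex.norm_real, Complex.norm_real, Real.norm_eq_abs,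
      Real.norm_eq_abs]
    gcongr
    · refine (norm_sub_le _ _).trans ?_
      rw [hw']
      norm_num
    · refine (norm_sub_le _ _).trans ?_
      rw [norm_div, hw']
      norm_num
  have h2 : ‖1 - w‖ ≤ 1 + ρ := (norm_one_sub_mem hw).2
  have e : ((2 : ℝ) ^ (x - y) * ρ ^ ((n : ℤ) + 1 + x - y))⁻¹ =
      ρ ^ (-(n + 1) : ℤ) * (2 * ρ) ^ (y - x) := by
    have e1 : (n : ℤ) + 1 + x - y = -(-(n + 1) + (y - x)) := by ring
    rw [e1, ← neg_sub y x, zpow_neg, zpow_neg, ← mul_inv, inv_inv, zpow_add₀ hρ.ne', mul_zpow]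
    ring
  rw [SIntegrand, norm_mul, norm_div, norm_mul, norm_pow, norm_zpow, norm_zpow, hw',
    Complex.norm_ofNat, div_eq_mul_inv, e]
  calc ‖1 - w‖ ^ n * (ρ ^ (-(n + 1) : ℤ) * (2 * ρ) ^ (y - x)) * ‖Complex.exp _‖
      ≤ (1 + ρ) ^ n * (ρ ^ (-(n + 1) : ℤ) * (2 * ρ) ^ (y - x)) *
        Real.exp (T * (|r| * (ρ + 1 / 2) + |ℓ| * (1 / ρ + 2))) := by
        gcongr
        exact norm_exp_mul_le ht h1
    _ = _ := by ring

/-- `𝓢` decays faster than any exponential; the rate `9` suffices for all convergence questions. -/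
lemma S_bound (r ℓ T : ℝ) (n : ℕ) : ∃ C, ∀ t, |t| ≤ T → ∀ y x : ℤ,
    |S r ℓ t n y x| ≤ C * (1 / 9) ^ (y - x).natAbs := by
  -- the radii are chosen so that `2ρ` is `9` and `1/9`
  obtain ⟨C₁, h₁⟩ := S_le_zpow (ρ := 9 / 2) (by norm_num) r ℓ T n
  obtain ⟨C₂, h₂⟩ := S_le_zpow (ρ := 1 / 18) (by norm_num) r ℓ T n
  refine ⟨max C₁ C₂, fun t ht y x => ?_⟩
  rcases le_total 0 (y - x) with h | h
  · have h3 := h₂ t ht y x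
    have e : (2 * (1 / 18) : ℝ) ^ (y - x) = (1 / 9) ^ (y - x).natAbs := by
      rw [← zpow_natCast, Int.natAbs_of_nonneg h]; norm_num
    rw [e] at h3
    exact h3.trans (mul_le_mul_of_nonneg_right (le_max_right _ _) (by positivity))
  · have h3 := h₁ t ht y x
    have e : (2 * (9 / 2) : ℝ) ^ (y - x) = (1 / 9) ^ (y - x).natAbs := by
      rw [← zpow_natCast, Int.ofNat_natAbs_of_nonpos h, zpow_neg, one_div, inv_zpow, inv_inv]
      norm_num
    rw [e] at h3
    exact h3.trans (mul_le_mul_of_nonneg_right (le_max_left _ _) (by positivity))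

/-- On the circle of radius `1/3` one has `4/3 ≤ 2|1 - w| ≤ 8/3`, which gives the growth rate `3`. -/
lemma Sbar_bound (r ℓ T : ℝ) (n : ℕ) : ∃ C, 0 ≤ C ∧ ∀ t, |t| ≤ T → ∀ b z : ℤ,
    |Sbar r ℓ t (n + 1) b z| ≤ C * 3 ^ (b - z).natAbs := by
  have h0 : (0 : ℝ) < 1 / 3 := by norm_num
  have h1 : (1 / 3 : ℝ) < 1 := by norm_num
  refine ⟨(1 / 3) * ((4 / 3) ^ n * 3 ^ (n + 1) * Real.exp (T * (|r| * 1 + |ℓ| * 4))),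
    by positivity, fun t ht b z => ?_⟩
  rw [← Real.norm_eq_abs, ← Complex.norm_real, Sbar_eq_cint h0 h1, mul_assoc]
  refine norm_cint_le h0 fun w hw => ?_
  have hw' : ‖w‖ = 1 / 3 := by simpa using hw
  have hv := norm_one_sub_mem hw
  have hv0 : 0 < ‖1 - w‖ := lt_of_lt_of_le (by norm_num) hv.1
  have h3 : ‖(r * (w - 1 / 2) + ℓ * (2 - 1 / (1 - w)) : ℂ)‖ ≤ |r| * 1 + |ℓ| * 4 := by
    refine (norm_add_le _ _).trans ?_
    rw [norm_mul, norm_mul, Complex.norm_real, Complex.norm_real, Real.norm_eq_abs,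
      Real.norm_eq_abs]
    gcongr
    · refine (norm_sub_le _ _).trans ?_
      rw [hw']
      norm_num
    · refine (norm_sub_le _ _).trans ?_
      rw [norm_div, norm_one, Complex.norm_ofNat]
      have : 1 / ‖1 - w‖ ≤ 1 / (1 - 1 / 3) := one_div_le_one_div_of_le (by norm_num) hv.1
      norm_num at this ⊢
      linarith
  have h4 : (2 * ‖1 - w‖) ^ (z - b) ≤ 3 ^ (b - z).natAbs := by
    have hl : 1 / 3 ≤ 2 * ‖1 - w‖ := by linarith [hv.1]
    have hu : 2 * ‖1 - w‖ ≤ 3 := by linarith [hv.2]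
    rcases le_total 0 (z - b) with h | h
    · have e : (b - z).natAbs = (z - b).natAbs := by omega
      rw [e, ← zpow_natCast, Int.natAbs_of_nonneg h]
      exact zpow_le_zpow_left₀ h (by positivity) hu
    · rw [← zpow_natCast, Int.natAbs_of_nonneg (by omega), ← neg_sub b z, zpow_neg, ← inv_zpow]
      refine zpow_le_zpow_left₀ (by omega) (by positivity) ?_
      rw [inv_le_comm₀ (by positivity) (by norm_num)]
      linarith
  have e : ‖1 - w‖ ^ (z - b + (n + 1 : ℕ) - 1) / (2 ^ (b - z) * (1 / 3) ^ (n + 1)) =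
      ‖1 - w‖ ^ n * 3 ^ (n + 1) * (2 * ‖1 - w‖) ^ (z - b) := by
    have e1 : z - b + (n + 1 : ℕ) - 1 = z - b + n := by push_cast; ring
    rw [e1, zpow_add₀ hv0.ne', zpow_natCast, ← neg_sub z b, zpow_neg, mul_zpow, one_div, inv_pow,
      ← mul_inv, div_inv_eq_mul]
    ring
  rw [SbarIntegrand, norm_mul, norm_div, norm_mul, norm_pow, norm_zpow, norm_zpow, hw',
    Complex.norm_ofNat, e]
  calc ‖1 - w‖ ^ n * 3 ^ (n + 1) * (2 * ‖1 - w‖) ^ (z - b) * ‖Complex.exp _‖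
      ≤ (4 / 3) ^ n * 3 ^ (n + 1) * 3 ^ (b - z).natAbs *
        Real.exp (T * (|r| * 1 + |ℓ| * 4)) := by
        gcongr
        · linarith [hv.2]
        · exact norm_exp_mul_le ht h3
    _ = _ := by ring

/-! ### The walk average and the hitting functional -/

/-- The action of the transition kernel `Q` of the walk on functions. -/
def avg (g : ℤ → ℝ) (y : ℤ) : ℝ := ∑' i : ℕ, (1 / 2 : ℝ) ^ (i + 1) * g (y - (i + 1))

/-- `g` vanishes far to the left; all sums in `avg g` are then finite. -/
def VanishBelow (g : ℤ → ℝ) : Prop := ∃ L, ∀ y ≤ L, g y = 0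

/-- `hit s n X y` is the expectation of `s (n - τ) (B_τ)` on `τ < n` for the walk `B` started from
`y`, where `τ` is the hitting time of the strict epigraph of `X`; here `X` need not be decreasing.
It is defined by conditioning on the first step. -/
def hit (s : ℕ → ℤ → ℝ) : ℕ → (ℕ → ℤ) → ℤ → ℝ
  | 0 => fun _ _ => 0
  | n + 1 => fun X y => if X 0 < y then s (n + 1) y else avg (hit s n fun k => X (k + 1)) y

lemma avg_eq_sum {g : ℤ → ℝ} {L : ℤ} (h : ∀ y ≤ L, g y = 0) (y : ℤ) :
    avg g y = ∑ i ∈ Finset.range (y - L).toNat, (1 / 2 : ℝ) ^ (i + 1) * g (y - (i + 1)) := by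
  rw [avg, tsum_eq_sum]
  intro i hi
  rw [Finset.mem_range] at hi
  rw [h _ (by omega), mul_zero]

lemma VanishBelow.summable {g : ℤ → ℝ} (h : VanishBelow g) (y : ℤ) :
    Summable fun i : ℕ => (1 / 2 : ℝ) ^ (i + 1) * g (y - (i + 1)) := by
  obtain ⟨L, h⟩ := h
  refine summable_of_ne_finset_zero (s := Finset.range (y - L).toNat) fun i hi => ?_
  rw [Finset.mem_range] at hi
  rw [h _ (by omega), mul_zero]

lemma VanishBelow.sub {f g : ℤ → ℝ} (hf : VanishBelow f) (hg : VanishBelow g) :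
    VanishBelow fun y => f y - g y := by
  obtain ⟨L, hf⟩ := hf
  obtain ⟨M, hg⟩ := hg
  exact ⟨min L M, fun y hy => by simp [hf y (by omega), hg y (by omega)]⟩

lemma VanishBelow.const_mul {f : ℤ → ℝ} (hf : VanishBelow f) (c : ℝ) :
    VanishBelow fun y => c * f y := by
  obtain ⟨L, hf⟩ := hf
  exact ⟨L, fun y hy => by simp [hf y hy]⟩

lemma VanishBelow.shift {f : ℤ → ℝ} (hf : VanishBelow f) (c : ℤ) :
    VanishBelow fun y => f (y + c) := by
  obtain ⟨L, hf⟩ := hf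
  exact ⟨L - c, fun y hy => hf _ (by omega)⟩

/-- `Q⁻¹ Q = 1` on functions that vanish far to the left. -/
lemma two_mul_avg_sub_avg {g : ℤ → ℝ} (h : VanishBelow g) (y : ℤ) :
    2 * avg g (y + 1) - avg g y = g y := by
  have e : avg g (y + 1) = 1 / 2 * g y + 1 / 2 * avg g y := by
    rw [avg, (h.summable (y + 1)).tsum_eq_zero_add, avg, ← tsum_mul_left]
    congr 1
    · simp
    · refine tsum_congr fun i => ?_
      have : y + 1 - (((i + 1 : ℕ) : ℤ) + 1) = y - (i + 1) := by push_cast; ring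
      rw [this, pow_succ]
      ring
  rw [e]
  ring

lemma avg_sub {f g : ℤ → ℝ} (hf : VanishBelow f) (hg : VanishBelow g) (y : ℤ) :
    avg (fun b => f b - g b) y = avg f y - avg g y := by
  rw [avg, avg, avg, ← (hf.summable y).tsum_sub (hg.summable y)]
  exact tsum_congr fun i => mul_sub _ _ _

lemma avg_const_mul (c : ℝ) (f : ℤ → ℝ) (y : ℤ) : avg (fun b => c * f b) y = c * avg f y := by
  rw [avg, avg, ← tsum_mul_left]
  exact tsum_congr fun i => mul_left_comm _ _ _

lemma avg_shift (f : ℤ → ℝ) (c y : ℤ) : avg (fun b => f (b + c)) y = avg f (y + c) :=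
  tsum_congr fun i => by dsimp only; rw [sub_add_eq_add_sub]

lemma avg_finset_sum {ι : Type*} (s : Finset ι) {f : ι → ℤ → ℝ} (hf : ∀ i, VanishBelow (f i))
    (y : ℤ) : avg (fun b => ∑ i ∈ s, f i b) y = ∑ i ∈ s, avg (f i) y := by
  simp only [avg, Finset.mul_sum]
  exact Summable.tsum_finsetSum fun i _ => (hf i).summable y

lemma avg_eq_zero {g : ℤ → ℝ} {y : ℤ} (h : ∀ b < y, g b = 0) : avg g y = 0 := by
  rw [avg, ← tsum_zero]
  exact tsum_congr fun i => by rw [h _ (by omega), mul_zero]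

lemma avg_congr {f g : ℤ → ℝ} {y : ℤ} (h : ∀ b < y, f b = g b) : avg f y = avg g y :=
  tsum_congr fun i => by rw [h _ (by omega)]

lemma abs_avg_le {g : ℤ → ℝ} {y : ℤ} {B : ℝ} (h : ∀ b < y, |g b| ≤ B) : |avg g y| ≤ B := by
  have hs : HasSum (fun i : ℕ => (1 / 2 : ℝ) ^ (i + 1) * B) B := by
    have := (hasSum_geometric_two.mul_left (1 / 2 : ℝ)).mul_right B
    convert! this using 1
    · funext i; rw [pow_succ]; ring
    · ring
  rw [← Real.norm_eq_abs]
  refine tsum_of_norm_bounded hs fun i => ?_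
  rw [norm_mul, Real.norm_of_nonneg (by positivity), Real.norm_eq_abs]
  exact mul_le_mul_of_nonneg_left (h _ (by omega)) (by positivity)

lemma hit_succ_of_lt (s : ℕ → ℤ → ℝ) (n : ℕ) {X : ℕ → ℤ} {y : ℤ} (h : X 0 < y) :
    hit s (n + 1) X y = s (n + 1) y := if_pos h

lemma hit_succ_of_le (s : ℕ → ℤ → ℝ) (n : ℕ) {X : ℕ → ℤ} {y : ℤ} (h : y ≤ X 0) :
    hit s (n + 1) X y = avg (hit s n fun k => X (k + 1)) y := if_neg h.not_gt

/-- A walk that starts low enough never enters the epigraph, since each of its steps is at least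
one unit to the left. -/
lemma hit_eq_zero (s : ℕ → ℤ → ℝ) (n : ℕ) : ∀ (X : ℕ → ℤ) (y : ℤ), (∀ k < n, y ≤ X k + k) →
    hit s n X y = 0 := by
  induction n with
  | zero => intro X y _; rfl
  | succ n ih =>
    intro X y h
    rw [hit_succ_of_le s n (by simpa using h 0 (Nat.succ_pos n))]
    refine avg_eq_zero fun b hb => ih _ b fun k hk => ?_
    have := h (k + 1) (by omega)
    push_cast at this ⊢
    omega

/-- The size of the first `n` particle positions. -/
def size (n : ℕ) (X : ℕ → ℤ) : ℕ := ∑ k ∈ Finset.range n, (X k).natAbs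

lemma natAbs_le_size {n k : ℕ} (hk : k < n) (X : ℕ → ℤ) : (X k).natAbs ≤ size n X :=
  Finset.single_le_sum (f := fun k => (X k).natAbs) (fun _ _ => Nat.zero_le _)
    (Finset.mem_range.2 hk)

lemma hit_eq_zero_of_le_size (s : ℕ → ℤ → ℝ) (n : ℕ) (X : ℕ → ℤ) {y : ℤ}
    (hy : y ≤ -(size n X : ℤ)) : hit s n X y = 0 :=
  hit_eq_zero s n X y fun k hk => by
    have := natAbs_le_size hk X
    omega

lemma vanishBelow_hit (s : ℕ → ℤ → ℝ) (n : ℕ) (X : ℕ → ℤ) : VanishBelow (hit s n X) :=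
  ⟨_, fun _ hy => hit_eq_zero_of_le_size s n X hy⟩

lemma abs_hit_le (s : ℕ → ℤ → ℝ) {B : ℝ} (hB : 0 ≤ B) (n : ℕ) : ∀ (X : ℕ → ℤ) (y : ℤ),
    (∀ k < n, ∀ b ≤ y, (∃ j < n, X j < b) → |s (k + 1) b| ≤ B) → |hit s n X y| ≤ B := by
  induction n with
  | zero => intro X y _; simpa [hit] using hB
  | succ n ih =>
    intro X y h
    rcases lt_or_ge (X 0) y with h0 | h0
    · rw [hit_succ_of_lt s n h0]
      exact h n (Nat.lt_succ_self n) y le_rfl ⟨0, Nat.succ_pos n, h0⟩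
    · rw [hit_succ_of_le s n h0]
      refine abs_avg_le fun b hb => ih _ b fun k hk c hc ⟨j, hj, hjc⟩ => ?_
      exact h k (by omega) c (by omega) ⟨j + 1, by omega, hjc⟩

lemma hit_sub (s s' : ℕ → ℤ → ℝ) (n : ℕ) : ∀ (X : ℕ → ℤ) (y : ℤ),
    hit (fun m b => s m b - s' m b) n X y = hit s n X y - hit s' n X y := by
  induction n with
  | zero => intro X y; simp [hit]
  | succ n ih =>
    intro X y
    rcases lt_or_ge (X 0) y with h0 | h0
    · simp only [hit_succ_of_lt _ n h0]
    · simp only [hit_succ_of_le _ n h0]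
      rw [← avg_sub (vanishBelow_hit _ _ _) (vanishBelow_hit _ _ _)]
      exact avg_congr fun b _ => ih _ b

lemma hit_const_mul (c : ℝ) (s : ℕ → ℤ → ℝ) (n : ℕ) : ∀ (X : ℕ → ℤ) (y : ℤ),
    hit (fun m b => c * s m b) n X y = c * hit s n X y := by
  induction n with
  | zero => intro X y; simp [hit]
  | succ n ih =>
    intro X y
    rcases lt_or_ge (X 0) y with h0 | h0
    · simp only [hit_succ_of_lt _ n h0]
    · simp only [hit_succ_of_le _ n h0]
      rw [← avg_const_mul]
      exact avg_congr fun b _ => ih _ b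

lemma hit_hasDerivAt {s : ℝ → ℕ → ℤ → ℝ} {s' : ℕ → ℤ → ℝ} {t : ℝ}
    (h : ∀ n b, HasDerivAt (fun u => s u (n + 1) b) (s' (n + 1) b) t) (n : ℕ) :
    ∀ (X : ℕ → ℤ) (y : ℤ), HasDerivAt (fun u => hit (s u) n X y) (hit s' n X y) t := by
  induction n with
  | zero => intro X y; exact hasDerivAt_const t 0
  | succ n ih =>
    intro X y
    rcases lt_or_ge (X 0) y with h0 | h0
    · simp only [hit_succ_of_lt _ n h0]
      exact h n y
    · have e : ∀ f, hit f (n + 1) X y = _ := fun f => (hit_succ_of_le f n h0).trans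
        (avg_eq_sum (fun b hb => hit_eq_zero_of_le_size f n (fun k => X (k + 1)) hb) y)
      simp only [e]
      exact HasDerivAt.fun_sum fun i _ => (ih _ _).const_mul _

/-! ### Moving one particle changes the hitting functional by a rank one term -/

/-- The configuration `X` with particle `k` moved by `ε`; no ordering is enforced. -/
def move (X : ℕ → ℤ) (k : ℕ) (ε : ℤ) : ℕ → ℤ := Function.update X k (X k + ε)

lemma move_zero_zero (X : ℕ → ℤ) (ε : ℤ) : move X 0 ε 0 = X 0 + ε := by simp [move]

lemma move_zero_succ (X : ℕ → ℤ) (ε : ℤ) : (fun k => move X 0 ε (k + 1)) = fun k => X (k + 1) := by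
  funext k
  simp [move]

lemma move_succ_zero (X : ℕ → ℤ) (k : ℕ) (ε : ℤ) : move X (k + 1) ε 0 = X 0 := by simp [move]

lemma move_succ_succ (X : ℕ → ℤ) (k : ℕ) (ε : ℤ) :
    (fun j => move X (k + 1) ε (j + 1)) = move (fun j => X (j + 1)) k ε := by
  funext j
  by_cases h : j = k
  · subst h; simp [move]
  · simp [move, h]

/-- The change of `hit s n X y` under a unit move of one particle factorizes; the factor that
depends on the starting point does not depend on `s` and `n`. -/
lemma hit_move_sub (k : ℕ) {ε : ℤ} (hε : ε = 1 ∨ ε = -1) : ∀ X : ℕ → ℤ, ∃ φ : ℤ → ℝ,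
    ∀ (s : ℕ → ℤ → ℝ) (n : ℕ), ∃ π : ℝ, ∀ y,
      hit s n (move X k ε) y - hit s n X y = φ y * π := by
  induction k with
  | zero =>
    intro X
    set c : ℤ := max (X 0) (X 0 + ε) with hc
    refine ⟨fun y => if y = c then 1 else 0, fun s n => ?_⟩
    cases n with
    | zero => exact ⟨0, fun y => by simp [hit]⟩
    | succ n =>
      refine ⟨hit s (n + 1) (move X 0 ε) c - hit s (n + 1) X c, fun y => ?_⟩
      dsimp only
      split_ifs with h
      · rw [h, one_mul]
      · rw [zero_mul, sub_eq_zero]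
        rcases lt_or_ge c y with h1 | h1
        · rw [hit_succ_of_lt s n (by rw [move_zero_zero]; omega), hit_succ_of_lt s n (by omega)]
        · rw [hit_succ_of_le s n (by rw [move_zero_zero]; omega), hit_succ_of_le s n (by omega),
            move_zero_succ]
  | succ k ih =>
    intro X
    obtain ⟨φ, hφ⟩ := ih fun j => X (j + 1)
    refine ⟨fun y => if X 0 < y then 0 else avg φ y, fun s n => ?_⟩
    cases n with
    | zero => exact ⟨0, fun y => by simp [hit]⟩
    | succ n =>
      obtain ⟨π, hπ⟩ := hφ s n
      refine ⟨π, fun y => ?_⟩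
      dsimp only
      split_ifs with h
      · rw [hit_succ_of_lt s n h, hit_succ_of_lt s n (by rwa [move_succ_zero])]
        ring
      · rw [hit_succ_of_le s n (not_lt.1 h), hit_succ_of_le s n (by rw [move_succ_zero]; omega),
          move_succ_succ, ← avg_sub (vanishBelow_hit _ _ _) (vanishBelow_hit _ _ _)]
        simp only [hπ]
        rw [avg, avg, ← tsum_mul_right]
        exact tsum_congr fun i => by ring

/-- The recursion `Q⁻¹ s_{n+1} = s_n`, `Q⁻¹ s_1 = 0`. -/
structure IsHarmonic (s : ℕ → ℤ → ℝ) : Prop where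
  succ : ∀ n b, 2 * s (n + 2) (b + 1) - s (n + 2) b = s (n + 1) b
  one : ∀ b, 2 * s 1 (b + 1) - s 1 b = 0

lemma IsHarmonic.eq_hit {s : ℕ → ℤ → ℝ} (hs : IsHarmonic s) (n : ℕ) {X : ℕ → ℤ} {b : ℤ}
    (hb : X 0 < b) : 2 * s (n + 1) (b + 1) - s (n + 1) b = hit s n X b := by
  cases n with
  | zero => exact hs.one b
  | succ n => rw [hit_succ_of_lt s n hb]; exact hs.succ n b

/-- The total effect of moving single particles to the right, as a commutator of the hitting
functional with the shift. -/
lemma sum_hit_move_right {s s' : ℕ → ℤ → ℝ} (hs : IsHarmonic s)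
    (hs' : ∀ n b, s' (n + 1) b = s (n + 1) (b - 1)) (n : ℕ) : ∀ X : ℕ → ℤ, StrictAnti X → ∀ y,
    1 / 2 * (hit s n X (y - 1) - hit s' n X y) =
      ∑ k ∈ Finset.range n, (hit s n (move X k 1) y - hit s n X y) := by
  induction n with
  | zero => intro X _ y; simp [hit]
  | succ n ih =>
    intro X hX y
    have hX' : StrictAnti fun k => X (k + 1) := fun i j hij => hX (by omega)
    have h10 : X 1 < X 0 := hX one_pos
    set G := hit s n fun k => X (k + 1) with hG
    have hGv : VanishBelow G := vanishBelow_hit _ _ _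
    rw [Finset.sum_range_succ']
    rcases lt_trichotomy y (X 0 + 1) with h | h | h
    · have h0 : hit s (n + 1) (move X 0 1) y - hit s (n + 1) X y = 0 := by
        rw [hit_succ_of_le s n (by rw [move_zero_zero]; omega), hit_succ_of_le s n (by omega),
          move_zero_succ, sub_self]
      have h1 : ∀ k, hit s (n + 1) (move X (k + 1) 1) y - hit s (n + 1) X y =
          avg (fun b => hit s n (move (fun j => X (j + 1)) k 1) b - G b) y := fun k => by
        rw [hit_succ_of_le s n (by rw [move_succ_zero]; omega), hit_succ_of_le s n (by omega),
          move_succ_succ, avg_sub (vanishBelow_hit _ _ _) hGv]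
      rw [h0, add_zero]
      simp only [h1]
      rw [← avg_finset_sum _ fun k => (vanishBelow_hit _ _ _).sub hGv]
      simp only [hG, ← ih _ hX', sub_eq_add_neg _ (1 : ℤ)]
      rw [avg_const_mul, avg_sub ((vanishBelow_hit _ _ _).shift (-1)) (vanishBelow_hit _ _ _),
        avg_shift G (-1) y, hit_succ_of_le s n (by omega), hit_succ_of_le s' n (by omega)]
    · -- the walk starts at the new position of the first particle: only the move of that particle
      -- has an effect, and it is computed from `Q⁻¹ s_{n+1} = s_n`
      subst h
      have h1 : ∀ k, hit s (n + 1) (move X (k + 1) 1) (X 0 + 1) - hit s (n + 1) X (X 0 + 1) = 0 :=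
        fun k => by
          rw [hit_succ_of_lt s n (by rw [move_succ_zero]; omega), hit_succ_of_lt s n (by omega),
            sub_self]
      simp only [h1, Finset.sum_const_zero, zero_add]
      rw [hit_succ_of_le s n (X := move X 0 1) (by rw [move_zero_zero]),
        hit_succ_of_lt s n (X := X) (y := X 0 + 1) (by omega), hit_succ_of_lt s' n (by omega),
        add_sub_cancel_right, hit_succ_of_le s n (X := X) le_rfl, move_zero_succ, hs',
        add_sub_cancel_right]
      have h2 := two_mul_avg_sub_avg hGv (X 0)
      have h3 := hs.eq_hit n (X := fun k => X (k + 1)) h10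
      linarith
    · have h0 : hit s (n + 1) (move X 0 1) y - hit s (n + 1) X y = 0 := by
        rw [hit_succ_of_lt s n (by rw [move_zero_zero]; omega), hit_succ_of_lt s n (by omega),
          sub_self]
      have h1 : ∀ k, hit s (n + 1) (move X (k + 1) 1) y - hit s (n + 1) X y = 0 := fun k => by
        rw [hit_succ_of_lt s n (by rw [move_succ_zero]; omega), hit_succ_of_lt s n (by omega),
          sub_self]
      simp only [h0, h1, Finset.sum_const_zero, zero_add]
      rw [hit_succ_of_lt s n (by omega), hit_succ_of_lt s' n (by omega), hs']
      ring

/-- The total effect of moving single particles to the left, as a commutator of the hitting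
functional with the shift. -/
lemma sum_hit_move_left {s s' : ℕ → ℤ → ℝ} (hs : IsHarmonic s)
    (hs' : ∀ n b, s' (n + 1) b = s (n + 1) (b + 1)) (n : ℕ) : ∀ X : ℕ → ℤ, StrictAnti X → ∀ y,
    2 * (hit s n X (y + 1) - hit s' n X y) =
      ∑ k ∈ Finset.range n, (hit s n (move X k (-1)) y - hit s n X y) := by
  induction n with
  | zero => intro X _ y; simp [hit]
  | succ n ih =>
    intro X hX y
    have hX' : StrictAnti fun k => X (k + 1) := fun i j hij => hX (by omega)
    have h10 : X 1 < X 0 := hX one_pos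
    set G := hit s n fun k => X (k + 1) with hG
    have hGv : VanishBelow G := vanishBelow_hit _ _ _
    rw [Finset.sum_range_succ']
    rcases lt_or_ge (X 0) y with h | h
    · have h0 : hit s (n + 1) (move X 0 (-1)) y - hit s (n + 1) X y = 0 := by
        rw [hit_succ_of_lt s n (by rw [move_zero_zero]; omega), hit_succ_of_lt s n (by omega),
          sub_self]
      have h1 : ∀ k, hit s (n + 1) (move X (k + 1) (-1)) y - hit s (n + 1) X y = 0 := fun k => by
        rw [hit_succ_of_lt s n (by rw [move_succ_zero]; omega), hit_succ_of_lt s n (by omega),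
          sub_self]
      simp only [h0, h1, Finset.sum_const_zero, zero_add]
      rw [hit_succ_of_lt s n (by omega), hit_succ_of_lt s' n (by omega), hs']
      ring
    · have h1 : ∀ k, hit s (n + 1) (move X (k + 1) (-1)) y - hit s (n + 1) X y =
          avg (fun b => hit s n (move (fun j => X (j + 1)) k (-1)) b - G b) y := fun k => by
        rw [hit_succ_of_le s n (by rw [move_succ_zero]; omega), hit_succ_of_le s n (by omega),
          move_succ_succ, avg_sub (vanishBelow_hit _ _ _) hGv]
      simp only [h1]
      rw [← avg_finset_sum _ fun k => (vanishBelow_hit _ _ _).sub hGv]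
      simp only [hG, ← ih _ hX']
      rw [avg_const_mul, avg_sub ((vanishBelow_hit _ _ _).shift 1) (vanishBelow_hit _ _ _),
        avg_shift G 1 y, hit_succ_of_le s n (X := X) h, hit_succ_of_le s' n h]
      rcases h.lt_or_eq with h2 | h2
      · rw [hit_succ_of_le s n (X := move X 0 (-1)) (by rw [move_zero_zero]; omega),
          hit_succ_of_le s n (by omega), move_zero_succ]
        ring
      · -- the walk starts at the first particle, and is above it after the move
        rw [hit_succ_of_lt s n (X := move X 0 (-1)) (by rw [move_zero_zero]; omega),
          hit_succ_of_lt s n (by omega)]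
        have h3 := two_mul_avg_sub_avg hGv y
        have h4 := hs.eq_hit n (X := fun k => X (k + 1)) (b := y) (h2 ▸ h10)
        linarith

/-! ### Exclusion and pushing as boundary conditions -/

/-- The largest strictly decreasing configuration below `X` whose first entry is at most `c`. -/
def capped (c : ℤ) (X : ℕ → ℤ) : ℕ → ℤ
  | 0 => min c (X 0)
  | k + 1 => min (capped c X k - 1) (X (k + 1))

lemma capped_succ (c : ℤ) (X : ℕ → ℤ) :
    (fun k => capped c X (k + 1)) = capped (min c (X 0) - 1) fun k => X (k + 1) := by
  funext k
  induction k with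
  | zero => rfl
  | succ k ih =>
    rw [capped, ih]
    rfl

lemma hit_capped (s : ℕ → ℤ → ℝ) (n : ℕ) : ∀ (c : ℤ) (X : ℕ → ℤ) (y : ℤ), y ≤ c →
    hit s n (capped c X) y = hit s n X y := by
  induction n with
  | zero => intro c X y _; rfl
  | succ n ih =>
    intro c X y hy
    have h0 : capped c X 0 = min c (X 0) := rfl
    rcases lt_or_ge (X 0) y with h | h
    · rw [hit_succ_of_lt s n h, hit_succ_of_lt s n (by omega)]
    · rw [hit_succ_of_le s n h, hit_succ_of_le s n (by omega), capped_succ]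
      exact avg_congr fun b hb => ih _ _ b (by omega)

/-- The hitting functional does not distinguish a configuration from its strictly decreasing
modification: a walk above the removed part has already been above the previous particle. -/
lemma hit_capped_self (s : ℕ → ℤ → ℝ) (n : ℕ) (X : ℕ → ℤ) (y : ℤ) :
    hit s n (capped (X 0) X) y = hit s n X y := by
  rcases le_or_gt y (X 0) with h | h
  · exact hit_capped s n _ X y h
  · cases n with
    | zero => rfl
    | succ n =>
      rw [hit_succ_of_lt s n h, hit_succ_of_lt s n]
      simpa [capped] using h

lemma eq_capped {X Y : ℕ → ℤ} (h0 : Y 0 = X 0) (h : ∀ k, Y (k + 1) = min (Y k - 1) (X (k + 1))) :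
    Y = capped (X 0) X := by
  funext k
  induction k with
  | zero => simp [capped, h0]
  | succ k ih => rw [h, ih, capped]

open Classical in
/-- The configuration after an attempted jump of particle `k` to the right. -/
def jump (X : Config) (k : ℕ) : Config := if h : CanJump X k then jumpRight X k h else X

/-- Exclusion: a particle that is moved onto its right neighbour is put back. -/
lemma jump_eq_capped (X : Config) (k : ℕ) :
    (jump X k).1 = capped (move X.1 k 1 0) (move X.1 k 1) := by
  have hX : ∀ j, X.1 (j + 1) < X.1 j := fun j => X.2 (Nat.lt_succ_self j)
  by_cases h : CanJump X k
  · have e : (jump X k).1 = move X.1 k 1 := by rw [jump, dif_pos h]; rfl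
    refine eq_capped (by rw [e]) fun j => ?_
    have h1 : (jump X k).1 (j + 1) < (jump X k).1 j := (jump X k).2 (Nat.lt_succ_self j)
    rw [e] at h1 ⊢
    omega
  · have e : jump X k = X := dif_neg h
    rw [CanJump, not_or, not_lt] at h
    obtain ⟨h0, h1⟩ := h
    obtain ⟨k, rfl⟩ := Nat.exists_eq_succ_of_ne_zero h0
    simp only [Nat.succ_eq_add_one, add_tsub_cancel_right] at h1
    rw [e]
    refine eq_capped (by rw [Nat.succ_eq_add_one, move_succ_zero]) fun j => ?_
    have h2 := hX j
    by_cases hj : j = k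
    · subst hj
      simp [move]
      omega
    · simp [move, hj]
      omega

/-- Pushing: a particle that is hit from the right is moved on by one step. -/
lemma pushLeft_eq_capped (X : Config) (k : ℕ) :
    (pushLeft X k).1 = capped (move X.1 k (-1) 0) (move X.1 k (-1)) := by
  have hX : ∀ j, X.1 (j + 1) < X.1 j := fun j => X.2 (Nat.lt_succ_self j)
  have hv : ∀ j, (pushLeft X k).1 j = X.1 j - 1 ∧ InBlock X k j ∨
      (pushLeft X k).1 j = X.1 j ∧ ¬ InBlock X k j := fun j => by
    by_cases h : InBlock X k j <;> simp [pushLeft, h]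
  have hm : ∀ j, j ≠ k → move X.1 k (-1) j = X.1 j := fun j hj => by simp [move, hj]
  have hmk : move X.1 k (-1) k = X.1 k - 1 := by simp [move]; rfl
  have hle : ∀ i : ℕ, X.1 (k + i) ≤ X.1 k - i := fun i => by
    induction i with
    | zero => simp
    | succ i ih =>
      have := hX (k + i)
      push_cast
      rw [← add_assoc]
      omega
  have hkk : InBlock X k k := ⟨le_rfl, by simp⟩
  refine eq_capped ?_ fun j => ?_
  · rcases Nat.eq_zero_or_pos k with rfl | hk
    · rcases hv 0 with h | h
      · rw [h.1, hmk]
      · exact absurd hkk h.2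
    · rw [hm 0 hk.ne]
      rcases hv 0 with h | h
      · exact absurd h.2.1 (by omega)
      · exact h.1
  · have h1 := hX j
    by_cases hj : j + 1 = k
    · rw [hj, hmk]
      rcases hv k with h | h
      · rcases hv j with h2 | h2
        · exact absurd h2.2.1 (by omega)
        · rw [h.1, h2.1]
          rw [hj] at h1
          omega
      · exact absurd hkk h.2
    · rw [hm _ hj]
      unfold InBlock at hv
      have h2 := hv (j + 1)
      have h3 := hv j
      have h4 := hle (j - k)
      push_cast at h2
      by_cases hkj : k ≤ j
      · rw [Nat.add_sub_of_le hkj] at h4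
        omega
      · omega

lemma hit_jump (s : ℕ → ℤ → ℝ) (n : ℕ) (X : Config) (k : ℕ) (y : ℤ) :
    hit s n (jump X k).1 y = hit s n (move X.1 k 1) y := by
  rw [jump_eq_capped, hit_capped_self]

lemma hit_pushLeft (s : ℕ → ℤ → ℝ) (n : ℕ) (X : Config) (k : ℕ) (y : ℤ) :
    hit s n (pushLeft X k).1 y = hit s n (move X.1 k (-1)) y := by
  rw [pushLeft_eq_capped, hit_capped_self]

/-! ### The expectation over the walk equals the hitting functional -/

/-- The configuration without its rightmost particle. -/
def Config.tail (X : Config) : Config := ⟨fun k => X.1 (k + 1), fun _ _ h => X.2 (by omega)⟩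

open Classical in
/-- The random variable `s (n - τ) (B_τ) 1{τ < n}` as a function of the steps of the walk. -/
def payoff (s : ℕ → ℤ → ℝ) (X : Config) (n : ℕ) (z : ℤ) (ξ : Fin n → ℕ) : ℝ :=
  if h : ∃ k, InEpi X z ξ k then s (n - Nat.find h) (walk z ξ (Nat.find h)) else 0

lemma payoff_eq (s : ℕ → ℤ → ℝ) {X : Config} {n : ℕ} {z : ℤ} {ξ : Fin n → ℕ} {k : ℕ}
    (hk : InEpi X z ξ k) (hmin : ∀ j < k, ¬ InEpi X z ξ j) :
    payoff s X n z ξ = s (n - k) (walk z ξ k) := by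
  classical
  have h : ∃ k, InEpi X z ξ k := ⟨k, hk⟩
  have e : Nat.find h = k := (Nat.find_eq_iff h).2 ⟨hk, hmin⟩
  rw [payoff, dif_pos h]
  convert! rfl using 2
  · rw [← e]
  · rw [← e]

lemma payoff_cases (s : ℕ → ℤ → ℝ) (X : Config) (n : ℕ) (z : ℤ) (ξ : Fin n → ℕ) :
    (∃ k, InEpi X z ξ k ∧ (∀ j < k, ¬ InEpi X z ξ j) ∧
      payoff s X n z ξ = s (n - k) (walk z ξ k)) ∨
    ((∀ k, ¬ InEpi X z ξ k) ∧ payoff s X n z ξ = 0) := by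
  classical
  by_cases h : ∃ k, InEpi X z ξ k
  · have hmin : ∀ j < Nat.find h, ¬ InEpi X z ξ j := fun j hj => Nat.find_min h hj
    exact Or.inl ⟨Nat.find h, Nat.find_spec h, hmin, payoff_eq s (Nat.find_spec h) hmin⟩
  · exact Or.inr ⟨fun k hk => h ⟨k, hk⟩, dif_neg h⟩

lemma walk_zero {n : ℕ} (z : ℤ) (ξ : Fin n → ℕ) : walk z ξ 0 = z := by simp [walk]

lemma walk_succ {n : ℕ} (z : ℤ) (ξ : Fin (n + 1) → ℕ) (k : ℕ) :
    walk z ξ (k + 1) = walk (z - (ξ 0 + 1)) (Fin.tail ξ) k := by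
  simp only [walk, Fin.sum_univ_succ, Fin.tail, Fin.val_zero, Fin.val_succ, Nat.succ_pos, if_true,
    add_lt_add_iff_right]
  ring

lemma inEpi_succ (X : Config) {n : ℕ} (z : ℤ) (ξ : Fin (n + 1) → ℕ) (k : ℕ) :
    InEpi X z ξ (k + 1) ↔ InEpi X.tail (z - (ξ 0 + 1)) (Fin.tail ξ) k := by
  rw [InEpi, InEpi, walk_succ, add_lt_add_iff_right]
  rfl

lemma payoff_succ_of_lt (s : ℕ → ℤ → ℝ) {X : Config} {n : ℕ} {z : ℤ} (ξ : Fin (n + 1) → ℕ)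
    (h : X.1 0 < z) : payoff s X (n + 1) z ξ = s (n + 1) z := by
  rw [payoff_eq s (k := 0) ⟨Nat.succ_pos n, by rwa [walk_zero]⟩ (by simp), walk_zero]
  rfl

lemma payoff_succ_of_le (s : ℕ → ℤ → ℝ) {X : Config} {n : ℕ} {z : ℤ} (ξ : Fin (n + 1) → ℕ)
    (h : z ≤ X.1 0) : payoff s X (n + 1) z ξ =
      payoff s X.tail n (z - (ξ 0 + 1)) (Fin.tail ξ) := by
  have h0 : ¬ InEpi X z ξ 0 := fun h' => by
    have := h'.2
    rw [walk_zero] at this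
    omega
  rcases payoff_cases s X.tail n (z - (ξ 0 + 1)) (Fin.tail ξ) with ⟨k, hk, hmin, e⟩ | ⟨hno, e⟩
  · rw [e, payoff_eq s ((inEpi_succ X z ξ k).2 hk), walk_succ, Nat.add_sub_add_right]
    intro j hj
    cases j with
    | zero => exact h0
    | succ j => rw [inEpi_succ]; exact hmin j (by omega)
  · rw [e, payoff, dif_neg]
    rintro ⟨k, hk⟩
    cases k with
    | zero => exact h0 hk
    | succ k => exact hno k ((inEpi_succ X z ξ k).1 hk)

lemma exists_abs_payoff_le (s : ℕ → ℤ → ℝ) (X : Config) (n : ℕ) (z : ℤ) :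
    ∃ B, ∀ ξ, |payoff s X n z ξ| ≤ B := by
  refine ⟨∑ m ∈ Finset.range (n + 1), ∑ b ∈ Finset.Icc (-(size n X.1 : ℤ)) z, |s m b|, fun ξ => ?_⟩
  rcases payoff_cases s X n z ξ with ⟨k, hk, -, e⟩ | ⟨-, e⟩
  · have h1 := natAbs_le_size hk.1 X.1
    have h2 := hk.2
    have h3 : walk z ξ k ≤ z := by
      rw [walk, sub_le_self_iff]
      exact Finset.sum_nonneg fun i _ => by split_ifs <;> positivity
    have hb : walk z ξ k ∈ Finset.Icc (-(size n X.1 : ℤ)) z := Finset.mem_Icc.2 ⟨by omega, h3⟩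
    rw [e]
    exact (Finset.single_le_sum (f := fun b => |s (n - k) b|) (fun _ _ => abs_nonneg _) hb).trans
      (Finset.single_le_sum (f := fun m => ∑ b ∈ Finset.Icc (-(size n X.1 : ℤ)) z, |s m b|)
        (fun _ _ => Finset.sum_nonneg fun _ _ => abs_nonneg _)
        (Finset.mem_range.2 (by omega : n - k < n + 1)))
  · rw [e, abs_zero]
    exact Finset.sum_nonneg fun _ _ => Finset.sum_nonneg fun _ _ => abs_nonneg _

instance (n : ℕ) : IsProbabilityMeasure (stepLaw n) := by
  unfold stepLaw
  infer_instance

/-- Conditioning on the first step of the walk. -/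
lemma integral_stepLaw_succ (n : ℕ) (F : ℕ → (Fin n → ℕ) → ℝ) {B : ℝ} (hF : ∀ i ξ, |F i ξ| ≤ B) :
    ∫ ξ, F (ξ 0) (Fin.tail ξ) ∂stepLaw (n + 1) =
      ∑' i : ℕ, (1 / 2 : ℝ) ^ (i + 1) * ∫ ξ, F i ξ ∂stepLaw n := by
  set p : unitInterval := ⟨1 / 2, by norm_num, by norm_num⟩ with hp
  have hp0 : p ≠ 0 := fun h => by
    have := congrArg Subtype.val h
    simp [hp] at this
  have h1 := measurePreserving_piFinSuccAbove (fun _ : Fin (n + 1) => geometricMeasure p) 0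
  have h2 := h1.integral_comp' (g := fun q : ℕ × (Fin n → ℕ) => F q.1 q.2)
  have e : ∀ ξ : Fin (n + 1) → ℕ, (MeasurableEquiv.piFinSuccAbove (fun _ => ℕ) 0) ξ =
      (ξ 0, Fin.tail ξ) := fun ξ => rfl
  simp only [e] at h2
  have hint : Integrable (fun q : ℕ × (Fin n → ℕ) => F q.1 q.2)
      ((geometricMeasure p).prod (stepLaw n)) :=
    Integrable.of_bound (Measurable.of_discrete).aestronglyMeasurable B
      (ae_of_all _ fun q => hF q.1 q.2)
  calc ∫ ξ, F (ξ 0) (Fin.tail ξ) ∂stepLaw (n + 1)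
      = ∫ q, F q.1 q.2 ∂((geometricMeasure p).prod (stepLaw n)) := h2
    _ = ∫ i, ∫ ξ, F i ξ ∂stepLaw n ∂geometricMeasure p := integral_prod _ hint
    _ = _ := by
      rw [integral_geometricMeasure hp0]
      refine tsum_congr fun i => ?_
      rw [smul_eq_mul, hp, pow_succ]
      norm_num

lemma integral_payoff (s : ℕ → ℤ → ℝ) (n : ℕ) : ∀ (X : Config) (z : ℤ),
    ∫ ξ, payoff s X n z ξ ∂stepLaw n = hit s n X.1 z := by
  induction n with
  | zero =>
    intro X z
    have h : ∀ ξ, payoff s X 0 z ξ = 0 := fun ξ => dif_neg fun ⟨k, hk⟩ => by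
      have := hk.1
      omega
    simp [h, hit]
  | succ n ih =>
    intro X z
    rcases lt_or_ge (X.1 0) z with h | h
    · simp [payoff_succ_of_lt s _ h, hit_succ_of_lt s n h]
    · obtain ⟨B, hB⟩ := exists_abs_payoff_le s X (n + 1) z
      simp only [payoff_succ_of_le s _ h] at hB ⊢
      rw [integral_stepLaw_succ n (fun i ξ => payoff s X.tail n (z - (i + 1)) ξ) (B := B)
        (fun i ξ => by simpa using hB (Fin.cons i ξ)), hit_succ_of_le s n h]
      exact tsum_congr fun i => by rw [ih]; rfl

lemma SbarEpi_eq_hit (r ℓ t : ℝ) (X : Config) (n : ℕ) (z₁ z₂ : ℤ) :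
    SbarEpi r ℓ t X n z₁ z₂ = hit (fun m b => Sbar r ℓ t m b z₂) n X.1 z₁ :=
  integral_payoff (fun m b => Sbar r ℓ t m b z₂) n X z₁

/-! ### The kernel for arbitrary configurations: bounds and time derivative -/

lemma hit_congr (s : ℕ → ℤ → ℝ) (n : ℕ) : ∀ (X Y : ℕ → ℤ) (y : ℤ), (∀ k < n, X k = Y k) →
    hit s n X y = hit s n Y y := by
  induction n with
  | zero => intro X Y y _; rfl
  | succ n ih =>
    intro X Y y h
    have h0 := h 0 (Nat.succ_pos n)
    rcases lt_or_ge (X 0) y with h1 | h1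
    · rw [hit_succ_of_lt s n h1, hit_succ_of_lt s n (h0 ▸ h1)]
    · rw [hit_succ_of_le s n h1, hit_succ_of_le s n (h0 ▸ h1)]
      exact avg_congr fun b _ => ih _ _ b fun k hk => h (k + 1) (by omega)

lemma hit_move_of_le (s : ℕ → ℤ → ℝ) {n k : ℕ} (h : n ≤ k) (X : ℕ → ℤ) (ε y : ℤ) :
    hit s n (move X k ε) y = hit s n X y :=
  hit_congr s n _ _ y fun j hj =>
    Function.update_of_ne (by omega) _ _

/-- The family `𝓢̄_{-t,m}(·, z)`. -/
def Sb (r ℓ t : ℝ) (z : ℤ) (m : ℕ) (b : ℤ) : ℝ := Sbar r ℓ t m b z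

lemma isHarmonic_Sb (r ℓ t : ℝ) (z : ℤ) : IsHarmonic (Sb r ℓ t z) :=
  ⟨fun n b => Sbar_rec r ℓ t n b z, fun b => Sbar_one_rec r ℓ t b z⟩

lemma abs_hit_Sb_le (r ℓ T : ℝ) (n : ℕ) : ∃ C, 0 ≤ C ∧ ∀ t, |t| ≤ T → ∀ (z : ℤ) (X : ℕ → ℤ) (y : ℤ),
    |hit (Sb r ℓ t z) n X y| ≤ C * 3 ^ (y.natAbs + z.natAbs + size n X) := by
  choose C hC0 hC using Sbar_bound r ℓ T
  refine ⟨∑ k ∈ Finset.range n, C k, Finset.sum_nonneg fun k _ => hC0 k, fun t ht z X y => ?_⟩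
  have hS : 0 ≤ ∑ k ∈ Finset.range n, C k := Finset.sum_nonneg fun k _ => hC0 k
  refine abs_hit_le _ (by positivity) n X y fun k hk b hb ⟨j, hj, hjb⟩ => ?_
  have h1 := natAbs_le_size hj X
  refine (hC k t ht b z).trans ?_
  refine mul_le_mul (Finset.single_le_sum (f := C) (fun k _ => hC0 k) (Finset.mem_range.2 hk))
    (pow_le_pow_right₀ (by norm_num) (by omega)) (by positivity) hS

lemma summable_pow_natAbs_sub (x : ℤ) : Summable fun y : ℤ => (1 / 3 : ℝ) ^ (y - x).natAbs := by
  have h : Summable fun y : ℤ => (1 / 3 : ℝ) ^ y.natAbs := by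
    have hg := summable_geometric_of_lt_one (r := (1 / 3 : ℝ)) (by norm_num) (by norm_num)
    refine Summable.of_nat_of_neg (f := fun y : ℤ => (1 / 3 : ℝ) ^ y.natAbs) ?_ ?_ <;> simpa using hg
  exact h.comp_injective (sub_left_injective (b := x))

lemma tsum_pow_natAbs_sub (x : ℤ) :
    ∑' y : ℤ, (1 / 3 : ℝ) ^ (y - x).natAbs = ∑' y : ℤ, (1 / 3 : ℝ) ^ y.natAbs :=
  (Equiv.subRight x).tsum_eq fun y : ℤ => (1 / 3 : ℝ) ^ y.natAbs

/-- The terms of the product `𝓢^* 𝓢̄^{epi}` decay exponentially, locally uniformly in time. -/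
lemma abs_S_mul_hit_le (r ℓ T : ℝ) (n m : ℕ) : ∃ C, 0 ≤ C ∧ ∀ t, |t| ≤ T → ∀ (X : ℕ → ℤ) (x z y : ℤ),
    |S r ℓ t n y x * hit (Sb r ℓ t z) m X y| ≤
      C * 3 ^ (x.natAbs + z.natAbs + size m X) * (1 / 3) ^ (y - x).natAbs := by
  obtain ⟨C₁, h₁⟩ := S_bound r ℓ T n
  obtain ⟨C₂, h₂0, h₂⟩ := abs_hit_Sb_le r ℓ T m
  refine ⟨|C₁| * C₂, by positivity, fun t ht X x z y => ?_⟩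
  have e : (1 / 9 : ℝ) ^ (y - x).natAbs = (1 / 3) ^ (y - x).natAbs * (1 / 3) ^ (y - x).natAbs := by
    rw [← mul_pow]; norm_num
  have e2 : (1 / 3 : ℝ) ^ (y - x).natAbs * 3 ^ (y - x).natAbs = 1 := by
    rw [← mul_pow]; norm_num
  have h3 : (3 : ℝ) ^ (y.natAbs + z.natAbs + size m X) ≤
      3 ^ (y - x).natAbs * 3 ^ (x.natAbs + z.natAbs + size m X) := by
    rw [← pow_add]
    exact pow_le_pow_right₀ (by norm_num) (by omega)
  rw [abs_mul]
  calc |S r ℓ t n y x| * |hit (Sb r ℓ t z) m X y|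
      ≤ (|C₁| * (1 / 9) ^ (y - x).natAbs) *
        (C₂ * (3 ^ (y - x).natAbs * 3 ^ (x.natAbs + z.natAbs + size m X))) := by
        refine mul_le_mul ((h₁ t ht y x).trans ?_) ((h₂ t ht z X y).trans ?_) (abs_nonneg _)
          (by positivity)
        · exact mul_le_mul_of_nonneg_right (le_abs_self _) (by positivity)
        · exact mul_le_mul_of_nonneg_left h3 h₂0
    _ = |C₁| * C₂ * 3 ^ (x.natAbs + z.natAbs + size m X) * (1 / 3) ^ (y - x).natAbs *
        ((1 / 3 : ℝ) ^ (y - x).natAbs * 3 ^ (y - x).natAbs) := by rw [e]; ring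
    _ = _ := by rw [e2, mul_one]

lemma summable_S_mul_hit (r ℓ t : ℝ) (n m : ℕ) (X : ℕ → ℤ) (x z : ℤ) :
    Summable fun y : ℤ => S r ℓ t n y x * hit (Sb r ℓ t z) m X y := by
  obtain ⟨C, -, hC⟩ := abs_S_mul_hit_le r ℓ |t| n m
  exact Summable.of_norm_bounded ((summable_pow_natAbs_sub x).mul_left _)
    fun y => hC t le_rfl X x z y

/-- The product `(𝓢_{-t,-n})^* 𝓢̄^{epi(X)}_{-t,m}`. -/
def prodKernel (r ℓ t : ℝ) (n m : ℕ) (X : ℕ → ℤ) (x z : ℤ) : ℝ :=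
  ∑' y : ℤ, S r ℓ t n y x * hit (Sb r ℓ t z) m X y

lemma abs_prodKernel_le (r ℓ T : ℝ) (n m : ℕ) : ∃ C, 0 ≤ C ∧ ∀ t, |t| ≤ T → ∀ (X : ℕ → ℤ) (x z : ℤ),
    |prodKernel r ℓ t n m X x z| ≤ C * 3 ^ (x.natAbs + z.natAbs + size m X) := by
  obtain ⟨C, hC0, hC⟩ := abs_S_mul_hit_le r ℓ T n m
  refine ⟨C * ∑' y : ℤ, (1 / 3 : ℝ) ^ y.natAbs, mul_nonneg hC0 (tsum_nonneg fun _ => by positivity),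
    fun t ht X x z => ?_⟩
  have h := tsum_of_norm_bounded (f := fun y => S r ℓ t n y x * hit (Sb r ℓ t z) m X y)
    ((summable_pow_natAbs_sub x).mul_left (C * 3 ^ (x.natAbs + z.natAbs + size m X))).hasSum
    fun y => hC t ht X x z y
  rw [tsum_mul_left, tsum_pow_natAbs_sub] at h
  rw [← Real.norm_eq_abs]
  refine h.trans (le_of_eq ?_)
  ring

/-- The time derivative acts on the product kernel as a commutator with the shifts. -/
lemma prodKernel_hasDerivAt (r ℓ t : ℝ) (n m : ℕ) (X : ℕ → ℤ) (x z : ℤ) :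
    HasDerivAt (fun s => prodKernel r ℓ s n m X x z)
      (r * (1 / 2 * (prodKernel r ℓ t n m X (x - 1) z - prodKernel r ℓ t n m X x (z + 1))) +
        ℓ * (2 * (prodKernel r ℓ t n m X (x + 1) z - prodKernel r ℓ t n m X x (z - 1)))) t := by
  set T := |t| + 1 with hT
  obtain ⟨C, hC0, hC⟩ := abs_S_mul_hit_le r ℓ T n m
  let P : ℝ → ℤ → ℤ → ℤ → ℝ := fun s x z y => S r ℓ s n y x * hit (Sb r ℓ s z) m X y
  let u : ℤ → ℤ → ℤ → ℝ := fun x z y =>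
    C * 3 ^ (x.natAbs + z.natAbs + size m X) * (1 / 3) ^ (y - x).natAbs
  have hu : ∀ x z, Summable (u x z) := fun x z => (summable_pow_natAbs_sub x).mul_left _
  have hP : ∀ s, |s| ≤ T → ∀ x z y, |P s x z y| ≤ u x z y := fun s hs x z y => hC s hs X x z y
  have hPs : ∀ s x z, Summable (P s x z) := fun s x z => summable_S_mul_hit r ℓ s n m X x z
  have hd : ∀ s y, HasDerivAt (fun s => P s x z y)
      (r * (1 / 2) * (P s (x - 1) z y - P s x (z + 1) y) +
        ℓ * 2 * (P s (x + 1) z y - P s x (z - 1) y)) s := fun s y => by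
    have h1 := S_hasDerivAt r ℓ s n y x
    have h2 := hit_hasDerivAt (s := fun s => Sb r ℓ s z) (s' := fun m b =>
      (r / 2 * (Sb r ℓ s z m b - Sb r ℓ s (z + 1) m b) -
        2 * ℓ * (Sb r ℓ s (z - 1) m b - Sb r ℓ s z m b))) (t := s)
      (fun k b => Sbar_hasDerivAt r ℓ s k b z) m X y
    rw [hit_sub (fun m b => r / 2 * (Sb r ℓ s z m b - Sb r ℓ s (z + 1) m b))
      (fun m b => 2 * ℓ * (Sb r ℓ s (z - 1) m b - Sb r ℓ s z m b)),
      hit_const_mul (r / 2) (fun m b => Sb r ℓ s z m b - Sb r ℓ s (z + 1) m b),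
      hit_const_mul (2 * ℓ) (fun m b => Sb r ℓ s (z - 1) m b - Sb r ℓ s z m b),
      hit_sub, hit_sub] at h2
    refine (h1.mul h2).congr_deriv ?_
    simp only [P]
    ring
  have hbound : Summable fun y => |r * (1 / 2)| * (u (x - 1) z y + u x (z + 1) y) +
      |ℓ * 2| * (u (x + 1) z y + u x (z - 1) y) :=
    (((hu _ _).add (hu _ _)).mul_left _).add (((hu _ _).add (hu _ _)).mul_left _)
  have key := hasDerivAt_tsum_of_isPreconnected hbound (t := Ioo (-T) T) isOpen_Ioo
    isPreconnected_Ioo (g := fun y s => P s x z y)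
    (g' := fun y s => r * (1 / 2) * (P s (x - 1) z y - P s x (z + 1) y) +
        ℓ * 2 * (P s (x + 1) z y - P s x (z - 1) y)) (fun y s _ => hd s y)
    (fun y s hs => by
      have hs' : |s| ≤ T := (abs_lt.2 hs).le
      refine (abs_add_le _ _).trans ?_
      rw [abs_mul, abs_mul (ℓ * 2)]
      gcongr
      · exact (abs_sub _ _).trans (add_le_add (hP s hs' _ _ y) (hP s hs' _ _ y))
      · exact (abs_sub _ _).trans (add_le_add (hP s hs' _ _ y) (hP s hs' _ _ y)))
    (y₀ := t) (abs_lt.1 (by rw [hT]; linarith)) (hPs t x z) (abs_lt.1 (by rw [hT]; linarith))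
  refine key.congr_deriv ?_
  rw [Summable.tsum_add (((hPs _ _ _).sub (hPs _ _ _)).mul_left _)
    (((hPs _ _ _).sub (hPs _ _ _)).mul_left _), tsum_mul_left, tsum_mul_left,
    (hPs _ _ _).tsum_sub (hPs _ _ _), (hPs _ _ _).tsum_sub (hPs _ _ _)]
  simp only [P, prodKernel]
  ring

lemma prodKernel_shift (r ℓ t : ℝ) (n m : ℕ) (X : ℕ → ℤ) (x z c : ℤ) :
    prodKernel r ℓ t n m X (x - c) z = ∑' y : ℤ, S r ℓ t n y x * hit (Sb r ℓ t z) m X (y - c) := by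
  rw [← (Equiv.addRight c).tsum_eq, prodKernel]
  refine tsum_congr fun y => ?_
  have h := S_add r ℓ t n y (x - c) c
  rw [sub_add_cancel] at h
  simp [h]

lemma summable_S_mul_hit_sub (r ℓ t : ℝ) (n m : ℕ) (X : ℕ → ℤ) (x z c : ℤ) :
    Summable fun y : ℤ => S r ℓ t n y x * hit (Sb r ℓ t z) m X (y - c) := by
  rw [← (Equiv.addRight c).summable_iff]
  refine (summable_S_mul_hit r ℓ t n m X (x - c) z).congr fun y => ?_
  have h := S_add r ℓ t n y (x - c) c
  rw [sub_add_cancel] at h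
  simp [h]

lemma sum_prodKernel_move (r ℓ t : ℝ) (n m : ℕ) (X : ℕ → ℤ) (x z : ℤ) (ε : ℤ) {N : ℕ}
    (hm : m ≤ N) : ∑ k ∈ Finset.range N,
      (prodKernel r ℓ t n m (move X k ε) x z - prodKernel r ℓ t n m X x z) =
    ∑' y : ℤ, S r ℓ t n y x * ∑ k ∈ Finset.range m,
      (hit (Sb r ℓ t z) m (move X k ε) y - hit (Sb r ℓ t z) m X y) := by
  have hs := fun Y => summable_S_mul_hit r ℓ t n m Y x z
  have h0 : ∀ y, ∑ k ∈ Finset.range m, (hit (Sb r ℓ t z) m (move X k ε) y -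
      hit (Sb r ℓ t z) m X y) = ∑ k ∈ Finset.range N, (hit (Sb r ℓ t z) m (move X k ε) y -
      hit (Sb r ℓ t z) m X y) := fun y => by
    refine Finset.sum_subset (Finset.range_subset_range.2 hm) fun k _ hk => ?_
    rw [hit_move_of_le _ (by simpa using hk), sub_self]
  simp only [h0, Finset.mul_sum, mul_sub]
  rw [Summable.tsum_finsetSum fun k _ => (hs _).sub (hs _)]
  refine Finset.sum_congr rfl fun k _ => ?_
  rw [(hs _).tsum_sub (hs _)]
  rfl

lemma prodKernel_comm_right (r ℓ t : ℝ) (n m : ℕ) {X : ℕ → ℤ} (hX : StrictAnti X) (x z : ℤ) {N : ℕ}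
    (hm : m ≤ N) :
    1 / 2 * (prodKernel r ℓ t n m X (x - 1) z - prodKernel r ℓ t n m X x (z + 1)) =
      ∑ k ∈ Finset.range N,
        (prodKernel r ℓ t n m (move X k 1) x z - prodKernel r ℓ t n m X x z) := by
  have h := sum_hit_move_right (isHarmonic_Sb r ℓ t z) (s' := Sb r ℓ t (z + 1)) (fun n b => by
    have := Sbar_add r ℓ t n (b - 1) z 1
    rwa [sub_add_cancel] at this) m X hX
  rw [sum_prodKernel_move _ _ _ _ _ _ _ _ _ hm]
  simp only [← h]
  rw [prodKernel_shift, prodKernel, ← (summable_S_mul_hit_sub r ℓ t n m X x z 1).tsum_sub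
    (summable_S_mul_hit r ℓ t n m X x (z + 1)), ← tsum_mul_left]
  exact tsum_congr fun y => by ring

lemma prodKernel_comm_left (r ℓ t : ℝ) (n m : ℕ) {X : ℕ → ℤ} (hX : StrictAnti X) (x z : ℤ) {N : ℕ}
    (hm : m ≤ N) :
    2 * (prodKernel r ℓ t n m X (x + 1) z - prodKernel r ℓ t n m X x (z - 1)) =
      ∑ k ∈ Finset.range N,
        (prodKernel r ℓ t n m (move X k (-1)) x z - prodKernel r ℓ t n m X x z) := by
  have h := sum_hit_move_left (isHarmonic_Sb r ℓ t z) (s' := Sb r ℓ t (z - 1)) (fun n b => by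
    have := Sbar_add r ℓ t n b (z - 1) 1
    rw [sub_add_cancel] at this
    exact this.symm) m X hX
  rw [sum_prodKernel_move _ _ _ _ _ _ _ _ _ hm]
  simp only [← h]
  have h1 := summable_S_mul_hit_sub r ℓ t n m X x z (-1)
  have h2 := prodKernel_shift r ℓ t n m X x z (-1)
  simp only [sub_neg_eq_add] at h1 h2
  rw [h2, prodKernel, ← h1.tsum_sub (summable_S_mul_hit r ℓ t n m X x (z - 1)), ← tsum_mul_left]
  exact tsum_congr fun y => by ring

/-- The kernel `χ̄_a K_t χ̄_a` for an arbitrary, not necessarily decreasing configuration. -/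
def extKernel (r ℓ t : ℝ) (X : ℕ → ℤ) {m : ℕ} (n : Fin m → ℕ) (a : Fin m → ℤ)
    (p q : Fin m × ℤ) : ℝ :=
  (if p.2 ≤ a p.1 then 1 else 0) *
    (-(if n p.1 < n q.1 then kpow Q (n q.1 - n p.1) p.2 q.2 else 0) +
      prodKernel r ℓ t (n p.1) (n q.1) X p.2 q.2) * (if q.2 ≤ a q.1 then 1 else 0)

lemma kernel_eq (r ℓ t : ℝ) (X : Config) {m : ℕ} (n : Fin m → ℕ) (p q : Fin m × ℤ) :
    kernel r ℓ t X n p q = -(if n p.1 < n q.1 then kpow Q (n q.1 - n p.1) p.2 q.2 else 0) +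
      prodKernel r ℓ t (n p.1) (n q.1) X.1 p.2 q.2 := by
  simp only [kernel, prodKernel, SbarEpi_eq_hit]
  rfl

lemma cutKernel_eq (r ℓ t : ℝ) (X : Config) {m : ℕ} (n : Fin m → ℕ) (a : Fin m → ℤ) :
    cutKernel r ℓ t X n a = extKernel r ℓ t X.1 n a := by
  funext p q
  rw [cutKernel, kernel_eq, extKernel]

lemma cutKernel_jump (r ℓ t : ℝ) (X : Config) (k : ℕ) {m : ℕ} (n : Fin m → ℕ) (a : Fin m → ℤ) :
    cutKernel r ℓ t (jump X k) n a = extKernel r ℓ t (move X.1 k 1) n a := by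
  rw [cutKernel_eq]
  funext p q
  simp only [extKernel, prodKernel, hit_jump]

lemma cutKernel_pushLeft (r ℓ t : ℝ) (X : Config) (k : ℕ) {m : ℕ} (n : Fin m → ℕ)
    (a : Fin m → ℤ) :
    cutKernel r ℓ t (pushLeft X k) n a = extKernel r ℓ t (move X.1 k (-1)) n a := by
  rw [cutKernel_eq]
  funext p q
  simp only [extKernel, prodKernel, hit_pushLeft]

lemma extKernel_move_sub (r ℓ t : ℝ) (X : ℕ → ℤ) (k : ℕ) {ε : ℤ} (hε : ε = 1 ∨ ε = -1) {m : ℕ}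
    (n : Fin m → ℕ) (a : Fin m → ℤ) : ∃ u v : Fin m × ℤ → ℝ, ∀ p q,
      extKernel r ℓ t (move X k ε) n a p q - extKernel r ℓ t X n a p q = u p * v q := by
  obtain ⟨φ, hφ⟩ := hit_move_sub k hε X
  choose π hπ using hφ
  refine ⟨fun p => (if p.2 ≤ a p.1 then 1 else 0) * ∑' y, S r ℓ t (n p.1) y p.2 * φ y,
    fun q => π (Sb r ℓ t q.2) (n q.1) * (if q.2 ≤ a q.1 then 1 else 0), fun p q => ?_⟩
  have h : prodKernel r ℓ t (n p.1) (n q.1) (move X k ε) p.2 q.2 -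
      prodKernel r ℓ t (n p.1) (n q.1) X p.2 q.2 =
      (∑' y, S r ℓ t (n p.1) y p.2 * φ y) * π (Sb r ℓ t q.2) (n q.1) := by
    rw [prodKernel, prodKernel, ← (summable_S_mul_hit ..).tsum_sub (summable_S_mul_hit ..),
      ← tsum_mul_right]
    refine tsum_congr fun y => ?_
    rw [← mul_sub, hπ, mul_assoc]
  rw [extKernel, extKernel]
  linear_combination (if p.2 ≤ a p.1 then 1 else 0) * (if q.2 ≤ a q.1 then 1 else 0) * h

lemma cutKernel_hasDerivAt (r ℓ t : ℝ) (X : Config) {m : ℕ} {n : Fin m → ℕ} (a : Fin m → ℤ)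
    {N : ℕ} (hN : ∀ j, n j ≤ N) (p q : Fin m × ℤ) :
    HasDerivAt (fun s => cutKernel r ℓ s X n a p q)
      (r * ∑ k ∈ Finset.range N,
          (cutKernel r ℓ t (jump X k) n a p q - cutKernel r ℓ t X n a p q) +
        ℓ * ∑ k ∈ Finset.range N,
          (cutKernel r ℓ t (pushLeft X k) n a p q - cutKernel r ℓ t X n a p q)) t := by
  have h := ((((prodKernel_hasDerivAt r ℓ t (n p.1) (n q.1) X.1 p.2 q.2).const_add
    (-(if n p.1 < n q.1 then kpow Q (n q.1 - n p.1) p.2 q.2 else 0))).const_mul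
    (if p.2 ≤ a p.1 then (1 : ℝ) else 0)).mul_const (if q.2 ≤ a q.1 then (1 : ℝ) else 0))
  simp only [cutKernel_eq r ℓ _ X, cutKernel_jump, cutKernel_pushLeft]
  refine h.congr_deriv ?_
  rw [prodKernel_comm_right r ℓ t _ _ X.2 _ _ (hN q.1),
    prodKernel_comm_left r ℓ t _ _ X.2 _ _ (hN q.1)]
  simp only [extKernel, ← sub_mul, ← mul_sub, ← Finset.sum_mul, ← Finset.mul_sum,
    add_sub_add_left_eq_sub]
  ring

/-! ### Each term of the Fredholm series solves the backward equation -/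

section Det

variable {ι : Type*} [Fintype ι] [DecidableEq ι]

/-- The determinant as a continuous multilinear function of the rows. -/
def detRows (ι : Type*) [Fintype ι] [DecidableEq ι] :
    ContinuousMultilinearMap ℝ (fun _ : ι => ι → ℝ) ℝ :=
  ⟨(Matrix.detRowAlternating (n := ι) (R := ℝ)).toMultilinearMap,
    Continuous.matrix_det (A := fun M : ι → ι → ℝ => (Matrix.of M)) continuous_id⟩

/-- Along a rank one perturbation the determinant equals its linearization. -/
lemma detRows_add_rankOne (M : ι → ι → ℝ) (u v : ι → ℝ) :
    detRows ι (fun i j => M i j + u i * v j) - detRows ι M =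
      (detRows ι).linearDeriv M fun i j => u i * v j := by
  set B : Finset ι → ι → ι → ℝ := fun s i j => if i ∈ s then M i j + u i * v j else M i j with hB
  have hrow : ∀ (s : Finset ι) (k : ι), k ∉ s → detRows ι (Function.update (B s) k v) =
      detRows ι (Function.update M k v) := fun s k hk => by
    refine Matrix.det_eq_of_forall_row_eq_smul_add_const (fun i => if i ∈ s then u i else 0) k
      (if_neg hk) fun i j => ?_
    change Function.update (B s) k v i j = Function.update M k v i j +
      (if i ∈ s then u i else 0) * Function.update M k v k j
    rcases eq_or_ne i k with rfl | hik
    · simp [hk]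
    · by_cases hi : i ∈ s <;> simp [hik, hB, hi]
  have key : ∀ s : Finset ι, detRows ι (B s) = detRows ι M +
      ∑ i ∈ s, u i * detRows ι (Function.update M i v) := fun s => by
    induction s using Finset.induction_on with
    | empty => simp [hB]
    | insert k s hk ih =>
      have e : B (insert k s) = Function.update (B s) k (B s k + u k • v) := by
        funext i j
        rcases eq_or_ne i k with rfl | hik
        · simp [hB, hk]
        · simp [hB, hik]
      rw [e, ContinuousMultilinearMap.map_update_add, ContinuousMultilinearMap.map_update_smul,
        Function.update_eq_self, hrow s k hk, ih, Finset.sum_insert hk, smul_eq_mul]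
      ring
  have e1 : (fun i j => M i j + u i * v j) = B Finset.univ := by
    funext i j; simp [hB]
  rw [e1, key, add_sub_cancel_left, ContinuousMultilinearMap.linearDeriv_apply]
  refine Finset.sum_congr rfl fun i _ => ?_
  exact ((detRows ι).map_update_smul M i (u i) v).symm

lemma detRows_hasDerivAt {M : ℝ → ι → ι → ℝ} {M' : ι → ι → ℝ} {t : ℝ}
    (h : ∀ i j, HasDerivAt (fun s => M s i j) (M' i j) t) :
    HasDerivAt (fun s => detRows ι (M s)) ((detRows ι).linearDeriv (M t) M') t :=
  ((detRows ι).hasFDerivAt (M t)).comp_hasDerivAt t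
    (hasDerivAt_pi.2 fun i => hasDerivAt_pi.2 fun j => h i j)

end Det

/-- The generator on functions of the first `N` particles, as a finite sum. -/
def gen (r ℓ : ℝ) (N : ℕ) (f : Config → ℝ) (X : Config) : ℝ :=
  r * ∑ k ∈ Finset.range N, (f (jump X k) - f X) +
    ℓ * ∑ k ∈ Finset.range N, (f (pushLeft X k) - f X)

lemma fredholmTerm_eq {ι : Type*} [DecidableEq ι] (K : ι → ι → ℝ) (A : Finset ι) :
    fredholmTerm K A = (-1) ^ A.card * detRows A fun x y => K x y := rfl

/-- Each term of the Fredholm series solves the backward equation. The derivative of the kernel is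
the sum of its increments under single moves; each increment has rank one, so the derivative of the
determinant in its direction is the increment of the determinant. -/
lemma fredholmTerm_hasDerivAt (r ℓ t : ℝ) (X : Config) {m : ℕ} {n : Fin m → ℕ} (a : Fin m → ℤ)
    {N : ℕ} (hN : ∀ j, n j ≤ N) (A : Finset (Fin m × ℤ)) :
    HasDerivAt (fun s => fredholmTerm (cutKernel r ℓ s X n a) A)
      (gen r ℓ N (fun Y => fredholmTerm (cutKernel r ℓ t Y n a) A) X) t := by
  simp only [fredholmTerm_eq]
  set M : Config → A → A → ℝ := fun Y x y => cutKernel r ℓ t Y n a x y with hM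
  have h := (detRows_hasDerivAt (M := fun s (x y : A) => cutKernel r ℓ s X n a x y)
    fun x y => cutKernel_hasDerivAt r ℓ t X a hN x y).const_mul ((-1 : ℝ) ^ A.card)
  have hrank : ∀ Y : Config, (∃ u v : Fin m × ℤ → ℝ, ∀ p q,
      cutKernel r ℓ t Y n a p q - cutKernel r ℓ t X n a p q = u p * v q) →
      detRows A (M Y) - detRows A (M X) = (detRows A).linearDeriv (M X) (M Y - M X) := by
    rintro Y ⟨u, v, huv⟩
    have e : M Y - M X = fun x y : A => u ↑x * v ↑y := by
      funext x y; exact huv x y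
    have e' : M Y = fun x y : A => M X x y + u ↑x * v ↑y := by
      rw [← sub_add_cancel (M Y) (M X), e]
      funext x y
      exact add_comm _ _
    rw [e, ← detRows_add_rankOne (M X) (fun x : A => u ↑x) (fun y : A => v ↑y), ← e']
  have hj : ∀ k, _ := fun k => hrank (jump X k) (by
    simp only [cutKernel_jump, cutKernel_eq r ℓ t X]
    exact extKernel_move_sub r ℓ t X.1 k (Or.inl rfl) n a)
  have hp : ∀ k, _ := fun k => hrank (pushLeft X k) (by
    simp only [cutKernel_pushLeft, cutKernel_eq r ℓ t X]
    exact extKernel_move_sub r ℓ t X.1 k (Or.inr rfl) n a)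
  refine h.congr_deriv ?_
  have e : (fun x y : A => r * ∑ k ∈ Finset.range N,
        (cutKernel r ℓ t (jump X k) n a x y - cutKernel r ℓ t X n a x y) +
      ℓ * ∑ k ∈ Finset.range N,
        (cutKernel r ℓ t (pushLeft X k) n a x y - cutKernel r ℓ t X n a x y)) =
      r • ∑ k ∈ Finset.range N, (M (jump X k) - M X) +
        ℓ • ∑ k ∈ Finset.range N, (M (pushLeft X k) - M X) := by
    funext x y
    simp [hM]
  rw [e, map_add, map_smul, map_smul, map_sum, map_sum]
  change (-1 : ℝ) ^ A.card * (r * ∑ k ∈ Finset.range N, (detRows A).linearDeriv (M X) _ +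
      ℓ * ∑ k ∈ Finset.range N, (detRows A).linearDeriv (M X) _) =
    r * ∑ k ∈ Finset.range N,
      ((-1 : ℝ) ^ A.card * detRows A (M (jump X k)) - (-1 : ℝ) ^ A.card * detRows A (M X)) +
    ℓ * ∑ k ∈ Finset.range N,
      ((-1 : ℝ) ^ A.card * detRows A (M (pushLeft X k)) - (-1 : ℝ) ^ A.card * detRows A (M X))
  simp only [← mul_sub, ← Finset.mul_sum, hj, hp]
  ring

lemma jump_apply_of_ne (X : Config) {k j : ℕ} (h : j ≠ k) : (jump X k).1 j = X.1 j := by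
  unfold jump
  split_ifs
  · exact Function.update_of_ne h _ _
  · rfl

lemma jump_apply_self (X : Config) (k : ℕ) :
    (jump X k).1 k = X.1 k ∨ (jump X k).1 k = X.1 k + 1 := by
  unfold jump
  split_ifs
  · exact Or.inr (Function.update_self _ _ _)
  · exact Or.inl rfl

lemma pushLeft_apply (X : Config) (k j : ℕ) :
    (pushLeft X k).1 j = X.1 j ∨ (pushLeft X k).1 j = X.1 j - 1 := by
  by_cases h : InBlock X k j <;> simp [pushLeft, h]

lemma pushLeft_apply_of_lt (X : Config) {k j : ℕ} (h : j < k) : (pushLeft X k).1 j = X.1 j :=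
  if_neg fun h' => absurd h'.1 (by omega)

lemma generator_eq_gen (r ℓ : ℝ) {N : ℕ} {f : Config → ℝ} (hf : DependsOnFirst N f) :
    generator r ℓ f = gen r ℓ N f := by
  classical
  funext X
  have h1 : ∀ k, N ≤ k → f (jump X k) - f X = 0 := fun k hk =>
    sub_eq_zero.2 (hf _ _ fun j hj => jump_apply_of_ne X (by omega))
  have h2 : ∀ k, N ≤ k → f (pushLeft X k) - f X = 0 := fun k hk =>
    sub_eq_zero.2 (hf _ _ fun j hj => pushLeft_apply_of_lt X (by omega))
  have e : ∀ k, (if h : CanJump X k then f (jumpRight X k h) - f X else 0) =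
      f (jump X k) - f X := fun k => by
    unfold jump
    split_ifs <;> simp
  have hs : ∀ g : ℕ → ℝ, (∀ k, N ≤ k → g k = 0) → ∑ᶠ k, g k = ∑ k ∈ Finset.range N, g k :=
    fun g hg => finsum_eq_sum_of_support_subset g fun k hk => by
      by_contra h
      exact hk (hg k (by simpa using h))
  have h3 := hs _ h1
  have h4 := hs _ h2
  rw [generator, gen, h4, ← h3]
  congr 3
  funext k
  convert! e k

lemma dependsOnFirst_gen (r ℓ : ℝ) {N : ℕ} {f : Config → ℝ} (hf : DependsOnFirst N f) :
    DependsOnFirst N (gen r ℓ N f) := by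
  intro X Y h
  have e0 : f X = f Y := hf X Y h
  have h1 : ∀ k ∈ Finset.range N, f (jump X k) - f X = f (jump Y k) - f Y := fun k hk => by
    rw [Finset.mem_range] at hk
    rw [e0]
    congr 1
    refine hf _ _ fun j hj => ?_
    have hc : CanJump X k ↔ CanJump Y k := by
      rw [CanJump, CanJump, h k hk, h (k - 1) (by omega)]
    by_cases hX : CanJump X k
    · rw [jump, jump, dif_pos hX, dif_pos (hc.1 hX)]
      simp [jumpRight, Function.update_apply, h j hj, h k hk]
    · rw [jump, jump, dif_neg hX, dif_neg (mt hc.2 hX), h j hj]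
  have h2 : ∀ k ∈ Finset.range N, f (pushLeft X k) - f X = f (pushLeft Y k) - f Y := fun k hk => by
    rw [Finset.mem_range] at hk
    rw [e0]
    congr 1
    refine hf _ _ fun j hj => ?_
    have hb : InBlock X k j ↔ InBlock Y k j := by rw [InBlock, InBlock, h j hj, h k hk]
    by_cases hY : InBlock Y k j
    · simp [pushLeft, hb.2 hY, hY, h j hj]
    · simp [pushLeft, mt hb.1 hY, hY, h j hj]
  rw [gen, gen, Finset.sum_congr rfl h1, Finset.sum_congr rfl h2]

lemma dependsOnFirst_cutKernel (r ℓ t : ℝ) {m : ℕ} {n : Fin m → ℕ} (a : Fin m → ℤ) {N : ℕ}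
    (hN : ∀ j, n j ≤ N) {X Y : Config} (h : ∀ k < N, X.1 k = Y.1 k) :
    cutKernel r ℓ t X n a = cutKernel r ℓ t Y n a := by
  funext p q
  simp only [cutKernel_eq, extKernel, prodKernel]
  have e : ∀ y, hit (Sb r ℓ t q.2) (n q.1) X.1 y = hit (Sb r ℓ t q.2) (n q.1) Y.1 y := fun y =>
    hit_congr _ _ _ _ y fun k hk => h k (hk.trans_le (hN q.1))
  simp only [e]

/-! ### The backward equation on functions of finitely many particles -/

lemma size_jump_le (N : ℕ) (X : Config) (k : ℕ) : size N (jump X k).1 ≤ size N X.1 + N := by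
  have h : size N (jump X k).1 ≤ ∑ j ∈ Finset.range N, ((X.1 j).natAbs + 1) := by
    refine Finset.sum_le_sum fun j _ => ?_
    rcases eq_or_ne j k with rfl | hj
    · rcases jump_apply_self X j with h | h <;> omega
    · rw [jump_apply_of_ne X hj]; omega
  simpa [Finset.sum_add_distrib, size] using h

lemma size_pushLeft_le (N : ℕ) (X : Config) (k : ℕ) :
    size N (pushLeft X k).1 ≤ size N X.1 + N := by
  have h : size N (pushLeft X k).1 ≤ ∑ j ∈ Finset.range N, ((X.1 j).natAbs + 1) := by
    refine Finset.sum_le_sum fun j _ => ?_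
    rcases pushLeft_apply X k j with h | h <;> omega
  simpa [Finset.sum_add_distrib, size] using h

/-- A bound for the norm of the generator on functions dominated by `w ^ (size N X)`. -/
def genBound (r ℓ : ℝ) (N : ℕ) (w : ℝ) : ℝ := (r + ℓ) * (N * (w ^ N + 1))

/-- The iterates of the generator. -/
def genIter (r ℓ : ℝ) (N k : ℕ) (f : Config → ℝ) : Config → ℝ := (gen r ℓ N)^[k] f

lemma genIter_succ (r ℓ : ℝ) (N k : ℕ) (f : Config → ℝ) :
    genIter r ℓ N (k + 1) f = gen r ℓ N (genIter r ℓ N k f) := Function.iterate_succ_apply' _ _ _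

section

variable {r ℓ : ℝ} (hr : 0 ≤ r) (hℓ : 0 ≤ ℓ) {N : ℕ}

include hr hℓ in
lemma genBound_nonneg {w : ℝ} (hw : 1 ≤ w) : 0 ≤ genBound r ℓ N w := by
  unfold genBound
  positivity

include hr hℓ in
/-- The generator is bounded on exponentially weighted functions, since every move changes the
weight by at most a constant factor; stated for families, summed over the index. -/
lemma sum_abs_gen_le {ι : Type*} {s : Finset ι} {f : ι → Config → ℝ} {C w : ℝ} (hw : 1 ≤ w)
    (hC : 0 ≤ C) (h : ∀ X, ∑ i ∈ s, |f i X| ≤ C * w ^ size N X.1) (X : Config) :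
    ∑ i ∈ s, |gen r ℓ N (f i) X| ≤ C * genBound r ℓ N w * w ^ size N X.1 := by
  have hmove : ∀ Y : Config, size N Y.1 ≤ size N X.1 + N →
      ∑ i ∈ s, |f i Y - f i X| ≤ C * (w ^ N + 1) * w ^ size N X.1 := fun Y hY => by
    calc ∑ i ∈ s, |f i Y - f i X| ≤ ∑ i ∈ s, (|f i Y| + |f i X|) :=
          Finset.sum_le_sum fun i _ => abs_sub _ _
      _ ≤ C * w ^ (size N X.1 + N) + C * w ^ size N X.1 := by
          rw [Finset.sum_add_distrib]
          refine add_le_add ((h Y).trans ?_) (h X)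
          exact mul_le_mul_of_nonneg_left (pow_le_pow_right₀ hw hY) hC
      _ = _ := by rw [pow_add]; ring
  have hsum : ∀ R : ℕ → Config, (∀ k, size N (R k).1 ≤ size N X.1 + N) →
      ∑ i ∈ s, |∑ k ∈ Finset.range N, (f i (R k) - f i X)| ≤
        N * (C * (w ^ N + 1) * w ^ size N X.1) := fun R hR => by
    calc ∑ i ∈ s, |∑ k ∈ Finset.range N, (f i (R k) - f i X)|
        ≤ ∑ i ∈ s, ∑ k ∈ Finset.range N, |f i (R k) - f i X| :=
          Finset.sum_le_sum fun i _ => Finset.abs_sum_le_sum_abs _ _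
      _ = ∑ k ∈ Finset.range N, ∑ i ∈ s, |f i (R k) - f i X| := Finset.sum_comm
      _ ≤ ∑ k ∈ Finset.range N, C * (w ^ N + 1) * w ^ size N X.1 :=
          Finset.sum_le_sum fun k _ => hmove _ (hR k)
      _ = _ := by simp
  calc ∑ i ∈ s, |gen r ℓ N (f i) X|
      ≤ ∑ i ∈ s, (r * |∑ k ∈ Finset.range N, (f i (jump X k) - f i X)| +
          ℓ * |∑ k ∈ Finset.range N, (f i (pushLeft X k) - f i X)|) := by
        refine Finset.sum_le_sum fun i _ => (abs_add_le _ _).trans (le_of_eq ?_)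
        rw [abs_mul, abs_mul, abs_of_nonneg hr, abs_of_nonneg hℓ]
    _ ≤ r * (N * (C * (w ^ N + 1) * w ^ size N X.1)) +
        ℓ * (N * (C * (w ^ N + 1) * w ^ size N X.1)) := by
        rw [Finset.sum_add_distrib, ← Finset.mul_sum, ← Finset.mul_sum]
        gcongr
        · exact hsum _ fun k => size_jump_le N X k
        · exact hsum _ fun k => size_pushLeft_le N X k
    _ = _ := by rw [genBound]; ring

include hr hℓ in
lemma sum_abs_genIter_le {ι : Type*} {s : Finset ι} {f : ι → Config → ℝ} {C w : ℝ} (hw : 1 ≤ w)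
    (hC : 0 ≤ C) (h : ∀ X, ∑ i ∈ s, |f i X| ≤ C * w ^ size N X.1) (k : ℕ) : ∀ X : Config,
    ∑ i ∈ s, |genIter r ℓ N k (f i) X| ≤ C * genBound r ℓ N w ^ k * w ^ size N X.1 := by
  induction k with
  | zero => intro X; simpa [genIter] using h X
  | succ k ih =>
    intro X
    simp only [genIter_succ]
    have := sum_abs_gen_le hr hℓ hw
      (mul_nonneg hC (pow_nonneg (genBound_nonneg hr hℓ (N := N) hw) k)) ih X
    rwa [mul_assoc C, ← pow_succ] at this

include hr hℓ in
lemma abs_genIter_le {f : Config → ℝ} {C w : ℝ} (hw : 1 ≤ w) (hC : 0 ≤ C)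
    (h : ∀ X, |f X| ≤ C * w ^ size N X.1) (k : ℕ) (X : Config) :
    |genIter r ℓ N k f X| ≤ C * genBound r ℓ N w ^ k * w ^ size N X.1 := by
  have := sum_abs_genIter_le hr hℓ (ι := Unit) (s := {()}) (f := fun _ => f) (N := N) hw hC
    (by simpa using h) k X
  simpa using this

end

lemma hasDerivWithinAt_gen {r ℓ : ℝ} {N : ℕ} {v : ℝ → Config → ℝ} {v' : Config → ℝ} {s : Set ℝ}
    {t : ℝ} (h : ∀ X, HasDerivWithinAt (fun u => v u X) (v' X) s t) (X : Config) :
    HasDerivWithinAt (fun u => gen r ℓ N (v u) X) (gen r ℓ N v' X) s t :=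
  ((HasDerivWithinAt.fun_sum fun _ _ => (h _).sub (h X)).const_mul r).add
    ((HasDerivWithinAt.fun_sum fun _ _ => (h _).sub (h X)).const_mul ℓ)

lemma hasDerivAt_pow_div_factorial (j : ℕ) (t : ℝ) :
    HasDerivAt (fun s : ℝ => s ^ (j + 1) / (j + 1).factorial) (t ^ j / j.factorial) t := by
  refine ((hasDerivAt_pow (j + 1) t).div_const _).congr_deriv ?_
  rw [Nat.factorial_succ]
  have h1 : ((j : ℝ) + 1) ≠ 0 := by positivity
  have h2 : (j.factorial : ℝ) ≠ 0 := by positivity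
  push_cast
  field_simp

/-- Taylor's formula for a tower of derivatives with geometric bounds. -/
lemma abs_sub_taylor_le {g : ℕ → ℝ → ℝ} {T C L : ℝ}
    (hd : ∀ k, ∀ t ∈ Icc 0 T, HasDerivWithinAt (g k) (g (k + 1) t) (Ici 0) t)
    (hb : ∀ k, ∀ t ∈ Icc 0 T, |g k t| ≤ C * L ^ k) (J : ℕ) : ∀ k, ∀ t ∈ Icc 0 T,
    |g k t - ∑ j ∈ Finset.range J, t ^ j / j.factorial * g (k + j) 0| ≤
      C * L ^ (k + J) * (t ^ J / J.factorial) := by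
  induction J with
  | zero => intro k t ht; simpa using hb k t ht
  | succ J ih =>
    intro k
    have hder : ∀ x, HasDerivAt (fun t : ℝ => ∑ j ∈ Finset.range (J + 1),
        t ^ j / j.factorial * g (k + j) 0)
        (∑ j ∈ Finset.range J, x ^ j / j.factorial * g (k + 1 + j) 0) x := fun x => by
      simp only [Finset.sum_range_succ' _ J]
      have h1 : HasDerivAt (fun t : ℝ => ∑ j ∈ Finset.range J,
          t ^ (j + 1) / (j + 1).factorial * g (k + (j + 1)) 0)
          (∑ j ∈ Finset.range J, x ^ j / j.factorial * g (k + (j + 1)) 0) x :=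
        HasDerivAt.fun_sum fun j _ => (hasDerivAt_pow_div_factorial j x).mul_const _
      have e : ∀ j, g (k + (j + 1)) 0 = g (k + 1 + j) 0 := fun j => by rw [add_right_comm, add_assoc]
      simpa [e] using h1.add_const (g (k + 0) 0)
    refine image_norm_le_of_norm_deriv_right_le_deriv_boundary
      (f' := fun t => g (k + 1) t - ∑ j ∈ Finset.range J, t ^ j / j.factorial * g (k + 1 + j) 0)
      (B' := fun t => C * L ^ (k + (J + 1)) * (t ^ J / J.factorial)) ?_ ?_ ?_ ?_ ?_
    · intro x hx
      have h1 := ((hd k x hx).mono fun y (hy : y ∈ Icc 0 T) => hy.1).continuousWithinAt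
      exact h1.sub (hder x).continuousAt.continuousWithinAt
    · intro x hx
      exact ((hd k x (Ico_subset_Icc_self hx)).mono (Ici_subset_Ici.2 hx.1)).sub
        (hder x).hasDerivWithinAt
    · simp [Finset.sum_range_succ']
    · intro x
      exact (hasDerivAt_pow_div_factorial J x).const_mul _
    · intro x hx
      have := ih (k + 1) x (Ico_subset_Icc_self hx)
      rwa [show k + 1 + J = k + (J + 1) by omega] at this

lemma hasSum_taylor {g : ℕ → ℝ → ℝ} {T C L : ℝ}
    (hd : ∀ k, ∀ t ∈ Icc 0 T, HasDerivWithinAt (g k) (g (k + 1) t) (Ici 0) t)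
    (hb : ∀ k, ∀ t ∈ Icc 0 T, |g k t| ≤ C * L ^ k) {t : ℝ} (ht : t ∈ Icc 0 T) :
    HasSum (fun j : ℕ => t ^ j / j.factorial * g j 0) (g 0 t) := by
  have h0 : (0 : ℝ) ∈ Icc 0 T := ⟨le_rfl, ht.1.trans ht.2⟩
  have hs : Summable fun j : ℕ => t ^ j / j.factorial * g j 0 := by
    refine Summable.of_norm_bounded ((Real.summable_pow_div_factorial (t * L)).mul_left C)
      fun j => ?_
    rw [norm_mul, Real.norm_of_nonneg (div_nonneg (pow_nonneg ht.1 j) (by positivity)),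
      Real.norm_eq_abs]
    refine (mul_le_mul_of_nonneg_left (hb j 0 h0)
      (div_nonneg (pow_nonneg ht.1 j) (by positivity))).trans (le_of_eq ?_)
    rw [mul_pow]
    ring
  refine (hs.hasSum_iff_tendsto_nat).2 ?_
  rw [tendsto_iff_norm_sub_tendsto_zero]
  have hz : Tendsto (fun J : ℕ => C * ((t * L) ^ J / J.factorial)) atTop (𝓝 0) := by
    simpa using (Real.summable_pow_div_factorial (t * L)).tendsto_atTop_zero.const_mul C
  refine squeeze_zero (fun _ => norm_nonneg _) (fun J => ?_) hz
  have := abs_sub_taylor_le hd hb J 0 t ht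
  rw [norm_sub_rev, Real.norm_eq_abs]
  simp only [zero_add] at this
  refine this.trans (le_of_eq ?_)
  rw [mul_pow]
  ring

/-- A solution of the backward equation with at most exponential growth is given by the
exponential series of the generator applied to the initial condition. -/
lemma hasSum_genIter {r ℓ : ℝ} (hr : 0 ≤ r) (hℓ : 0 ≤ ℓ) {N : ℕ} {u : ℝ → Config → ℝ}
    {T C w : ℝ} (hw : 1 ≤ w) (hC : 0 ≤ C)
    (hd : ∀ t, 0 ≤ t → t ≤ T → ∀ X, HasDerivWithinAt (fun s => u s X) (gen r ℓ N (u t) X) (Ici 0) t)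
    (hb : ∀ t ∈ Icc 0 T, ∀ X, |u t X| ≤ C * w ^ size N X.1) {t : ℝ} (ht : t ∈ Icc 0 T)
    (X : Config) :
    HasSum (fun k : ℕ => t ^ k / k.factorial * genIter r ℓ N k (u 0) X) (u t X) := by
  have hder : ∀ k, ∀ t ∈ Icc 0 T, ∀ X, HasDerivWithinAt (fun s => genIter r ℓ N k (u s) X)
      (genIter r ℓ N (k + 1) (u t) X) (Ici 0) t := by
    intro k
    induction k with
    | zero => intro t ht X; exact hd t ht.1 ht.2 X
    | succ k ih =>
      intro t ht X
      simp only [genIter_succ _ _ _ (k + 1), genIter_succ _ _ _ k]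
      simp only [genIter_succ _ _ _ k] at ih
      exact hasDerivWithinAt_gen (ih t ht) X
  exact hasSum_taylor (g := fun k s => genIter r ℓ N k (u s) X) (C := C * w ^ size N X.1)
    (L := genBound r ℓ N w) (fun k t ht => hder k t ht X) (fun k t ht => by
      refine (abs_genIter_le hr hℓ hw hC (hb t ht) k X).trans (le_of_eq ?_)
      ring) ht

/-- The exponential of `t` times the generator, applied to `f`. -/
def semigroup (r ℓ : ℝ) (N : ℕ) (t : ℝ) (f : Config → ℝ) (X : Config) : ℝ :=
  ∑' k : ℕ, t ^ k / k.factorial * genIter r ℓ N k f X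

lemma summable_exp_series {c : ℕ → ℝ} {C L : ℝ} (hc : ∀ k, |c k| ≤ C * L ^ k) (t : ℝ) :
    Summable fun k : ℕ => t ^ k / k.factorial * c k := by
  refine Summable.of_norm_bounded ((Real.summable_pow_div_factorial (|t| * L)).mul_left C)
    fun k => ?_
  rw [norm_mul, norm_div, norm_pow, Real.norm_natCast, Real.norm_eq_abs, Real.norm_eq_abs]
  refine (mul_le_mul_of_nonneg_left (hc k) (by positivity)).trans (le_of_eq ?_)
  rw [mul_pow]
  ring

lemma hasDerivAt_exp_series {c : ℕ → ℝ} {C L : ℝ} (hc : ∀ k, |c k| ≤ C * L ^ k) (t : ℝ) :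
    HasDerivAt (fun s => ∑' k : ℕ, s ^ k / k.factorial * c k)
      (∑' k : ℕ, t ^ k / k.factorial * c (k + 1)) t := by
  set T := |t| + 1 with hT
  let g' : ℕ → ℝ → ℝ := fun k s => Nat.casesOn k 0 fun k => s ^ k / k.factorial * c (k + 1)
  let u : ℕ → ℝ := fun k => Nat.casesOn k 0 fun k => C * L * ((T * L) ^ k / k.factorial)
  have hu : Summable u := (summable_nat_add_iff 1).1
    ((Real.summable_pow_div_factorial (T * L)).mul_left (C * L))
  have ht : t ∈ Ioo (-T) T := abs_lt.1 (by rw [hT]; linarith)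
  have h1 : ∀ k s, s ∈ Ioo (-T) T → ‖g' k s‖ ≤ u k := fun k s hs => by
    cases k with
    | zero => exact norm_zero.le
    | succ k =>
      have hs' : |s| ≤ T := (abs_lt.2 hs).le
      have hk := (abs_nonneg _).trans (hc (k + 1))
      change ‖s ^ k / k.factorial * c (k + 1)‖ ≤ C * L * ((T * L) ^ k / k.factorial)
      rw [norm_mul, norm_div, norm_pow, Real.norm_natCast, Real.norm_eq_abs, Real.norm_eq_abs]
      calc |s| ^ k / k.factorial * |c (k + 1)| ≤ T ^ k / k.factorial * (C * L ^ (k + 1)) := by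
            gcongr
            exact hc (k + 1)
        _ = _ := by rw [mul_pow, pow_succ]; ring
  have key := hasDerivAt_tsum_of_isPreconnected hu (t := Ioo (-T) T) isOpen_Ioo isPreconnected_Ioo
    (g := fun k s => s ^ k / k.factorial * c k) (g' := g') (fun k s _ => by
      cases k with
      | zero => simpa [g'] using hasDerivAt_const s (c 0)
      | succ k => exact (hasDerivAt_pow_div_factorial k s).mul_const _)
    h1 ht (summable_exp_series hc t) ht
  refine key.congr_deriv ?_
  rw [(Summable.of_norm_bounded hu fun k => h1 k t ht).tsum_eq_zero_add]
  exact zero_add _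

lemma gen_tsum {r ℓ : ℝ} {N : ℕ} {ι : Type*} {f : ι → Config → ℝ}
    (h : ∀ X, Summable fun i => f i X) (X : Config) :
    gen r ℓ N (fun Y => ∑' i, f i Y) X = ∑' i, gen r ℓ N (f i) X := by
  have h1 : ∀ R : ℕ → Config, ∑ k ∈ Finset.range N, (∑' i, f i (R k) - ∑' i, f i X) =
      ∑' i, ∑ k ∈ Finset.range N, (f i (R k) - f i X) := fun R => by
    rw [Summable.tsum_finsetSum fun k _ => (h _).sub (h X)]
    exact Finset.sum_congr rfl fun k _ => ((h _).tsum_sub (h X)).symm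
  have h2 : ∀ R : ℕ → Config, Summable fun i => ∑ k ∈ Finset.range N, (f i (R k) - f i X) :=
    fun R => summable_sum fun k _ => (h _).sub (h X)
  simp only [gen]
  rw [h1, h1, ← tsum_mul_left, ← tsum_mul_left,
    ((h2 _).mul_left r).tsum_add ((h2 _).mul_left ℓ)]

lemma dependsOnFirst_genIter {r ℓ : ℝ} {N : ℕ} {f : Config → ℝ} (hf : DependsOnFirst N f)
    (k : ℕ) : DependsOnFirst N (genIter r ℓ N k f) := by
  induction k with
  | zero => exact hf
  | succ k ih => rw [genIter_succ]; exact dependsOnFirst_gen r ℓ ih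

section

variable {r ℓ : ℝ} (hr : 0 ≤ r) (hℓ : 0 ≤ ℓ) {N : ℕ} {f : Config → ℝ} {C : ℝ} (hC : 0 ≤ C)
  (hf : ∀ X, |f X| ≤ C)

include hr hℓ hC hf

lemma abs_genIter_le_of_bounded (k : ℕ) (X : Config) :
    |genIter r ℓ N k f X| ≤ C * genBound r ℓ N 1 ^ k := by
  have := abs_genIter_le hr hℓ (N := N) le_rfl hC (by simpa using hf) k X
  simpa using this

lemma gen_semigroup (t : ℝ) (X : Config) : gen r ℓ N (semigroup r ℓ N t f) X =
    ∑' k : ℕ, t ^ k / k.factorial * genIter r ℓ N (k + 1) f X := by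
  have h := gen_tsum (r := r) (ℓ := ℓ) (N := N)
    (f := fun (k : ℕ) X => t ^ k / k.factorial * genIter r ℓ N k f X)
    (fun X => summable_exp_series
      (fun k => abs_genIter_le_of_bounded hr hℓ hC hf k X) t) X
  refine h.trans (tsum_congr fun k => ?_)
  rw [genIter_succ]
  simp only [gen, ← mul_sub, ← Finset.mul_sum]
  ring

lemma semigroup_hasDerivAt (t : ℝ) (X : Config) :
    HasDerivAt (fun s => semigroup r ℓ N s f X) (gen r ℓ N (semigroup r ℓ N t f) X) t := by
  rw [gen_semigroup hr hℓ hC hf]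
  exact hasDerivAt_exp_series (fun k => abs_genIter_le_of_bounded hr hℓ hC hf k X) t

lemma abs_semigroup_le {t T : ℝ} (ht : |t| ≤ T) (X : Config) :
    |semigroup r ℓ N t f X| ≤ C * Real.exp (T * genBound r ℓ N 1) := by
  have h0 := genBound_nonneg hr hℓ (N := N) le_rfl
  have hs : HasSum (fun k : ℕ => C * ((T * genBound r ℓ N 1) ^ k / k.factorial))
      (C * Real.exp (T * genBound r ℓ N 1)) := by
    have := NormedSpace.expSeries_div_hasSum_exp (T * genBound r ℓ N 1)
    rw [← Real.exp_eq_exp_ℝ] at this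
    exact this.mul_left C
  rw [← Real.norm_eq_abs, semigroup]
  refine tsum_of_norm_bounded hs fun k => ?_
  rw [norm_mul, norm_div, norm_pow, Real.norm_natCast, Real.norm_eq_abs, Real.norm_eq_abs]
  calc |t| ^ k / k.factorial * |genIter r ℓ N k f X|
      ≤ T ^ k / k.factorial * (C * genBound r ℓ N 1 ^ k) := by
        have hT := (abs_nonneg t).trans ht
        gcongr
        exact abs_genIter_le_of_bounded hr hℓ hC hf k X
    _ = _ := by rw [mul_pow]; ring

end

/-- Summation over an absolutely summable family of initial conditions commutes with the
exponential series of the generator. -/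
lemma tsum_eq_semigroup {r ℓ : ℝ} (hr : 0 ≤ r) (hℓ : 0 ≤ ℓ) {N : ℕ} {ι : Type*}
    {f : ι → Config → ℝ} {C w : ℝ} (hw : 1 ≤ w) (hC : 0 ≤ C)
    (hf : ∀ (s : Finset ι) (X : Config), ∑ i ∈ s, |f i X| ≤ C * w ^ size N X.1)
    {t : ℝ} {X : Config} {u : ι → ℝ}
    (hu : ∀ i, HasSum (fun k : ℕ => t ^ k / k.factorial * genIter r ℓ N k (f i) X) (u i)) :
    Summable u ∧ ∑' i, u i = semigroup r ℓ N t (fun Y => ∑' i, f i Y) X := by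
  set L := genBound r ℓ N w
  have hb : ∀ k (s : Finset ι) X, ∑ i ∈ s, |genIter r ℓ N k (f i) X| ≤ C * L ^ k * w ^ size N X.1 :=
    fun k s X => sum_abs_genIter_le hr hℓ hw hC (hf s) k X
  have hsa : ∀ k X, Summable fun i => |genIter r ℓ N k (f i) X| := fun k X =>
    summable_of_sum_le (fun _ => abs_nonneg _) fun s => hb k s X
  have hs : ∀ k X, Summable fun i => genIter r ℓ N k (f i) X := fun k X => (hsa k X).of_abs
  have hiter : ∀ k, genIter r ℓ N k (fun Y => ∑' i, f i Y) =
      fun Y => ∑' i, genIter r ℓ N k (f i) Y := fun k => by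
    induction k with
    | zero => rfl
    | succ k ih =>
      funext Y
      rw [genIter_succ, ih, gen_tsum (hs k)]
      simp only [genIter_succ]
  have hprod : Summable fun q : ℕ × ι => |t ^ q.1 / q.1.factorial * genIter r ℓ N q.1 (f q.2) X| := by
    rw [summable_prod_of_nonneg fun q => abs_nonneg _]
    constructor
    · intro k
      simp only [abs_mul]
      exact (hsa k X).mul_left _
    · simp only [abs_mul, tsum_mul_left]
      refine Summable.of_nonneg_of_le
        (fun k => mul_nonneg (abs_nonneg _) (tsum_nonneg fun _ => abs_nonneg _)) (fun k => ?_)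
        ((Real.summable_pow_div_factorial (|t| * L)).mul_left (C * w ^ size N X.1))
      have h1 : ∑' i, |genIter r ℓ N k (f i) X| ≤ C * L ^ k * w ^ size N X.1 :=
        (hsa k X).tsum_le_of_sum_le fun s => hb k s X
      rw [abs_div, abs_pow, Nat.abs_cast]
      refine (mul_le_mul_of_nonneg_left h1 (by positivity)).trans (le_of_eq ?_)
      rw [mul_pow]
      ring
  have hprod' := hprod.of_abs
  have hswap : Summable fun q : ι × ℕ => t ^ q.2 / q.2.factorial * genIter r ℓ N q.2 (f q.1) X :=
    hprod'.prod_symm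
  have e : u = fun i => ∑' k : ℕ, t ^ k / k.factorial * genIter r ℓ N k (f i) X :=
    funext fun i => (hu i).tsum_eq.symm
  constructor
  · rw [e]
    exact hswap.prod
  · rw [e, semigroup]
    simp only [hiter, ← tsum_mul_left]
    exact (Summable.tsum_comm (f := fun (k : ℕ) i => t ^ k / k.factorial *
      genIter r ℓ N k (f i) X) hprod')

/-! ### The kernel at time zero -/

/-- The operator `Q⁻¹` on functions. -/
def qinv (f : ℤ → ℝ) (x : ℤ) : ℝ := 2 * f (x + 1) - f x

lemma qinv_iterate_congr (d : ℕ) : ∀ {f g : ℤ → ℝ} {x : ℤ},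
    (∀ y, x ≤ y → y ≤ x + d → f y = g y) → qinv^[d] f x = qinv^[d] g x := by
  induction d with
  | zero => intro f g x h; exact h x le_rfl (by simp)
  | succ d ih =>
    intro f g x h
    rw [Function.iterate_succ_apply, Function.iterate_succ_apply]
    refine ih fun y h1 h2 => ?_
    rw [qinv, qinv, h y h1 (by push_cast; omega), h (y + 1) (by omega) (by push_cast; omega)]

lemma qinv_iterate_zero (d : ℕ) (x : ℤ) : qinv^[d] (fun _ => 0) x = 0 := by
  induction d with
  | zero => rfl
  | succ d ih =>
    have e : qinv (fun _ => 0) = fun _ => 0 := by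
      funext y
      simp [qinv]
    rw [Function.iterate_succ_apply, e, ih]

lemma qinv_iterate_eq_zero {d : ℕ} {f : ℤ → ℝ} {x : ℤ} (h : ∀ y, x ≤ y → y ≤ x + d → f y = 0) :
    qinv^[d] f x = 0 :=
  (qinv_iterate_congr d h).trans (qinv_iterate_zero d x)

lemma qinv_avg {g : ℤ → ℝ} (h : VanishBelow g) : qinv (avg g) = g :=
  funext fun y => two_mul_avg_sub_avg h y

lemma IsHarmonic.qinv_iterate {s : ℕ → ℤ → ℝ} (hs : IsHarmonic s) (n : ℕ) : ∀ {d : ℕ}, n < d →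
    ∀ x, qinv^[d] (s (n + 1)) x = 0 := by
  induction n with
  | zero =>
    intro d hd x
    obtain ⟨d, rfl⟩ := Nat.exists_eq_succ_of_ne_zero (by omega : d ≠ 0)
    rw [Nat.succ_eq_add_one, Function.iterate_succ_apply]
    exact qinv_iterate_eq_zero fun y _ _ => hs.one y
  | succ n ih =>
    intro d hd x
    obtain ⟨d, rfl⟩ := Nat.exists_eq_succ_of_ne_zero (by omega : d ≠ 0)
    rw [Nat.succ_eq_add_one, Function.iterate_succ_apply,
      show qinv (s (n + 1 + 1)) = s (n + 1) from funext fun y => hs.succ n y]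
    exact ih (by omega) x

/-- The rows that are so low that the walk cannot reach the epigraph vanish. -/
lemma qinv_hit_low (s : ℕ → ℤ → ℝ) {n d : ℕ} {X : ℕ → ℤ} {x : ℤ}
    (h : ∀ k < n, x + d ≤ X k + k) : qinv^[d] (hit s n X) x = 0 :=
  qinv_iterate_eq_zero fun _ _ hy => hit_eq_zero s n X _ fun k hk => hy.trans (h k hk)

/-- The row at `x` vanishes if no particle lies in `[x, x + d)`: on `[x, x + d]` the hitting
functional is then either `s`, which is annihilated, or an average, which absorbs one factor
`Q⁻¹`. -/
lemma IsHarmonic.qinv_hit {s : ℕ → ℤ → ℝ} (hs : IsHarmonic s) (n : ℕ) :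
    ∀ {d : ℕ} {X : ℕ → ℤ} {x : ℤ}, n ≤ d → (∀ k < n, X k < x ∨ x + d ≤ X k) →
      qinv^[d] (hit s n X) x = 0 := by
  induction n with
  | zero => intro d X x _ _; exact qinv_iterate_zero d x
  | succ n ih =>
    intro d X x hd h
    rcases h 0 (Nat.succ_pos n) with h0 | h0
    · rw [← hs.qinv_iterate n (Nat.lt_of_succ_le hd) x]
      exact qinv_iterate_congr d fun y hy _ => hit_succ_of_lt s n (by omega)
    · rw [qinv_iterate_congr d (g := avg (hit s n fun k => X (k + 1)))
        fun y _ hy => hit_succ_of_le s n (by omega)]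
      obtain ⟨d, rfl⟩ := Nat.exists_eq_succ_of_ne_zero (by omega : d ≠ 0)
      rw [Nat.succ_eq_add_one, Function.iterate_succ_apply, qinv_avg (vanishBelow_hit s n _)]
      refine ih (by omega) fun k hk => ?_
      have := h (k + 1) (by omega)
      push_cast at this
      omega

lemma expKernel_zero (r ℓ : ℝ) (x y : ℤ) : expKernel r ℓ 0 x y = if x = y then 1 else 0 := by
  have h1 : ∀ x y, expNablaMinus 0 x y = if x = y then 1 else 0 := fun x y => by
    rcases lt_trichotomy x y with h | rfl | h
    · rw [expNablaMinus, if_neg (by omega), if_neg (by omega)]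
    · simp [expNablaMinus]
    · have : (x - y).toNat ≠ 0 := by omega
      rw [expNablaMinus, if_pos h.le, if_neg (by omega), zero_pow this]
      simp
  have h2 : ∀ x y, expNablaPlus 0 x y = if x = y then 1 else 0 := fun x y => by
    rcases lt_trichotomy x y with h | rfl | h
    · have : (y - x).toNat ≠ 0 := by omega
      rw [expNablaPlus, if_pos h.le, if_neg (by omega), zero_pow this]
      simp
    · simp [expNablaPlus]
    · rw [expNablaPlus, if_neg (by omega), if_neg (by omega)]
  have e : expNablaPlus 0 = fun x y => if x = y then 1 else 0 := by
    funext x y; exact h2 x y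
  rw [expKernel, mul_zero, zero_div, mul_zero, e, comp_id_right, h1]

lemma S_time_zero (r ℓ : ℝ) (d : ℕ) (y x : ℤ) : S r ℓ 0 d y x = kpow Qinv d x y := by
  rw [S, comp, tsum_eq_single x]
  · simp [expKernel_zero]
  · intro z hz
    simp [expKernel_zero, hz.symm]

lemma Sbar_time_zero (r ℓ : ℝ) (n : ℕ) (b z : ℤ) : Sbar r ℓ 0 n b z = Qbar n b z := by
  have e : expKernel r ℓ (-0) = fun x y => if x = y then 1 else 0 := by
    funext x y; rw [neg_zero, expKernel_zero]
  rw [Sbar, e, comp_id_right]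

lemma prodKernel_time_zero (r ℓ : ℝ) (d m : ℕ) (X : ℕ → ℤ) (x z : ℤ) :
    prodKernel r ℓ 0 d m X x z = qinv^[d] (hit (Sb r ℓ 0 z) m X) x := by
  rw [prodKernel]
  generalize hit (Sb r ℓ 0 z) m X = f
  have hs : ∀ d (g : ℤ → ℝ), Summable fun y => S r ℓ 0 d y x * g y := fun d g =>
    summable_of_ne_finset_zero (s := Finset.Icc x (x + d)) fun y hy => by
      rw [S_time_zero, kpow_Qinv_eq_zero, zero_mul]
      simp only [Finset.mem_Icc] at hy ⊢
      omega
  induction d generalizing f with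
  | zero =>
    rw [tsum_eq_single x]
    · simp [S_time_zero, kpow]
    · intro y hy
      simp [S_time_zero, kpow, hy.symm]
  | succ d ih =>
    have hsh : ∀ g : ℤ → ℝ, ∀ y, S r ℓ 0 d y x * g (y + 1) =
        (fun y => S r ℓ 0 d (y - 1) x * g y) (Equiv.addRight 1 y) := fun g y => by simp
    have hs1 : Summable fun y => S r ℓ 0 d (y - 1) x * f y := by
      rw [← (Equiv.addRight (1 : ℤ)).summable_iff]
      exact (hs d fun y => f (y + 1)).congr fun y => hsh f y
    rw [Function.iterate_succ_apply, ← ih]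
    have h1 : ∑' y, S r ℓ 0 d y x * f (y + 1) = ∑' y, S r ℓ 0 d (y - 1) x * f y := by
      rw [← (Equiv.addRight (1 : ℤ)).tsum_eq fun y => S r ℓ 0 d (y - 1) x * f y]
      exact tsum_congr fun y => hsh f y
    have h2 : ∀ y, S r ℓ 0 d y x * qinv f y =
        2 * (S r ℓ 0 d y x * f (y + 1)) - S r ℓ 0 d y x * f y := fun y => by rw [qinv]; ring
    have h3 : ∀ y, S r ℓ 0 (d + 1) y x * f y =
        2 * (S r ℓ 0 d (y - 1) x * f y) - S r ℓ 0 d y x * f y := fun y => by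
      rw [S_succ_index]; ring
    simp only [h2, h3]
    rw [(hs1.mul_left 2).tsum_sub (hs d f), ((hs d fun y => f (y + 1)).mul_left 2).tsum_sub (hs d f),
      tsum_mul_left, tsum_mul_left, h1]

/-! ### Powers of the transition kernel -/

lemma kpow_Q_eq_zero (n : ℕ) : ∀ {x z : ℤ}, x < z + n → kpow Q n x z = 0 := by
  induction n with
  | zero =>
    intro x z h
    have : x ≠ z := by rintro rfl; simp at h
    simp [kpow, this]
  | succ n ih =>
    intro x z h
    rw [kpow, comp, ← tsum_zero]
    refine tsum_congr fun w => ?_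
    rcases lt_or_ge z w with hw | hw
    · rw [ih (by push_cast at h; omega), zero_mul]
    · rw [Q, if_neg (by omega), mul_zero]

lemma avg_eq_comp (f : ℤ → ℝ) (x : ℤ) : avg f x = ∑' w, Q x w * f w := by
  have hinj : Function.Injective fun i : ℕ => x - ((i : ℤ) + 1) := fun i j h => by
    simp only at h; omega
  rw [avg, ← hinj.tsum_eq]
  · refine tsum_congr fun i => ?_
    rw [Q, if_pos (by omega)]
    congr 1
    rw [show x - ((i : ℤ) + 1) - x = -((i + 1 : ℕ) : ℤ) by push_cast; ring, zpow_neg, zpow_natCast,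
      one_div, inv_pow]
  · intro w hw
    have : w < x := by
      by_contra h
      exact hw (by simp [Q, h])
    exact ⟨(x - w - 1).toNat, by simp only; omega⟩

/-- The power of `Q` with the additional factor on the left instead of the right. -/
lemma kpow_Q_succ (n : ℕ) : ∀ z x : ℤ, kpow Q (n + 1) x z = avg (fun b => kpow Q n b z) x := by
  induction n with
  | zero =>
    intro z x
    change ∑' w, kpow Q 0 x w * Q w z = _
    rw [avg_eq_comp, tsum_eq_single x, tsum_eq_single z]
    · simp [kpow]
    · intro w hw; simp [kpow, hw]
    · intro w hw; simp [kpow, hw.symm]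
  | succ n ih =>
    intro z x
    have hv : ∀ (n : ℕ) (w : ℤ), VanishBelow fun b => kpow Q n b w := fun n w =>
      ⟨w - 1, fun y hy => kpow_Q_eq_zero n (by omega)⟩
    have hf : ∀ n, ∀ b ≤ x, kpow Q (n + 1) b z =
        ∑ w ∈ Finset.Ioc z x, Q w z * kpow Q n b w := fun n b hb => by
      rw [kpow, comp, tsum_eq_sum (s := Finset.Ioc z x)]
      · exact Finset.sum_congr rfl fun w _ => mul_comm _ _
      · intro w hw
        rw [Finset.mem_Ioc, not_and_or] at hw
        rcases hw with hw | hw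
        · rw [Q, if_neg (by omega), mul_zero]
        · rw [kpow_Q_eq_zero n (by omega), zero_mul]
    rw [hf (n + 1) x le_rfl, avg_congr fun b hb => hf n b hb.le,
      avg_finset_sum _ fun w => (hv n w).const_mul _]
    refine Finset.sum_congr rfl fun w _ => ?_
    rw [avg_const_mul, ← ih]

lemma vanishBelow_kpow_Q (n : ℕ) (z : ℤ) : VanishBelow fun b => kpow Q n b z :=
  ⟨z - 1, fun y hy => kpow_Q_eq_zero n (by omega)⟩

lemma qinv_kpow_Q (n : ℕ) (z : ℤ) :
    qinv (fun b => kpow Q (n + 1) b z) = fun b => kpow Q n b z := by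
  rw [show (fun b => kpow Q (n + 1) b z) = avg fun b => kpow Q n b z from
    funext fun b => kpow_Q_succ n z b]
  exact qinv_avg (vanishBelow_kpow_Q n z)

lemma qinv_iterate_kpow_Q (z : ℤ) (d : ℕ) : ∀ n x, qinv^[d] (fun b => kpow Q (n + d) b z) x =
    kpow Q n x z := by
  induction d with
  | zero => intro n x; rfl
  | succ d ih =>
    intro n x
    rw [Function.iterate_succ_apply, ← add_assoc, qinv_kpow_Q, ih]

lemma abs_kpow_Q_le (n : ℕ) : ∀ x z : ℤ, |kpow Q n x z| ≤ 1 := by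
  induction n with
  | zero => intro x z; by_cases h : x = z <;> simp [kpow, h]
  | succ n ih =>
    intro x z
    rw [kpow_Q_succ]
    exact abs_avg_le fun b _ => ih b z

/-- `Q̄⁽ⁿ⁾` extends `Qⁿ`. -/
lemma Sb_time_zero_eq_kpow (r ℓ : ℝ) (n : ℕ) (z : ℤ) :
    ∀ b, z < b → Sb r ℓ 0 z (n + 1) b = kpow Q (n + 1) b z := by
  have hs := isHarmonic_Sb r ℓ 0 z
  have h1 : ∀ n, Sb r ℓ 0 z (n + 1) (z + 1) = kpow Q (n + 1) (z + 1) z := fun n => by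
    rw [Sb, Sbar_time_zero, kpow_Q_succ, Qbar]
    cases n with
    | zero =>
      rw [avg, tsum_eq_single 0]
      · simp [kpow]
      · intro i hi
        rw [kpow_Q_eq_zero 0 (by omega), mul_zero]
    | succ n =>
      rw [avg_eq_zero fun b hb => kpow_Q_eq_zero (n + 1) (by omega)]
      rw [Finset.prod_eq_zero (i := 0) (by simp) (by push_cast; ring)]
      simp
  have step : ∀ n, (∀ b, z < b → 2 * Sb r ℓ 0 z (n + 1) (b + 1) - Sb r ℓ 0 z (n + 1) b =
      kpow Q n b z) → ∀ i : ℕ, Sb r ℓ 0 z (n + 1) (z + 1 + i) =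
        kpow Q (n + 1) (z + 1 + i) z := fun n h i => by
    induction i with
    | zero => simpa using h1 n
    | succ i ih =>
      have e1 := h (z + 1 + i) (by omega)
      have e2 := congrFun (qinv_kpow_Q n z) (z + 1 + i)
      rw [qinv] at e2
      push_cast
      rw [← add_assoc]
      linarith
  have key : ∀ n, (∀ b, z < b → 2 * Sb r ℓ 0 z (n + 1) (b + 1) - Sb r ℓ 0 z (n + 1) b =
      kpow Q n b z) → ∀ b, z < b → Sb r ℓ 0 z (n + 1) b = kpow Q (n + 1) b z := fun n h b hb => by
    have := step n h (b - z - 1).toNat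
    rwa [show z + 1 + ((b - z - 1).toNat : ℤ) = b by omega] at this
  induction n with
  | zero =>
    refine key 0 fun b hb => ?_
    simp [hs.one, kpow, hb.ne']
  | succ n ih => exact key (n + 1) fun b hb => by rw [hs.succ, ih b hb]

/-- With respect to the position of the last of the particles that it sees, the hitting
expectation at time zero is a power of `Q`: the walk has to enter the epigraph in order to reach
that position. -/
lemma hit_time_zero_last (r ℓ : ℝ) (n : ℕ) : ∀ {X : ℕ → ℤ}, StrictAnti X → ∀ b,
    hit (Sb r ℓ 0 (X n)) (n + 1) X b = kpow Q (n + 1) b (X n) := by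
  induction n with
  | zero =>
    intro X _ b
    rcases lt_or_ge (X 0) b with h | h
    · rw [hit_succ_of_lt _ _ h, Sb_time_zero_eq_kpow r ℓ 0 _ b h]
    · rw [hit_succ_of_le _ _ h, kpow_Q_eq_zero _ (by push_cast; omega)]
      exact avg_eq_zero fun _ _ => rfl
  | succ n ih =>
    intro X hX b
    rcases lt_or_ge (X 0) b with h | h
    · have := hX (Nat.succ_pos n)
      rw [hit_succ_of_lt _ _ h, Sb_time_zero_eq_kpow r ℓ (n + 1) _ b (this.trans h)]
    · rw [hit_succ_of_le _ _ h, kpow_Q_succ]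
      congr 1
      funext y
      exact ih (X := fun k => X (k + 1)) (fun i j h => hX (by omega)) y

/-! ### The Fredholm series at time zero -/

section Combinatorics

variable {ι : Type*} [DecidableEq ι]

/-- A nonvanishing determinant has a nonvanishing term in its Leibniz expansion. -/
lemma exists_perm_of_fredholmTerm_ne_zero {K : ι → ι → ℝ} {A : Finset ι}
    (h : fredholmTerm K A ≠ 0) : ∃ σ : Equiv.Perm A, ∀ p, K (σ p) p ≠ 0 := by
  have h1 := right_ne_zero_of_mul h
  rw [Matrix.det_apply] at h1
  obtain ⟨σ, -, hσ⟩ := Finset.exists_ne_zero_of_sum_ne_zero h1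
  refine ⟨σ, fun p hp => hσ ?_⟩
  rw [Finset.prod_eq_zero (Finset.mem_univ p) (by simpa using hp), smul_zero]

lemma fredholmTerm_empty (K : ι → ι → ℝ) : fredholmTerm K ∅ = 1 := by
  simp [fredholmTerm]

/-- The Fredholm series of a kernel that raises levels is trivial. -/
lemma fredholmDet_eq_one {K : ι → ι → ℝ} (lev : ι → ℕ) (h : ∀ p q, K p q ≠ 0 → lev p < lev q) :
    fredholmDet K = 1 := by
  rw [fredholmDet, tsum_eq_single ∅, fredholmTerm_empty]
  intro A hA
  by_contra hne
  obtain ⟨σ, hσ⟩ := exists_perm_of_fredholmTerm_ne_zero hne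
  obtain ⟨p₀, hp₀⟩ := Finset.nonempty_iff_ne_empty.2 hA
  have h1 : ∑ p : A, lev (σ p) < ∑ p : A, lev p :=
    Finset.sum_lt_sum_of_nonempty ⟨⟨p₀, hp₀⟩, Finset.mem_univ _⟩ fun p _ => h _ _ (hσ p)
  rw [Equiv.sum_comp σ fun p : A => lev p] at h1
  exact h1.false

lemma fredholmTerm_insert {K : ι → ι → ℝ} {p₀ : ι} (h : ∀ p, K p p₀ = if p = p₀ then 1 else 0)
    {A : Finset ι} (hA : p₀ ∉ A) : fredholmTerm K (insert p₀ A) = -fredholmTerm K A := by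
  have key : (Matrix.of fun x y : (insert p₀ A : Finset ι) => K x y).det =
      (Matrix.of fun x y : A => K x y).det := by
    rw [Matrix.twoBlockTriangular_det _ fun i : (insert p₀ A : Finset ι) => (i : ι) = p₀]
    · have e1 : (Matrix.toSquareBlockProp (Matrix.of fun x y : (insert p₀ A : Finset ι) => K x y)
          fun i : (insert p₀ A : Finset ι) => (i : ι) = p₀) = 1 := by
        ext i j
        have hi := i.2
        have hj := j.2
        have hij : i = j := Subtype.ext (Subtype.ext (hi.trans hj.symm))
        subst hij
        simp [Matrix.toSquareBlockProp, hi, h]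
      let e : A ≃ {i : (insert p₀ A : Finset ι) // ¬ (i : ι) = p₀} :=
        { toFun := fun x => ⟨⟨x, Finset.mem_insert_of_mem x.2⟩, fun hx => hA (hx ▸ x.2)⟩
          invFun := fun x => ⟨x.1, (Finset.mem_insert.1 x.1.2).resolve_left x.2⟩
          left_inv := fun x => rfl
          right_inv := fun x => rfl }
      rw [e1, Matrix.det_one, one_mul, ← Matrix.det_submatrix_equiv_self e]
      rfl
    · intro i hi j hj
      change K i j = 0
      rw [hj, h, if_neg hi]
  rw [fredholmTerm, fredholmTerm, key, Finset.card_insert_of_notMem hA, pow_succ]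
  ring

/-- If one column of `I - K` vanishes then so does the Fredholm determinant: the terms of the
series cancel in pairs. -/
lemma fredholmDet_eq_zero {K : ι → ι → ℝ} {p₀ : ι}
    (h : ∀ p, K p p₀ = if p = p₀ then 1 else 0) : fredholmDet K = 0 := by
  let e : Finset ι ≃ Finset ι := ⟨fun A => symmDiff A {p₀}, fun A => symmDiff A {p₀},
    fun A => symmDiff_symmDiff_cancel_right _ _, fun A => symmDiff_symmDiff_cancel_right _ _⟩
  have h1 : ∀ A, fredholmTerm K (e A) = -fredholmTerm K A := fun A => by
    change fredholmTerm K (symmDiff A {p₀}) = _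
    by_cases hA : p₀ ∈ A
    · have e1 : symmDiff A {p₀} = A.erase p₀ := by
        ext x
        by_cases hx : x = p₀ <;> simp [Finset.mem_symmDiff, hx, hA]
      have h2 := fredholmTerm_insert h (Finset.notMem_erase p₀ A)
      rw [Finset.insert_erase hA] at h2
      rw [e1, h2, neg_neg]
    · have e1 : symmDiff A {p₀} = insert p₀ A := by
        ext x
        by_cases hx : x = p₀ <;> simp [Finset.mem_symmDiff, hx, hA]
      rw [e1, fredholmTerm_insert h hA]
  have h2 := e.tsum_eq (fredholmTerm K)
  simp only [h1, tsum_neg] at h2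
  rw [fredholmDet]
  linarith

lemma abs_fredholmTerm_le {K : ι → ι → ℝ} {A : Finset ι} {B : ℝ}
    (h : ∀ p ∈ A, ∀ q ∈ A, |K p q| ≤ B) : |fredholmTerm K A| ≤ A.card.factorial * B ^ A.card := by
  have := Matrix.det_le (A := Matrix.of fun x y : A => K x y) (abv := IsAbsoluteValue.toAbsoluteValue (abs : ℝ → ℝ))
    (x := B) fun i j => h i i.2 j j.2
  rw [fredholmTerm, abs_mul, abs_pow, abs_neg, abs_one, one_pow, one_mul]
  simpa using this

/-- If the nonzero entries of a kernel raise the level except in rows from a set `W`, then the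
nonvanishing terms of its Fredholm series are of bounded size. -/
lemma card_le_of_fredholmTerm_ne_zero {K : ι → ι → ℝ} {lev : ι → ℕ} {m : ℕ}
    (hm : ∀ p, lev p < m) (W : Finset ι)
    (h : ∀ p q, K p q ≠ 0 → p ∉ W → lev p < lev q) {A : Finset ι}
    (hA : fredholmTerm K A ≠ 0) : A.card ≤ m * W.card := by
  obtain ⟨σ, hσ⟩ := exists_perm_of_fredholmTerm_ne_zero hA
  have h1 : ∀ p : A, lev (σ p) + 1 ≤ lev p + m * (if ((σ p : A) : ι) ∈ W then 1 else 0) :=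
    fun p => by
      split_ifs with hp
      · have := hm (σ p); omega
      · have := h _ _ (hσ p) hp; omega
  have h2 := Finset.sum_le_sum fun p (_ : p ∈ (Finset.univ : Finset A)) => h1 p
  rw [Finset.sum_add_distrib, Finset.sum_add_distrib, Equiv.sum_comp σ fun p : A => lev p,
    ← Finset.mul_sum, Equiv.sum_comp σ fun p : A => if (p : ι) ∈ W then 1 else 0] at h2
  have h3 : ∑ p : A, (if (p : ι) ∈ W then 1 else 0) ≤ W.card := by
    rw [Finset.sum_coe_sort A fun p => if p ∈ W then 1 else 0, ← Finset.card_filter]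
    exact Finset.card_le_card fun p hp => (Finset.mem_filter.1 hp).2
  have h4 : m * ∑ p : A, (if (p : ι) ∈ W then 1 else 0) ≤ m * W.card := Nat.mul_le_mul_left m h3
  simp only [Finset.sum_const, Finset.card_univ, Fintype.card_coe, smul_eq_mul, mul_one] at h2
  omega

/-- If the nonzero entries of the rows in `V` raise the level and lie in columns of `V`, then the
nonvanishing terms of the Fredholm series avoid `V`. -/
lemma notMem_of_fredholmTerm_ne_zero {K : ι → ι → ℝ} {lev : ι → ℕ} {V : Set ι}
    (h : ∀ p ∈ V, ∀ q, K p q ≠ 0 → lev p < lev q ∧ q ∈ V) {A : Finset ι}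
    (hA : fredholmTerm K A ≠ 0) {p : ι} (hp : p ∈ A) : p ∉ V := by
  classical
  intro hpV
  obtain ⟨σ, hσ⟩ := exists_perm_of_fredholmTerm_ne_zero hA
  obtain ⟨q, hq, hmax⟩ := (A.filter (· ∈ V)).exists_max_image lev
    ⟨p, Finset.mem_filter.2 ⟨hp, hpV⟩⟩
  rw [Finset.mem_filter] at hq
  have hne := hσ (σ.symm ⟨q, hq.1⟩)
  rw [Equiv.apply_symm_apply] at hne
  have h1 := h q hq.2 _ hne
  have h2 := hmax _ (Finset.mem_filter.2 ⟨(σ.symm ⟨q, hq.1⟩).2, h1.2⟩)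
  omega

end Combinatorics

section TimeZero

variable (r ℓ : ℝ) {m : ℕ} {n : Fin m → ℕ}

lemma cutKernel_time_zero (X : Config) (n : Fin m → ℕ) (a : Fin m → ℤ) (p q : Fin m × ℤ) :
    cutKernel r ℓ 0 X n a p q = (if p.2 ≤ a p.1 then 1 else 0) *
      (-(if n p.1 < n q.1 then kpow Q (n q.1 - n p.1) p.2 q.2 else 0) +
        qinv^[n p.1] (hit (Sb r ℓ 0 q.2) (n q.1) X.1) p.2) * (if q.2 ≤ a q.1 then 1 else 0) := by
  rw [cutKernel_eq, extKernel, prodKernel_time_zero]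

lemma apply_add_le (X : Config) {j k : ℕ} (h : j ≤ k) : X.1 k + k ≤ X.1 j + j := by
  induction k, h using Nat.le_induction with
  | base => exact le_rfl
  | succ k _ ih =>
    have : X.1 (k + 1) < X.1 k := X.2 (Nat.lt_succ_self k)
    push_cast
    omega

lemma fredholmDet_time_zero_of_forall (hn_pos : ∀ j, 1 ≤ n j) (hn : StrictMono n) {a : Fin m → ℤ}
    {X : Config} (h : ∀ j, a j < X.1 (n j - 1)) : fredholmDet (cutKernel r ℓ 0 X n a) = 1 := by
  refine fredholmDet_eq_one (fun p => p.1) fun p q hpq => ?_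
  rw [cutKernel_time_zero] at hpq
  by_contra hlev
  have hle : n q.1 ≤ n p.1 := hn.monotone (not_lt.1 hlev)
  refine hpq ?_
  by_cases hp : p.2 ≤ a p.1
  · rw [if_neg (show ¬ n p.1 < n q.1 by omega), qinv_hit_low, neg_zero, add_zero, mul_zero, zero_mul]
    intro k hk
    have h1 := apply_add_le X (show k ≤ n p.1 - 1 by omega)
    have h2 := h p.1
    have h3 := hn_pos p.1
    push_cast [Nat.cast_sub h3] at h1
    omega
  · rw [if_neg hp, zero_mul, zero_mul]

lemma fredholmDet_time_zero_of_exists (hn_pos : ∀ j, 1 ≤ n j) (hn : StrictMono n) {a : Fin m → ℤ}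
    {X : Config} (h : ¬ ∀ j, a j < X.1 (n j - 1)) : fredholmDet (cutKernel r ℓ 0 X n a) = 0 := by
  push Not at h
  obtain ⟨j₀, hj₀⟩ := h
  obtain ⟨j, hj, hmax⟩ := (Finset.univ.filter fun j => X.1 (n j - 1) ≤ a j).exists_max_image id
    ⟨j₀, by simpa using hj₀⟩
  have hj' : X.1 (n j - 1) ≤ a j := by simpa using hj
  have hmax' : ∀ i, j < i → a i < X.1 (n i - 1) := fun i hi => by
    by_contra hc
    exact absurd (hmax i (by simpa using hc)) (by simpa using hi)
  -- the column of the last particle that violates its bound is a unit vector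
  refine fredholmDet_eq_zero (p₀ := (j, X.1 (n j - 1))) fun p => ?_
  rw [cutKernel_time_zero]
  simp only [hj', if_true, mul_one]
  have hlast : hit (Sb r ℓ 0 (X.1 (n j - 1))) (n j) X.1 =
      fun b => kpow Q (n j) b (X.1 (n j - 1)) := by
    funext b
    have := hit_time_zero_last r ℓ (n j - 1) X.2 b
    rwa [Nat.sub_add_cancel (hn_pos j)] at this
  rcases lt_trichotomy p.1 j with hlt | heq | hgt
  · have h1 := hn hlt
    have h2 := qinv_iterate_kpow_Q (X.1 (n j - 1)) (n p.1) (n j - n p.1) p.2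
    rw [Nat.sub_add_cancel h1.le] at h2
    rw [hlast, if_pos h1, h2, neg_add_cancel, mul_zero, if_neg]
    rintro rfl
    exact hlt.false
  · have h2 := qinv_iterate_kpow_Q (X.1 (n j - 1)) (n j) 0 p.2
    rw [zero_add] at h2
    obtain ⟨i, x⟩ := p
    obtain rfl : i = j := heq
    rw [hlast, if_neg (lt_irrefl _), h2]
    by_cases hx : x = X.1 (n i - 1)
    · subst hx
      simp [kpow, hj']
    · simp [kpow, hx]
  · rw [if_neg (show p ≠ (j, X.1 (n j - 1)) by rintro rfl; exact hgt.false)]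
    have h1 := hn hgt
    by_cases hp : p.2 ≤ a p.1
    · rw [if_neg h1.not_gt, qinv_hit_low, neg_zero, add_zero, mul_zero]
      intro k hk
      have h1 := apply_add_le X (show k ≤ n p.1 - 1 by omega)
      have h2 := hmax' p.1 hgt
      have h3 := hn_pos p.1
      push_cast [Nat.cast_sub h3] at h1
      omega
    · rw [if_neg hp, zero_mul]

/-- An entry of the kernel at time zero raises the level unless its row lies within distance `N`
to the left of one of the first `N` particles. -/
lemma lt_of_cutKernel_ne_zero (hn : StrictMono n) {N : ℕ} (hN : ∀ j, n j ≤ N) {a : Fin m → ℤ}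
    {X : Config} {p q : Fin m × ℤ} (h : cutKernel r ℓ 0 X n a p q ≠ 0)
    (hp : ∀ k < N, X.1 k < p.2 ∨ p.2 + N ≤ X.1 k) : p.1 < q.1 := by
  by_contra hlev
  have hle : n q.1 ≤ n p.1 := hn.monotone (not_lt.1 hlev)
  refine h ?_
  have := hN p.1
  rw [cutKernel_time_zero, if_neg (show ¬ n p.1 < n q.1 by omega),
    (isHarmonic_Sb r ℓ 0 q.2).qinv_hit _ hle fun k hk => ?_, neg_zero, add_zero, mul_zero, zero_mul]
  have := hp k (by omega)
  omega

/-- To the left of the first `N` particles, the kernel at time zero raises the level and moves to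
the left. -/
lemma lt_of_cutKernel_ne_zero_of_low (hn : StrictMono n) {N : ℕ} (hN : ∀ j, n j ≤ N)
    {a : Fin m → ℤ} {X : Config} {p q : Fin m × ℤ} (h : cutKernel r ℓ 0 X n a p q ≠ 0)
    (hp : p.2 < X.1 (N - 1)) : p.1 < q.1 ∧ q.2 < X.1 (N - 1) := by
  have h0 : qinv^[n p.1] (hit (Sb r ℓ 0 q.2) (n q.1) X.1) p.2 = 0 := qinv_hit_low _ fun k hk => by
    have h1 := hN p.1
    have h2 := hN q.1
    have h3 := apply_add_le X (show k ≤ N - 1 by omega)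
    push_cast [Nat.cast_sub (show 1 ≤ N by omega)] at h3
    omega
  rw [cutKernel_time_zero, h0, add_zero] at h
  have h1 := right_ne_zero_of_mul (left_ne_zero_of_mul h)
  by_cases hlt : n p.1 < n q.1
  · rw [if_pos hlt] at h1
    refine ⟨hn.lt_iff_lt.1 hlt, ?_⟩
    by_contra hq
    exact h1 (by rw [kpow_Q_eq_zero _ (by omega), neg_zero])
  · simp [hlt] at h1

lemma abs_cutKernel_le (T : ℝ) {N : ℕ} (hN : ∀ j, n j ≤ N) (a : Fin m → ℤ) :
    ∃ C, 1 ≤ C ∧ ∀ t, |t| ≤ T → ∀ (X : Config) (p q : Fin m × ℤ),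
      |cutKernel r ℓ t X n a p q| ≤ C * 3 ^ (p.2.natAbs + q.2.natAbs + size N X.1) := by
  choose C hC0 hC using fun ij : Fin m × Fin m => abs_prodKernel_le r ℓ T (n ij.1) (n ij.2)
  refine ⟨1 + ∑ ij, C ij, by
    have := Finset.sum_nonneg fun ij (_ : ij ∈ Finset.univ) => hC0 ij
    linarith, fun t ht X p q => ?_⟩
  have h1 := hC (p.1, q.1) t ht X.1 p.2 q.2
  have h2 : C (p.1, q.1) ≤ ∑ ij, C ij :=
    Finset.single_le_sum (fun ij _ => hC0 ij) (Finset.mem_univ (p.1, q.1))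
  have h3 : size (n q.1) X.1 ≤ size N X.1 :=
    Finset.sum_le_sum_of_subset (Finset.range_subset_range.2 (hN q.1))
  have h4 : |(if n p.1 < n q.1 then kpow Q (n q.1 - n p.1) p.2 q.2 else 0)| ≤ 1 := by
    split_ifs
    · exact abs_kpow_Q_le _ _ _
    · simp
  have h5 : (1 : ℝ) ≤ 3 ^ (p.2.natAbs + q.2.natAbs + size N X.1) := one_le_pow₀ (by norm_num)
  have hI : ∀ P : Prop, [Decidable P] → |(if P then (1 : ℝ) else 0)| ≤ 1 := fun P _ => by
    split_ifs <;> simp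
  have h6 : |prodKernel r ℓ t (n p.1) (n q.1) X.1 p.2 q.2| ≤
      (∑ ij, C ij) * 3 ^ (p.2.natAbs + q.2.natAbs + size N X.1) := by
    refine h1.trans (mul_le_mul h2 (pow_le_pow_right₀ (by norm_num) (by simpa using h3))
      (by positivity) ((hC0 _).trans h2))
  rw [cutKernel_eq, extKernel, abs_mul, abs_mul]
  refine (mul_le_of_le_one_right (by positivity) (hI _)).trans
    ((mul_le_of_le_one_left (abs_nonneg _) (hI _)).trans ?_)
  refine (abs_add_le _ _).trans ?_
  rw [abs_neg, add_mul, one_mul]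
  exact add_le_add (h4.trans h5) h6

/-- The Fredholm series at time zero converges absolutely, with at most exponential growth in the
configuration: only boundedly many points in a window whose width is controlled by the size of the
configuration contribute. -/
lemma exists_sum_abs_fredholmTerm_le (hn : StrictMono n) {N : ℕ} (hN : ∀ j, n j ≤ N)
    (hN1 : 1 ≤ N) (a : Fin m → ℤ) : ∃ C w : ℝ, 1 ≤ w ∧ 0 ≤ C ∧
      ∀ (s : Finset (Finset (Fin m × ℤ))) (X : Config),
        ∑ A ∈ s, |fredholmTerm (cutKernel r ℓ 0 X n a) A| ≤ C * w ^ size N X.1 := by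
  obtain ⟨C, hC1, hC⟩ := abs_cutKernel_le r ℓ 0 hN a
  set b : ℕ := ∑ j, (a j).natAbs with hb
  set R : ℕ := m * (m * (N * N)) with hR
  have hC0 : 0 ≤ C := zero_le_one.trans hC1
  refine ⟨2 ^ (m * (b + 1)) * (R.factorial * (C * 9 ^ b) ^ R), 2 ^ m * 27 ^ R, ?_, by positivity,
    fun s X => ?_⟩
  · exact one_le_mul_of_one_le_of_one_le (one_le_pow₀ (by norm_num)) (one_le_pow₀ (by norm_num))
  set σ := size N X.1 with hσ
  set K := cutKernel r ℓ 0 X n a with hK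
  have ha : ∀ j, a j ≤ b := fun j => by
    have : (a j).natAbs ≤ b :=
      Finset.single_le_sum (f := fun j => (a j).natAbs) (fun _ _ => Nat.zero_le _)
        (Finset.mem_univ j)
    omega
  have hlast : -(σ : ℤ) ≤ X.1 (N - 1) := by
    have := natAbs_le_size (show N - 1 < N by omega) X.1
    omega
  -- the rows that need not raise the level
  let W : Finset (Fin m × ℤ) := Finset.univ ×ˢ
    ((Finset.range N ×ˢ Finset.range N).image fun kj => X.1 kj.1 - kj.2)
  have hW : W.card ≤ m * (N * N) := by
    rw [Finset.card_product, Finset.card_univ, Fintype.card_fin]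
    refine Nat.mul_le_mul_left m (Finset.card_image_le.trans ?_)
    simp
  -- the window that contains all points of nonvanishing terms
  let V : Finset (Fin m × ℤ) := Finset.univ ×ˢ Finset.Icc (-(σ : ℤ)) b
  have hV : V.card = m * (σ + (b + 1)) := by
    rw [Finset.card_product, Finset.card_univ, Fintype.card_fin, Int.card_Icc]
    congr 1
    omega
  have hterm : ∀ A, fredholmTerm K A ≠ 0 → A ⊆ V ∧
      |fredholmTerm K A| ≤ R.factorial * (C * 9 ^ b * 27 ^ σ) ^ R := fun A hA => by
    have hcard : A.card ≤ R := by
      refine (card_le_of_fredholmTerm_ne_zero (lev := fun p => p.1) (m := m) (fun p => p.1.2) W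
        (fun p q hpq hp => ?_) hA).trans (Nat.mul_le_mul_left m hW)
      refine lt_of_cutKernel_ne_zero r ℓ hn hN hpq fun k hk => ?_
      by_contra hc
      push Not at hc
      refine hp (Finset.mem_product.2 ⟨Finset.mem_univ _, Finset.mem_image.2
        ⟨(k, (X.1 k - p.2).toNat), ?_, ?_⟩⟩)
      · simp only [Finset.mem_product, Finset.mem_range]
        omega
      · simp only
        omega
    have hsub : A ⊆ V := fun p hp => by
      have h1 := notMem_of_fredholmTerm_ne_zero (lev := fun p => p.1)
        (V := {p : Fin m × ℤ | p.2 < X.1 (N - 1)})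
        (fun p hp q hpq => lt_of_cutKernel_ne_zero_of_low r ℓ hn hN hpq hp) hA hp
      have h2 : p.2 ≤ a p.1 := by
        obtain ⟨τ, hτ⟩ := exists_perm_of_fredholmTerm_ne_zero hA
        by_contra hc
        refine hτ ⟨p, hp⟩ ?_
        simp [hK, cutKernel, hc]
      have h3 := ha p.1
      simp only [Set.mem_ofPred_eq, not_lt] at h1
      exact Finset.mem_product.2 ⟨Finset.mem_univ _, Finset.mem_Icc.2 ⟨by omega, by omega⟩⟩
    refine ⟨hsub, ?_⟩
    have habs : ∀ p ∈ A, p.2.natAbs ≤ σ + b := fun p hp => by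
      have := Finset.mem_Icc.1 (Finset.mem_product.1 (hsub hp)).2
      omega
    have h1 : (1 : ℝ) ≤ C * 9 ^ b * 27 ^ σ :=
      one_le_mul_of_one_le_of_one_le (one_le_mul_of_one_le_of_one_le hC1
        (one_le_pow₀ (by norm_num))) (one_le_pow₀ (by norm_num))
    refine (abs_fredholmTerm_le (B := C * 9 ^ b * 27 ^ σ) fun p hp q hq => ?_).trans ?_
    · refine (hC 0 (by simp) X p q).trans ?_
      calc C * 3 ^ (p.2.natAbs + q.2.natAbs + size N X.1)
          ≤ C * 3 ^ (2 * b + 3 * σ) := by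
            have h1 := habs p hp
            have h2 := habs q hq
            exact mul_le_mul_of_nonneg_left (pow_le_pow_right₀ (by norm_num) (by omega)) hC0
        _ = C * 9 ^ b * 27 ^ σ := by
            rw [pow_add, pow_mul, pow_mul]
            norm_num
            ring
    · have h2 : (A.card.factorial : ℝ) ≤ R.factorial := by exact_mod_cast Nat.factorial_le hcard
      gcongr
  classical
  calc ∑ A ∈ s, |fredholmTerm K A|
      = ∑ A ∈ s.filter fun A => fredholmTerm K A ≠ 0, |fredholmTerm K A| := by
        refine (Finset.sum_filter_of_ne fun A _ hA => ?_).symm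
        exact abs_ne_zero.1 hA
    _ ≤ (s.filter fun A => fredholmTerm K A ≠ 0).card •
          (R.factorial * (C * 9 ^ b * 27 ^ σ) ^ R : ℝ) :=
        Finset.sum_le_card_nsmul _ _ _ fun A hA => (hterm A (Finset.mem_filter.1 hA).2).2
    _ ≤ (2 ^ (m * (σ + (b + 1))) : ℝ) * (R.factorial * (C * 9 ^ b * 27 ^ σ) ^ R) := by
        rw [nsmul_eq_mul]
        gcongr
        have : (s.filter fun A => fredholmTerm K A ≠ 0).card ≤ V.powerset.card :=
          Finset.card_le_card fun A hA =>
            Finset.mem_powerset.2 (hterm A (Finset.mem_filter.1 hA).2).1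
        rw [Finset.card_powerset, hV] at this
        exact_mod_cast this
    _ = _ := by
        rw [mul_pow (C * 9 ^ b), mul_pow (2 ^ m : ℝ), ← pow_mul (27 : ℝ) R, ← pow_mul (27 : ℝ) σ,
          ← pow_mul (2 : ℝ), mul_comm σ R, mul_add, pow_add]
        ring

end TimeZero

/-! ### The backward equation for the Fredholm determinant -/

lemma DependsOnFirst.mono {N M : ℕ} {f : Config → ℝ} (hf : DependsOnFirst N f) (h : N ≤ M) :
    DependsOnFirst M f := fun X Y hXY => hf X Y fun k hk => hXY k (hk.trans_le h)

/-- The backward equation has at most one solution. -/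
lemma IsBackwardSolution.eq {r ℓ : ℝ} (hr : 0 ≤ r) (hℓ : 0 ≤ ℓ) {m : ℕ} {n : Fin m → ℕ}
    {a : Fin m → ℤ} {u v : ℝ → Config → ℝ} (hu : IsBackwardSolution r ℓ n a u)
    (hv : IsBackwardSolution r ℓ n a v) {t : ℝ} (ht : 0 ≤ t) (X : Config) : u t X = v t X := by
  obtain ⟨N, hN⟩ := hu.cylinder t
  obtain ⟨M, hM⟩ := hv.cylinder t
  have key : ∀ w : ℝ → Config → ℝ, IsBackwardSolution r ℓ n a w →
      (∀ s ∈ Icc 0 t, DependsOnFirst (max N M) (w s)) →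
      HasSum (fun k : ℕ => t ^ k / k.factorial * genIter r ℓ (max N M) k (w 0) X) (w t X) :=
    fun w hw hdep => by
      obtain ⟨C, hC⟩ := hw.bounded t
      refine hasSum_genIter hr hℓ (C := |C|) (w := 1) le_rfl (abs_nonneg _) (fun s hs0 hst X => ?_)
        (fun s hs X => ?_) ⟨ht, le_rfl⟩ X
      · rw [← generator_eq_gen r ℓ (hdep s ⟨hs0, hst⟩)]
        exact hw.equation s hs0 X
      · rw [one_pow, mul_one]
        exact (hC s hs X).trans (le_abs_self C)
  have h0 : u 0 = v 0 := funext fun Y => by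
    by_cases h : ∀ j, a j < Y.1 (n j - 1)
    · rw [hu.initial_true Y h, hv.initial_true Y h]
    · rw [hu.initial_false Y h, hv.initial_false Y h]
  have h1 := key u hu fun s hs => (hN s hs).mono (le_max_left _ _)
  have h2 := key v hv fun s hs => (hM s hs).mono (le_max_right _ _)
  rw [h0] at h1
  exact h1.unique h2

section

variable {r ℓ : ℝ} {m : ℕ} {n : Fin m → ℕ} {N : ℕ}

/-- At fixed `A` the term grows at most exponentially in the configuration, so the Taylor expansion
applies to it. -/
lemma hasSum_fredholmTerm (hr : 0 ≤ r) (hℓ : 0 ≤ ℓ) (hN : ∀ j, n j ≤ N) (a : Fin m → ℤ)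
    {t : ℝ} (ht : 0 ≤ t) (X : Config) (A : Finset (Fin m × ℤ)) :
    HasSum (fun k : ℕ => t ^ k / k.factorial *
      genIter r ℓ N k (fun Y => fredholmTerm (cutKernel r ℓ 0 Y n a) A) X)
      (fredholmTerm (cutKernel r ℓ t X n a) A) := by
  obtain ⟨C, hC1, hC⟩ := abs_cutKernel_le r ℓ t hN a
  set b : ℕ := ∑ p ∈ A, p.2.natAbs with hb
  have hC0 : 0 ≤ C := zero_le_one.trans hC1
  refine hasSum_genIter hr hℓ (u := fun s Y => fredholmTerm (cutKernel r ℓ s Y n a) A)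
    (C := A.card.factorial * (C * 9 ^ b) ^ A.card) (w := 3 ^ A.card) (one_le_pow₀ (by norm_num))
    (by positivity) (fun s _ _ Y => (fredholmTerm_hasDerivAt r ℓ s Y a hN A).hasDerivWithinAt)
    (fun s hs Y => ?_) ⟨ht, le_rfl⟩ X
  refine (abs_fredholmTerm_le (B := C * 9 ^ b * 3 ^ size N Y.1) fun p hp q hq => ?_).trans
    (le_of_eq ?_)
  · have h1 : ∀ p ∈ A, p.2.natAbs ≤ b := fun p hp =>
      Finset.single_le_sum (f := fun p : Fin m × ℤ => p.2.natAbs) (fun _ _ => Nat.zero_le _) hp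
    have h2 := h1 p hp
    have h3 := h1 q hq
    refine (hC s (abs_le.2 ⟨by linarith [hs.1], hs.2⟩) Y p q).trans ?_
    calc C * 3 ^ (p.2.natAbs + q.2.natAbs + size N Y.1) ≤ C * 3 ^ (2 * b + size N Y.1) :=
          mul_le_mul_of_nonneg_left (pow_le_pow_right₀ (by norm_num) (by omega)) hC0
      _ = C * 9 ^ b * 3 ^ size N Y.1 := by
          rw [pow_add, pow_mul]
          norm_num
          ring
  · rw [mul_pow (C * 9 ^ b), ← pow_mul, ← pow_mul, mul_comm (size N Y.1)]
    ring

lemma summable_fredholmTerm_and_fredholmDet_eq (hr : 0 ≤ r) (hℓ : 0 ≤ ℓ) (hn : StrictMono n)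
    (hN : ∀ j, n j ≤ N) (hN1 : 1 ≤ N) (a : Fin m → ℤ) {t : ℝ} (ht : 0 ≤ t) (X : Config) :
    Summable (fredholmTerm (cutKernel r ℓ t X n a)) ∧ fredholmDet (cutKernel r ℓ t X n a) =
      semigroup r ℓ N t (fun Y => fredholmDet (cutKernel r ℓ 0 Y n a)) X := by
  obtain ⟨C, w, hw, hC, hb⟩ := exists_sum_abs_fredholmTerm_le r ℓ hn hN hN1 a
  exact tsum_eq_semigroup hr hℓ hw hC (f := fun A Y => fredholmTerm (cutKernel r ℓ 0 Y n a) A)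
    hb (hasSum_fredholmTerm hr hℓ hN a ht X)

lemma dependsOnFirst_fredholmDet (hN : ∀ j, n j ≤ N) (a : Fin m → ℤ) (t : ℝ) :
    DependsOnFirst N fun X => fredholmDet (cutKernel r ℓ t X n a) := fun X Y h => by
  simp only [dependsOnFirst_cutKernel r ℓ t a hN h]

lemma abs_fredholmDet_time_zero_le (hn_pos : ∀ j, 1 ≤ n j) (hn : StrictMono n) (a : Fin m → ℤ)
    (X : Config) : |fredholmDet (cutKernel r ℓ 0 X n a)| ≤ 1 := by
  by_cases h : ∀ j, a j < X.1 (n j - 1)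
  · rw [fredholmDet_time_zero_of_forall r ℓ hn_pos hn h, abs_one]
  · rw [fredholmDet_time_zero_of_exists r ℓ hn_pos hn h, abs_zero]
    exact zero_le_one

lemma isBackwardSolution_fredholmDet (hr : 0 ≤ r) (hℓ : 0 ≤ ℓ) (hn_pos : ∀ j, 1 ≤ n j)
    (hn : StrictMono n) (hN : ∀ j, n j ≤ N) (hN1 : 1 ≤ N) (a : Fin m → ℤ) :
    IsBackwardSolution r ℓ n a fun t X => fredholmDet (cutKernel r ℓ t X n a) := by
  have hF := fun (t : ℝ) (ht : 0 ≤ t) X =>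
    (summable_fredholmTerm_and_fredholmDet_eq hr hℓ hn hN hN1 a ht X).2
  have hF0 := abs_fredholmDet_time_zero_le (r := r) (ℓ := ℓ) hn_pos hn a
  refine ⟨fun T => ⟨N, fun t _ => dependsOnFirst_fredholmDet hN a t⟩,
    fun T => ⟨1 * Real.exp (T * genBound r ℓ N 1), fun t ht X => ?_⟩, fun t ht X => ?_,
    fun X h => fredholmDet_time_zero_of_forall r ℓ hn_pos hn h,
    fun X h => fredholmDet_time_zero_of_exists r ℓ hn_pos hn h⟩
  · rw [hF t ht.1]
    exact abs_semigroup_le hr hℓ zero_le_one hF0 (abs_le.2 ⟨by linarith [ht.1, ht.2], ht.2⟩) X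
  · rw [generator_eq_gen r ℓ (dependsOnFirst_fredholmDet hN a t),
      show (fun X => fredholmDet (cutKernel r ℓ t X n a)) =
        semigroup r ℓ N t fun Y => fredholmDet (cutKernel r ℓ 0 Y n a) from funext (hF t ht)]
    exact (semigroup_hasDerivAt hr hℓ zero_le_one hF0 t X).hasDerivWithinAt.congr
      (fun s hs => hF s hs X) (hF t ht X)

end

/-! ### Expectations of cylinder functions of the process -/

lemma DependsOnFirst.measurable {N : ℕ} {f : Config → ℝ} (hf : DependsOnFirst N f) :
    Measurable f := by
  classical
  let π : Config → Fin N → ℤ := fun X k => X.1 k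
  have hπ : Measurable π := measurable_pi_lambda _ fun k =>
    (measurable_pi_apply (k : ℕ)).comp measurable_subtype_coe
  have hfac : Function.FactorsThrough f π := fun X Y h => hf X Y fun k hk => congrFun h ⟨k, hk⟩
  have e : f = Function.extend π f (fun _ => 0) ∘ π := by
    funext X
    exact (hfac.extend_apply _ X).symm
  rw [e]
  exact (Measurable.of_discrete).comp hπ

section Expectation

variable {r ℓ : ℝ} {X₀ : Config} {Ω : Type*} [mΩ : MeasurableSpace Ω] {P : Measure Ω}
  {𝓕 : Filtration ℝ≥0 mΩ} {X : ℝ≥0 → Ω → Config}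

lemma IsPushASEP.measurable (h : IsPushASEP r ℓ X₀ P 𝓕 X) (t : ℝ≥0) : Measurable (X t) :=
  Measurable.subtype_mk (measurable_pi_lambda _ fun k => (h.adapted t k).mono (𝓕.le t) le_rfl)

/-- Joint measurability, from right-continuity of the paths: the process is the limit of its
values at the next point of a fine grid. -/
lemma IsPushASEP.measurable_uncurry (h : IsPushASEP r ℓ X₀ P 𝓕 X) {N : ℕ} {f : Config → ℝ}
    (hf : DependsOnFirst N f) : Measurable fun p : ℝ × Ω => f (X p.1.toNNReal p.2) := by
  let grid : ℕ → ℝ≥0 → ℝ≥0 := fun i s => ((⌊s * (i + 1)⌋₊ + 1 : ℕ) : ℝ≥0) / (i + 1)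
  have hgt : ∀ i s, s < grid i s := fun i s => by
    rw [lt_div_iff₀ (by positivity)]
    exact_mod_cast Nat.lt_floor_add_one (s * (i + 1))
  have hle : ∀ i s, grid i s ≤ s + 1 / (i + 1) := fun i s => by
    rw [div_le_iff₀ (by positivity), add_mul, one_div, inv_mul_cancel₀ (by positivity)]
    push_cast
    gcongr
    exact Nat.floor_le (by positivity)
  have hlim : ∀ s, Tendsto (fun i => grid i s) atTop (𝓝[>] s) := fun s => by
    refine tendsto_nhdsWithin_iff.2 ⟨?_, Eventually.of_forall fun i => hgt i s⟩
    refine tendsto_of_tendsto_of_tendsto_of_le_of_le tendsto_const_nhds ?_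
      (fun i => (hgt i s).le) (fun i => hle i s)
    simpa using (tendsto_const_nhds (x := s)).add
      (tendsto_one_div_add_atTop_nhds_zero_nat (𝕜 := ℝ≥0))
  refine measurable_of_tendsto_metrizable
    (f := fun i (p : ℝ × Ω) => f (X (grid i p.1.toNNReal) p.2)) (fun i => ?_) ?_
  · have h1 : Measurable fun q : ℕ × Ω => f (X (((q.1 + 1 : ℕ) : ℝ≥0) / (i + 1)) q.2) :=
      measurable_from_prod_countable_right fun k =>
        hf.measurable.comp (h.measurable (((k + 1 : ℕ) : ℝ≥0) / (i + 1)))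
    have h2 : Measurable fun p : ℝ × Ω => ((⌊p.1.toNNReal * (i + 1)⌋₊, p.2) : ℕ × Ω) := by
      fun_prop
    exact h1.comp h2
  · rw [tendsto_pi_nhds]
    intro p
    refine tendsto_const_nhds.congr' ?_
    have h1 : ∀ᶠ s in 𝓝[>] p.1.toNNReal, ∀ k ∈ Finset.range N,
        (X s p.2).1 k = (X p.1.toNNReal p.2).1 k :=
      (Filter.eventually_all_finset _).2 fun k _ => h.right_continuous p.2 _ k
    filter_upwards [(hlim p.1.toNNReal).eventually h1] with i hi
    exact hf _ _ fun k hk => (hi k (Finset.mem_range.2 hk)).symm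

variable [IsProbabilityMeasure P]

/-- Dynkin's formula. -/
lemma IsPushASEP.integral_eq (h : IsPushASEP r ℓ X₀ P 𝓕 X) {N : ℕ} {f : Config → ℝ}
    (hf : DependsOnFirst N f) {C C' : ℝ} (hC : ∀ Y, |f Y| ≤ C) (hC' : ∀ Y, |gen r ℓ N f Y| ≤ C')
    (t : ℝ≥0) : ∫ ω, f (X t ω) ∂P =
      f X₀ + ∫ s in (0 : ℝ)..t, ∫ ω, gen r ℓ N f (X s.toNNReal ω) ∂P := by
  have hm := h.martingale f ⟨⟨N, hf⟩, C, hC⟩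
  rw [generator_eq_gen r ℓ hf] at hm
  have hg := dependsOnFirst_gen r ℓ hf
  have h1 := hm.setIntegral_eq (zero_le (a := t)) MeasurableSet.univ
  simp only [Measure.restrict_univ, NNReal.coe_zero, intervalIntegral.integral_same, sub_zero] at h1
  have hint : Integrable (Function.uncurry fun (s : ℝ) ω => gen r ℓ N f (X s.toNNReal ω))
      ((volume.restrict (Ioc (0 : ℝ) t)).prod P) :=
    Integrable.of_bound (h.measurable_uncurry hg).aestronglyMeasurable C'
      (Eventually.of_forall fun p => hC' _)
  have hfint : Integrable (fun ω => f (X t ω)) P :=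
    Integrable.of_bound (hf.measurable.comp (h.measurable t)).aestronglyMeasurable C
      (Eventually.of_forall fun ω => hC _)
  have hI : Integrable (fun ω => ∫ s in (0 : ℝ)..t, gen r ℓ N f (X s.toNNReal ω)) P := by
    simp only [intervalIntegral.integral_of_le t.coe_nonneg]
    exact hint.integral_prod_right
  have h0 : ∫ ω, f (X 0 ω) ∂P = f X₀ := by
    rw [integral_congr_ae (g := fun _ => f X₀) (by
      filter_upwards [h.initial] with ω hω
      rw [hω])]
    simp
  have hswap : ∫ ω, (∫ s in (0 : ℝ)..t, gen r ℓ N f (X s.toNNReal ω)) ∂P =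
      ∫ s in (0 : ℝ)..t, ∫ ω, gen r ℓ N f (X s.toNNReal ω) ∂P := by
    simp only [intervalIntegral.integral_of_le t.coe_nonneg]
    exact (integral_integral_swap hint).symm
  rw [h0, integral_sub hfint hI, hswap] at h1
  linarith

/-- The expectation of a cylinder function is the exponential series of the generator. -/
lemma IsPushASEP.integral_eq_semigroup (hr : 0 ≤ r) (hℓ : 0 ≤ ℓ) (h : IsPushASEP r ℓ X₀ P 𝓕 X)
    {N : ℕ} {f : Config → ℝ} (hf : DependsOnFirst N f) {C : ℝ} (hC0 : 0 ≤ C)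
    (hC : ∀ Y, |f Y| ≤ C) (t : ℝ≥0) : ∫ ω, f (X t ω) ∂P = semigroup r ℓ N t f X₀ := by
  set L := genBound r ℓ N 1
  set φ : ℕ → Config → ℝ := fun k => genIter r ℓ N k f with hφ
  have hφs : ∀ k, φ (k + 1) = gen r ℓ N (φ k) := fun k => genIter_succ r ℓ N k f
  have hdep : ∀ k, DependsOnFirst N (φ k) := dependsOnFirst_genIter hf
  have hb : ∀ k Y, |φ k Y| ≤ C * L ^ k := abs_genIter_le_of_bounded hr hℓ hC0 hC
  let g : ℕ → ℝ → ℝ := fun k s => ∫ ω, φ k (X s.toNNReal ω) ∂P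
  have hgb : ∀ k s, |g k s| ≤ C * L ^ k := fun k s => by
    have := norm_integral_le_of_norm_le_const (μ := P) (f := fun ω => φ k (X s.toNNReal ω))
      (Eventually.of_forall fun ω => hb k _)
    simpa using this
  have hgm : ∀ k, StronglyMeasurable (g k) := fun k =>
    (h.measurable_uncurry (hdep k)).stronglyMeasurable.integral_prod_right
  have hgi : ∀ k a b, IntervalIntegrable (g k) volume a b := fun k a b => by
    have h1 : IntegrableOn (g k) (Ioc (min a b) (max a b)) volume :=
      Integrable.of_bound (hgm k).aestronglyMeasurable _ (Eventually.of_forall fun s => hgb k s)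
    exact intervalIntegrable_iff.2 h1
  have hdyn : ∀ k s, 0 ≤ s → g k s = φ k X₀ + ∫ v in (0 : ℝ)..s, g (k + 1) v := fun k s hs => by
    have := h.integral_eq (hdep k) (hb k) (fun Y => by rw [← hφs]; exact hb (k + 1) Y) s.toNNReal
    rw [Real.coe_toNNReal s hs, ← hφs] at this
    exact this
  have hcont : ∀ k, Continuous (g k) := fun k => by
    have h1 : Continuous fun s => φ k X₀ + ∫ v in (0 : ℝ)..max s 0, g (k + 1) v :=
      continuous_const.add ((intervalIntegral.continuous_primitive (hgi (k + 1)) 0).comp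
        (continuous_id.max continuous_const))
    have e : g k = fun s => φ k X₀ + ∫ v in (0 : ℝ)..max s 0, g (k + 1) v := funext fun s => by
      rw [← hdyn k _ (le_max_right s 0)]
      have : (max s 0).toNNReal = s.toNNReal := by
        rcases le_total s 0 with hs | hs
        · rw [max_eq_right hs, Real.toNNReal_of_nonpos hs, Real.toNNReal_zero]
        · rw [max_eq_left hs]
      simp only [g, this]
    rw [e]
    exact h1
  have hder : ∀ k, ∀ s ∈ Icc (0 : ℝ) t, HasDerivWithinAt (g k) (g (k + 1) s) (Ici 0) s :=
    fun k s hs => by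
      have h1 := ((hcont (k + 1)).integral_hasStrictDerivAt 0 s).hasDerivAt.const_add (φ k X₀)
      exact h1.hasDerivWithinAt.congr (fun v hv => hdyn k v hv) (hdyn k s hs.1)
  have hsum := hasSum_taylor hder (fun k s _ => hgb k s) (t := t) ⟨t.coe_nonneg, le_rfl⟩
  have h0 : ∀ k, g k 0 = φ k X₀ := fun k => by simpa using hdyn k 0 le_rfl
  simp only [h0] at hsum
  have e : g 0 t = ∫ ω, f (X t ω) ∂P := by
    simp only [g, Real.toNNReal_coe]
    rfl
  rw [← e]
  exact hsum.tsum_eq.symm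

end Expectation

end

end PushASEP

theorem mainTheorem2 (r ℓ : ℝ) (hr : 0 ≤ r) (hℓ : 0 ≤ ℓ) {m : ℕ} (n : Fin m → ℕ)
    (hn_pos : ∀ j, 1 ≤ n j) (hn : StrictMono n) (a : Fin m → ℤ) :
    -- the contour integral formulas
    (∀ (t : ℝ) (k : ℕ) (z₁ z₂ : ℤ) (ρ : ℝ), 0 ≤ t → 0 < ρ → ρ < 1 →
      (PushASEP.S r ℓ t k z₁ z₂ : ℂ) = PushASEP.SContour r ℓ t k z₁ z₂ ρ ∧
      (1 ≤ k → (PushASEP.Sbar r ℓ t k z₁ z₂ : ℂ) = PushASEP.SbarContour r ℓ t k z₁ z₂ ρ)) ∧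
    -- the kernel and its Fredholm series converge absolutely
    (∀ (t : ℝ) (X : PushASEP.Config), 0 ≤ t →
      (∀ (i j : Fin m) (z₁ z₂ : ℤ), Summable fun y : ℤ =>
        PushASEP.S r ℓ t (n i) y z₁ * PushASEP.SbarEpi r ℓ t X (n j) y z₂) ∧
      Summable (PushASEP.fredholmTerm (PushASEP.cutKernel r ℓ t X n a))) ∧
    -- the determinant solves the backward equation
    PushASEP.IsBackwardSolution r ℓ n a
      (fun t X => PushASEP.fredholmDet (PushASEP.cutKernel r ℓ t X n a)) ∧
    -- uniqueness
    (∀ u : ℝ → PushASEP.Config → ℝ, PushASEP.IsBackwardSolution r ℓ n a u →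
      ∀ (t : ℝ) (X : PushASEP.Config), 0 ≤ t →
        u t X = PushASEP.fredholmDet (PushASEP.cutKernel r ℓ t X n a)) ∧
    -- the multipoint probabilities of the process
    (∀ {Ω : Type*} [mΩ : MeasurableSpace Ω] (P : Measure Ω) [IsProbabilityMeasure P]
      (𝓕 : Filtration ℝ≥0 mΩ) (X₀ : PushASEP.Config) (X : ℝ≥0 → Ω → PushASEP.Config),
      PushASEP.IsPushASEP r ℓ X₀ P 𝓕 X → ∀ t : ℝ≥0,
        P.real {ω | ∀ j, a j < (X t ω).1 (n j - 1)} =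
          PushASEP.fredholmDet (PushASEP.cutKernel r ℓ t X₀ n a)) := by
  -- a positive bound for the labels, also when there are none
  have hN : ∀ j, n j ≤ 1 + ∑ i, n i := fun j =>
    (Finset.single_le_sum (fun _ _ => Nat.zero_le _) (Finset.mem_univ j)).trans
      (Nat.le_add_left _ _)
  have hN1 : 1 ≤ 1 + ∑ i, n i := Nat.le_add_right _ _
  have hsol := PushASEP.isBackwardSolution_fredholmDet hr hℓ hn_pos hn hN hN1 a
  refine ⟨fun t k z₁ z₂ ρ _ hρ hρ1 => ⟨PushASEP.S_eq_SContour hρ r ℓ t k z₁ z₂,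
      fun hk => PushASEP.Sbar_eq_SbarContour hρ hρ1 r ℓ t hk z₁ z₂⟩,
    fun t X ht => ⟨fun i j z₁ z₂ => ?_,
      (PushASEP.summable_fredholmTerm_and_fredholmDet_eq hr hℓ hn hN hN1 a ht X).1⟩,
    hsol, fun u hu t X ht => hu.eq hr hℓ hsol ht X, ?_⟩
  · simp only [PushASEP.SbarEpi_eq_hit]
    exact PushASEP.summable_S_mul_hit r ℓ t (n i) (n j) X.1 z₁ z₂
  · intro Ω mΩ P _ 𝓕 X₀ X h t
    have hdep := PushASEP.dependsOnFirst_fredholmDet (r := r) (ℓ := ℓ) hN a 0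
    rw [(PushASEP.summable_fredholmTerm_and_fredholmDet_eq hr hℓ hn hN hN1 a t.coe_nonneg X₀).2,
      ← h.integral_eq_semigroup hr hℓ hdep zero_le_one
        (PushASEP.abs_fredholmDet_time_zero_le hn_pos hn a) t]
    have hmeas : MeasurableSet {ω | ∀ j, a j < (X t ω).1 (n j - 1)} := by
      simp only [Set.ofPred_forall]
      exact MeasurableSet.iInter fun j => measurableSet_lt measurable_const
        ((h.adapted t (n j - 1)).mono (𝓕.le t) le_rfl)
    rw [← integral_indicator_one hmeas]
    refine integral_congr_ae (Eventually.of_forall fun ω => ?_)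
    by_cases hω : ∀ j, a j < (X t ω).1 (n j - 1)
    · rw [Set.indicator_of_mem (show ω ∈ {ω | ∀ j, a j < (X t ω).1 (n j - 1)} from hω)]
      exact (PushASEP.fredholmDet_time_zero_of_forall r ℓ hn_pos hn hω).symm
    · rw [Set.indicator_of_notMem (show ω ∉ {ω | ∀ j, a j < (X t ω).1 (n j - 1)} from hω)]
      exact (PushASEP.fredholmDet_time_zero_of_exists r ℓ hn_pos hn hω).symm
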